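/- Let $k\ge 1$ and let $Q$ be a smooth, Hausdorff, second countable $n$-manifold. For $m\ge 0$ let $T^mQ$ be the bundle of $m$-jets at $0$ of smooth curves in $Q$, with natural coordinates $(q_0^A,\dots,q_m^A)$, $q_i=\frac{d^i}{dt^i}\big|_{0}$, and let $\rho\colon T^{2k-1}Q\to T^{k-1}Q$ be the projection. For $L\in C^\infty(T^kQ)$ put, in natural coordinates, $$p^{r}_A=\sum_{i=0}^{k-1-r}(-1)^i d_T^i\Big(\frac{\partial L}{\partial q^A_{r+1+i}}\Big)\ (0\le r\le k-1),\qquad \theta_L=\sum_{r=0}^{k-1}p^r_A\,dq_r^A,\qquad \omega_L=-d\theta_L,\qquad E_L=\sum_{r=0}^{k-1}q_{r+1}^A\,p^{r}_A-L,$$ where $d_Tf=\sum_i q_{i+1}^A\,\partial f/\partial q_i^A$ (sums over $A$ understood). Assume that $L$ is regular, i.e. that $\omega_L$ is a symplectic form on $T^{2k-1}Q$, and let $X_L$ be the vector field on $T^{2k-1}Q$ with $i(X_L)\omega_L=dE_L$. Let $s$ be a smooth section of $\rho$ and put $X_s:=T\rho\circ X_L\circ s$, a vector field on $T^{k-1}Q$.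 A pair $(s,X)$, with $X$ a smooth vector field on $T^{k-1}Q$, is a solution of the generalized $k$th-order Lagrangian Hamilton–Jacobi problem if, for every integral curve $\gamma$ of $X$ (defined on an open interval), $s\circ\gamma$ is an integral curve of $X_L$. **(A)** For every smooth vector field $X$ on $T^{k-1}Q$ the following are equivalent: 1. $(s,X)$ is a solution of the generalized $k$th-order Lagrangian Hamilton–Jacobi problem; 2. $X$ and $X_L$ are $s$-related: $X_L\circ s=Ts\circ X$; 3. $X=X_s$ and $X_L$ is tangent to $\operatorname{Im}s$; 4. $X=X_s$ and $\operatorname{Im}s$ is invariant by the (local) flow of $X_L$; 5. the integral curves of $X_L$ that have an initial condition in $\operatorname{Im}s$ project by $\rho$ to integral curves of $X$; 6. $X=X_s$ and $i(X)(s^*\omega_L)=d(s^*E_L)$. **(B)** For the section alone, the following are equivalent: $(s,X)$ is a solution of the generalized problem for some smooth $X$; $X_L$ is tangent to $\operatorname{Im}s$; $\operatorname{Im}s$ is invariant by the flow of $X_L$; $i(X_s)(s^*\omega_L)=d(s^*E_L)$. **(C)** The following are equivalent: 1. $s$ is a solution of the $k$th-order Lagrangian Hamilton–Jacobi problem, i.e.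 $(s,X)$ solves the generalized problem for some smooth $X$, and $s^*\omega_L=0$; 2. $\operatorname{Im}s$ is a Lagrangian submanifold of $(T^{2k-1}Q,\omega_L)$ to which $X_L$ is tangent, and near every point of $T^{k-1}Q$ it has a local generating function, i.e. a smooth function $S$ on an open set $U$ with $s^*\theta_L=dS$ on $U$; 3. $\operatorname{Im}s$ is a Lagrangian submanifold of $(T^{2k-1}Q,\omega_L)$ that is invariant by the flow of $X_L$; 4. $s^*\omega_L=0$ and $d(s^*E_L)=0$; 5. $s^*\omega_L=0$ and $E_L\circ s$ is locally constant. -/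

import Mathlib

open Set Filter
open scoped Manifold ContDiff Topology

namespace HJ

section JetCalculus
variable {V : Type*} [NormedAddCommGroup V] [NormedSpace ℝ V]
  {W : Type*} [NormedAddCommGroup W] [NormedSpace ℝ W]

/-! Calculus needed to make jets of curves into a manifold. -/

theorem iteratedDeriv_pair_deriv {c : ℝ → V} (hc : ContDiffAt ℝ ∞ c 0) (i : ℕ) :
    iteratedDeriv i (fun t => (c t, deriv c t)) 0
      = (iteratedDeriv i c 0, iteratedDeriv (i + 1) c 0) := by
  have hd : ContDiffAt ℝ ∞ (deriv c) 0 := by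
    have := hc.fderiv_right (m := ∞) (by simp)
    exact this.clm_apply contDiffAt_const
  have hp : ContDiffAt ℝ i (fun t => (c t, deriv c t)) 0 :=
    (hc.prodMk hd).of_le (by exact_mod_cast le_top)
  have h1 := (ContinuousLinearMap.fst ℝ V V).iteratedFDeriv_comp_left hp (i := i) le_rfl
  have h2 := (ContinuousLinearMap.snd ℝ V V).iteratedFDeriv_comp_left hp (i := i) le_rfl
  ext
  · have := congrArg (fun f => f (fun _ => (1 : ℝ))) h1
    simpa [iteratedDeriv, Function.comp_def] using this.symm
  · have := congrArg (fun f => f (fun _ => (1 : ℝ))) h2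
    rw [iteratedDeriv_succ']
    simpa [iteratedDeriv, Function.comp_def] using this.symm

theorem deriv_comp_eventuallyEq {F : V → W} {c : ℝ → V} (hc : ContDiffAt ℝ ∞ c 0)
    (hF : ContDiffAt ℝ ∞ F (c 0)) :
    deriv (F ∘ c) =ᶠ[𝓝 0]
      (fun x : V × V => fderiv ℝ F x.1 x.2) ∘ (fun t => (c t, deriv c t)) := by
  have h1 : ∀ᶠ t in 𝓝 (0 : ℝ), ContDiffAt ℝ 1 c t :=
    (hc.of_le (m := 1) (by exact_mod_cast le_top)).eventually (by simp)
  have h2 : ∀ᶠ t in 𝓝 (0 : ℝ), ContDiffAt ℝ 1 F (c t) :=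
    hc.continuousAt.eventually
      ((hF.of_le (m := 1) (by exact_mod_cast le_top)).eventually (by simp))
  filter_upwards [h1, h2] with t ht1 ht2
  simpa using fderiv_comp_deriv t (ht2.differentiableAt one_ne_zero)
    (ht1.differentiableAt one_ne_zero)

/-- Composition with a smooth map preserves contact of curves. -/
theorem iteratedDeriv_comp_congr (m : ℕ) : ∀ {V : Type*} [NormedAddCommGroup V]
    [NormedSpace ℝ V] {F : V → W} {c d : ℝ → V},
    ContDiffAt ℝ ∞ c 0 → ContDiffAt ℝ ∞ d 0 → ContDiffAt ℝ ∞ F (c 0) →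
    (∀ i ≤ m, iteratedDeriv i c 0 = iteratedDeriv i d 0) →
    iteratedDeriv m (F ∘ c) 0 = iteratedDeriv m (F ∘ d) 0 := by
  induction m with
  | zero =>
    intro V _ _ F c d _ _ _ h
    have := h 0 le_rfl
    simp only [iteratedDeriv_zero] at this
    simp [this]
  | succ m ih =>
    intro V _ _ F c d hc hd hF h
    have h0 : c 0 = d 0 := by simpa using h 0 (Nat.zero_le _)
    have hF' : ContDiffAt ℝ ∞ F (d 0) := h0 ▸ hF
    rw [iteratedDeriv_succ', iteratedDeriv_succ',
      (deriv_comp_eventuallyEq hc hF).iteratedDeriv_eq m,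
      (deriv_comp_eventuallyEq hd hF').iteratedDeriv_eq m]
    have key : ∀ {e : ℝ → V}, ContDiffAt ℝ ∞ e 0 →
        ContDiffAt ℝ ∞ (fun t => (e t, deriv e t)) 0 := fun he =>
      he.prodMk ((he.fderiv_right (m := ∞) (by simp)).clm_apply contDiffAt_const)
    apply ih (key hc) (key hd)
    · have : ContDiffAt ℝ ∞ (fderiv ℝ F) (c 0) := hF.fderiv_right (m := ∞) (by simp)
      exact (ContDiffAt.comp (c 0, deriv c 0) this contDiffAt_fst).clm_apply contDiffAt_snd
    · intro i hi
      rw [iteratedDeriv_pair_deriv hc, iteratedDeriv_pair_deriv hd, h i (by omega),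
        h (i + 1) (by omega)]

theorem contDiffOn_iteratedDeriv_param (i : ℕ) : ∀ {G : V × ℝ → W} {U : Set (V × ℝ)},
    IsOpen U → ContDiffOn ℝ ∞ G U →
    ContDiffOn ℝ ∞ (fun v => iteratedDeriv i (fun t => G (v, t)) 0) {v | (v, (0 : ℝ)) ∈ U} := by
  induction i with
  | zero =>
    intro G U hU hG
    simp only [iteratedDeriv_zero]
    exact hG.comp (by fun_prop) (fun v hv => hv)
  | succ i ih =>
    intro G U hU hG
    have h := ih (G := fun x => fderiv ℝ G x (0, 1)) hU
      ((hG.fderiv_of_isOpen (m := ∞) hU (by simp)).clm_apply contDiffOn_const)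
    refine h.congr fun v hv => ?_
    rw [iteratedDeriv_succ']
    apply Filter.EventuallyEq.iteratedDeriv_eq
    have hc : ContinuousAt (fun t : ℝ => (v, t)) 0 := by fun_prop
    filter_upwards [hc.eventually (hU.mem_nhds hv)] with t ht
    have hGd : HasFDerivAt G (fderiv ℝ G (v, t)) (v, t) :=
      ((hG.contDiffAt (hU.mem_nhds ht)).differentiableAt (by simp)).hasFDerivAt
    have hl : HasDerivAt (fun t : ℝ => (v, t)) (0, 1) t :=
      (hasDerivAt_const t v).prodMk (hasDerivAt_id t)
    exact (hGd.comp_hasDerivAt t hl).deriv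

/-- The polynomial curve with prescribed derivatives at time zero. -/
noncomputable def jetPoly {m : ℕ} (v : Fin (m + 1) → V) (t : ℝ) : V :=
  ∑ i : Fin (m + 1), (t ^ (i : ℕ) / ((i : ℕ).factorial : ℝ)) • v i

theorem contDiff_jetPoly_uncurry {m : ℕ} :
    ContDiff ℝ ∞ (fun x : (Fin (m + 1) → V) × ℝ => jetPoly x.1 x.2) := by
  unfold jetPoly
  fun_prop

theorem contDiff_jetPoly {m : ℕ} (v : Fin (m + 1) → V) : ContDiff ℝ ∞ (jetPoly v) := by
  unfold jetPoly
  fun_prop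

theorem jetPoly_zero {m : ℕ} (v : Fin (m + 1) → V) : jetPoly v 0 = v 0 := by
  unfold jetPoly
  rw [Fin.sum_univ_succ]
  simp

theorem iteratedDeriv_jetPoly {m : ℕ} (v : Fin (m + 1) → V) (j : Fin (m + 1)) :
    iteratedDeriv j (jetPoly v) 0 = v j := by
  have h : iteratedDeriv (j : ℕ) (jetPoly v) 0 = ∑ i : Fin (m + 1),
      iteratedDeriv (j : ℕ) (fun t : ℝ => (t ^ (i : ℕ) / ((i : ℕ).factorial : ℝ)) • v i) 0 := by
    unfold jetPoly
    rw [iteratedDeriv_fun_sum]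
    intro i _
    exact ContDiff.contDiffAt (by fun_prop)
  rw [h, Finset.sum_eq_single j]
  · rw [iteratedDeriv_smul_const (by fun_prop), iteratedDeriv_div_const]
    simp [Nat.descFactorial_self, Nat.factorial_ne_zero]
  · intro i _ hij
    have hne : (j : ℕ) ≠ (i : ℕ) := fun h => hij (Fin.ext h.symm)
    rw [iteratedDeriv_smul_const (by fun_prop), iteratedDeriv_div_const,
      iteratedDeriv_fun_pow_zero, if_neg hne]
    simp
  · simp
end JetCalculus

section HigherTangentBundle

/-- Natural coordinates `(q_0, …, q_m)`, `q_i ∈ ℝⁿ`, of the `m`-th order tangent bundle. -/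
abbrev JetCoord (n m : ℕ) := Fin (m + 1) → EuclideanSpace ℝ (Fin n)

variable (n m : ℕ) (Q : Type*) [TopologicalSpace Q] [ChartedSpace (EuclideanSpace ℝ (Fin n)) Q]

/-- Curves in `Q` that are smooth at time zero. -/
def SmoothCurve := {γ : ℝ → Q // ContMDiffAt 𝓘(ℝ, ℝ) (𝓡 n) ∞ γ 0}

/-- Contact of order `m` at time zero: same base point, and the same derivatives up to order `m`
in every chart around it. -/
def contactSetoid : Setoid (SmoothCurve n Q) where
  r γ δ := γ.1 0 = δ.1 0 ∧ ∀ φ ∈ atlas (EuclideanSpace ℝ (Fin n)) Q, γ.1 0 ∈ φ.source →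
    ∀ i ≤ m, iteratedDeriv i (φ ∘ γ.1) 0 = iteratedDeriv i (φ ∘ δ.1) 0
  iseqv := by
    refine ⟨fun _ => ⟨rfl, fun _ _ _ _ _ => rfl⟩, fun h => ⟨h.1.symm, fun φ hφ h' i hi =>
      (h.2 φ hφ (h.1 ▸ h') i hi).symm⟩, fun h₁ h₂ => ⟨h₁.1.trans h₂.1, fun φ hφ h' i hi =>
      (h₁.2 φ hφ h' i hi).trans (h₂.2 φ hφ (h₁.1 ▸ h') i hi)⟩⟩

/-- The `m`-th order tangent bundle `T^m Q`: the `m`-jets at time zero of smooth curves in `Q`. -/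
def HigherTangent := Quotient (contactSetoid n m Q)

variable {n m Q}

/-- The base point in `Q` of a jet. -/
def HigherTangent.base : HigherTangent n m Q → Q :=
  Quotient.lift (fun γ => γ.1 0) fun _ _ h => h.1

/-- The natural projection `ρ^m_l : T^m Q → T^l Q`, for `l ≤ m`. -/
def HigherTangent.proj {l : ℕ} (h : l ≤ m) : HigherTangent n m Q → HigherTangent n l Q :=
  Quotient.lift (fun γ => Quotient.mk (contactSetoid n l Q) γ) fun _ _ hγ =>
    Quotient.sound ⟨hγ.1, fun φ hφ h' i hi => hγ.2 φ hφ h' i (hi.trans h)⟩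

/-- Natural coordinates of a jet in the chart of `Q` at `a`: the derivatives
`q_i = (d/dt)^i (φ ∘ γ) (0)`, for `0 ≤ i ≤ m`. -/
noncomputable def natCoord (a : Q) (z : HigherTangent n m Q) : JetCoord n m := fun i =>
  iteratedDeriv i (chartAt (EuclideanSpace ℝ (Fin n)) a ∘ (Quotient.out z).1) 0

theorem out_contact (z : HigherTangent n m Q) (γ : SmoothCurve n Q)
    (h : Quotient.mk (contactSetoid n m Q) γ = z) :
    (contactSetoid n m Q).r (Quotient.out z) γ :=
  Quotient.exact ((Quotient.out_eq z).trans h.symm)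

theorem base_eq_out (z : HigherTangent n m Q) : z.base = (Quotient.out z).1 0 := by
  conv_lhs => rw [← Quotient.out_eq z]
  rfl

theorem natCoord_mk (a : Q) (γ : SmoothCurve n Q)
    (h : γ.1 0 ∈ (chartAt (EuclideanSpace ℝ (Fin n)) a).source) (i : Fin (m + 1)) :
    natCoord a (Quotient.mk (contactSetoid n m Q) γ) i
      = iteratedDeriv i (chartAt (EuclideanSpace ℝ (Fin n)) a ∘ γ.1) 0 := by
  have hc := out_contact _ γ (rfl : Quotient.mk (contactSetoid n m Q) γ = _)
  exact hc.2 _ (chart_mem_atlas _ a) (hc.1 ▸ h) i (Nat.lt_succ_iff.1 i.2)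

theorem natCoord_zero (a : Q) (z : HigherTangent n m Q) :
    natCoord a z 0 = chartAt (EuclideanSpace ℝ (Fin n)) a z.base := by
  simp [natCoord, base_eq_out]

variable [IsManifold (𝓡 n) ∞ Q]

theorem contDiffAt_chart_comp (a : Q) (γ : SmoothCurve n Q)
    (h : γ.1 0 ∈ (chartAt (EuclideanSpace ℝ (Fin n)) a).source) :
    ContDiffAt ℝ ∞ (chartAt (EuclideanSpace ℝ (Fin n)) a ∘ γ.1) 0 := by
  rw [← contMDiffAt_iff_contDiffAt]
  have := (contMDiffAt_of_mem_maximalAtlas (I := 𝓡 n) (n := ∞)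
    (IsManifold.chart_mem_maximalAtlas a) h)
  exact this.comp 0 γ.2

theorem contMDiffAt_chart_symm_comp (a : Q) {c : ℝ → EuclideanSpace ℝ (Fin n)}
    (hc : ContDiffAt ℝ ∞ c 0) (h : c 0 ∈ (chartAt (EuclideanSpace ℝ (Fin n)) a).target) :
    ContMDiffAt 𝓘(ℝ, ℝ) (𝓡 n) ∞ ((chartAt (EuclideanSpace ℝ (Fin n)) a).symm ∘ c) 0 := by
  have := (contMDiffAt_symm_of_mem_maximalAtlas (I := 𝓡 n) (n := ∞)
    (IsManifold.chart_mem_maximalAtlas a) h)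
  exact this.comp 0 hc.contMDiffAt

open Classical in
/-- A curve whose jet has prescribed natural coordinates in the chart at `a`. -/
noncomputable def polyCurve (a : Q) (v : JetCoord n m) : SmoothCurve n Q :=
  if h : v 0 ∈ (chartAt (EuclideanSpace ℝ (Fin n)) a).target then
    ⟨(chartAt (EuclideanSpace ℝ (Fin n)) a).symm ∘ jetPoly v,
      contMDiffAt_chart_symm_comp a (contDiff_jetPoly v).contDiffAt (by rwa [jetPoly_zero])⟩
  else ⟨fun _ => (chartAt (EuclideanSpace ℝ (Fin n)) a).symm (v 0), contMDiffAt_const⟩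

theorem polyCurve_coe (a : Q) {v : JetCoord n m}
    (h : v 0 ∈ (chartAt (EuclideanSpace ℝ (Fin n)) a).target) :
    (polyCurve a v).1 = (chartAt (EuclideanSpace ℝ (Fin n)) a).symm ∘ jetPoly v := by
  simp [polyCurve, h]

theorem contDiffOn_transition (φ ψ : OpenPartialHomeomorph Q (EuclideanSpace ℝ (Fin n)))
    (hφ : φ ∈ atlas (EuclideanSpace ℝ (Fin n)) Q) (hψ : ψ ∈ atlas (EuclideanSpace ℝ (Fin n)) Q)
    : ContDiffOn ℝ ∞ (ψ ∘ φ.symm) (φ.symm ≫ₕ ψ).source := by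
  have h := HasGroupoid.compatible (G := contDiffGroupoid ∞ (𝓡 n)) hφ hψ
  exact contMDiffOn_iff_contDiffOn.1 (contMDiffOn_of_mem_contDiffGroupoid h)

theorem mk_polyCurve_natCoord (a : Q) (z : HigherTangent n m Q)
    (hz : z.base ∈ (chartAt (EuclideanSpace ℝ (Fin n)) a).source) :
    Quotient.mk (contactSetoid n m Q) (polyCurve a (natCoord a z)) = z := by
  set φ := chartAt (EuclideanSpace ℝ (Fin n)) a with hφ
  have hv : natCoord a z 0 ∈ φ.target := by
    rw [natCoord_zero]
    exact φ.map_source hz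
  have hz' : (Quotient.out z).1 0 ∈ φ.source := by rwa [base_eq_out] at hz
  conv_rhs => rw [← Quotient.out_eq z]
  have h0 : (polyCurve a (natCoord a z)).1 0 = (Quotient.out z).1 0 := by
    rw [polyCurve_coe a hv]
    simp [jetPoly_zero, natCoord_zero, ← hφ, base_eq_out, φ.left_inv hz']
  refine Quotient.sound ⟨h0, fun ψ hψ hs i hi => ?_⟩
  rw [h0] at hs
  have hc := contDiffAt_chart_comp a (Quotient.out z) hz'
  have hF : ContDiffAt ℝ ∞ (ψ ∘ φ.symm) (φ ((Quotient.out z).1 0)) := by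
    refine (contDiffOn_transition φ ψ (chart_mem_atlas _ a) hψ).contDiffAt
      ((φ.symm ≫ₕ ψ).open_source.mem_nhds ?_)
    simp [φ.map_source hz', φ.left_inv hz', hs]
  have hev : ψ ∘ (Quotient.out z).1 =ᶠ[𝓝 0] (ψ ∘ φ.symm) ∘ (φ ∘ (Quotient.out z).1) := by
    filter_upwards [(Quotient.out z).2.continuousAt.eventually (φ.open_source.mem_nhds hz')]
      with t ht
    simp [φ.left_inv ht]
  have hp0 : jetPoly (natCoord a z) 0 = φ ((Quotient.out z).1 0) := by
    rw [jetPoly_zero, natCoord_zero, base_eq_out]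
  rw [polyCurve_coe a hv, hev.iteratedDeriv_eq i]
  change iteratedDeriv i ((ψ ∘ φ.symm) ∘ jetPoly (natCoord a z)) 0 = _
  refine iteratedDeriv_comp_congr i (contDiff_jetPoly _).contDiffAt hc (hp0 ▸ hF) ?_
  intro j hj
  exact iteratedDeriv_jetPoly (natCoord a z) ⟨j, by omega⟩

theorem natCoord_mk_polyCurve (a b : Q) (v : JetCoord n m)
    (hv : v 0 ∈ (chartAt (EuclideanSpace ℝ (Fin n)) a).target)
    (hb : (chartAt (EuclideanSpace ℝ (Fin n)) a).symm (v 0)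
      ∈ (chartAt (EuclideanSpace ℝ (Fin n)) b).source) (i : Fin (m + 1)) :
    natCoord b (Quotient.mk (contactSetoid n m Q) (polyCurve a v)) i
      = iteratedDeriv i (fun t => (chartAt (EuclideanSpace ℝ (Fin n)) b ∘
          (chartAt (EuclideanSpace ℝ (Fin n)) a).symm) (jetPoly v t)) 0 := by
  rw [natCoord_mk, polyCurve_coe a hv]
  · rfl
  · rw [polyCurve_coe a hv]
    simpa [jetPoly_zero] using hb

/-- The natural chart of `T^m Q` over the chart of `Q` at `a`. -/
noncomputable def natChart (a : Q) : PartialEquiv (HigherTangent n m Q) (JetCoord n m) where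
  toFun := natCoord a
  invFun v := Quotient.mk (contactSetoid n m Q) (polyCurve a v)
  source := {z | z.base ∈ (chartAt (EuclideanSpace ℝ (Fin n)) a).source}
  target := {v | v 0 ∈ (chartAt (EuclideanSpace ℝ (Fin n)) a).target}
  map_source' z hz := by
    simp only [mem_ofPred_eq] at hz ⊢
    rw [natCoord_zero]
    exact (chartAt (EuclideanSpace ℝ (Fin n)) a).map_source hz
  map_target' v hv := by
    simp only [mem_ofPred_eq] at hv ⊢
    change (polyCurve a v).1 0 ∈ (chartAt (EuclideanSpace ℝ (Fin n)) a).source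
    rw [polyCurve_coe a hv]
    simpa [jetPoly_zero] using (chartAt (EuclideanSpace ℝ (Fin n)) a).map_target hv
  left_inv' z hz := mk_polyCurve_natCoord a z hz
  right_inv' v hv := by
    funext i
    have hs := (chartAt (EuclideanSpace ℝ (Fin n)) a).map_target hv
    rw [natCoord_mk_polyCurve a a v hv hs]
    have hev : (fun t => (chartAt (EuclideanSpace ℝ (Fin n)) a ∘
        (chartAt (EuclideanSpace ℝ (Fin n)) a).symm) (jetPoly v t)) =ᶠ[𝓝 0] jetPoly v := by
      have hc : ContinuousAt (jetPoly v) 0 := (contDiff_jetPoly v).continuous.continuousAt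
      filter_upwards [hc.eventually ((chartAt (EuclideanSpace ℝ (Fin n)) a).open_target.mem_nhds
        (by rw [jetPoly_zero]; exact hv))] with t ht
      simp [(chartAt (EuclideanSpace ℝ (Fin n)) a).right_inv ht]
    rw [hev.iteratedDeriv_eq]
    exact iteratedDeriv_jetPoly v i

theorem natChart_trans_source (a b : Q) :
    ((natChart (n := n) (m := m) a).symm.trans (natChart b)).source = {v : JetCoord n m | v 0 ∈
      ((chartAt (EuclideanSpace ℝ (Fin n)) a).symm ≫ₕ
        chartAt (EuclideanSpace ℝ (Fin n)) b).source} := by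
  ext v
  simp only [PartialEquiv.trans_source, PartialEquiv.symm_source, mem_inter_iff, mem_preimage,
    OpenPartialHomeomorph.trans_source, OpenPartialHomeomorph.symm_source, mem_ofPred_eq]
  change (v 0 ∈ (chartAt (EuclideanSpace ℝ (Fin n)) a).target ∧
    (polyCurve a v).1 0 ∈ (chartAt (EuclideanSpace ℝ (Fin n)) b).source) ↔ _
  refine and_congr_right fun hv => ?_
  rw [polyCurve_coe a hv]
  simp [jetPoly_zero]

theorem isOpen_natChart_trans_source (a b : Q) :
    IsOpen ((natChart (n := n) (m := m) a).symm.trans (natChart b)).source := by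
  rw [natChart_trans_source]
  exact (OpenPartialHomeomorph.open_source _).preimage (continuous_apply 0)

theorem contDiffOn_natChart_trans (a b : Q) :
    ContDiffOn ℝ ∞ ((natChart (n := n) (m := m) a).symm.trans (natChart b))
      ((natChart (n := n) (m := m) a).symm.trans (natChart b)).source := by
  rw [natChart_trans_source, contDiffOn_pi]
  intro i
  set φ := chartAt (EuclideanSpace ℝ (Fin n)) a with hφ
  set ψ := chartAt (EuclideanSpace ℝ (Fin n)) b with hψ
  have h := contDiffOn_iteratedDeriv_param (V := JetCoord n m) (W := EuclideanSpace ℝ (Fin n)) i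
    (G := fun x => (ψ ∘ φ.symm) (jetPoly x.1 x.2))
    (U := (fun x : JetCoord n m × ℝ => jetPoly x.1 x.2) ⁻¹' (φ.symm ≫ₕ ψ).source)
    ((φ.symm ≫ₕ ψ).open_source.preimage contDiff_jetPoly_uncurry.continuous)
    ((contDiffOn_transition φ ψ (chart_mem_atlas _ a) (chart_mem_atlas _ b)).comp
      contDiff_jetPoly_uncurry.contDiffOn (fun _ hx => hx))
  have hset : {v : JetCoord n m | (v, (0 : ℝ)) ∈
      (fun x : JetCoord n m × ℝ => jetPoly x.1 x.2) ⁻¹' (φ.symm ≫ₕ ψ).source}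
      = {v | v 0 ∈ (φ.symm ≫ₕ ψ).source} := by
    ext v
    simp only [mem_ofPred_eq, mem_preimage, jetPoly_zero]
  rw [hset] at h
  refine h.congr fun v hv => ?_
  have hv' : v 0 ∈ φ.target ∧ φ.symm (v 0) ∈ ψ.source := by
    simpa [OpenPartialHomeomorph.trans_source] using hv
  exact natCoord_mk_polyCurve a b v hv'.1 hv'.2 i

variable (n m Q) in
/-- The atlas of natural charts. -/
noncomputable def higherTangentCore :
    ChartedSpaceCore (JetCoord n m) (HigherTangent n m Q) where
  atlas := range natChart
  chartAt z := natChart z.base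
  mem_chart_source z := mem_chart_source (EuclideanSpace ℝ (Fin n)) z.base
  chart_mem_atlas z := mem_range_self _
  open_source := by
    rintro _ _ ⟨a, rfl⟩ ⟨b, rfl⟩
    exact isOpen_natChart_trans_source a b
  continuousOn_toFun := by
    rintro _ _ ⟨a, rfl⟩ ⟨b, rfl⟩
    exact (contDiffOn_natChart_trans a b).continuousOn

noncomputable instance instTopHigherTangent : TopologicalSpace (HigherTangent n m Q) :=
  (higherTangentCore n m Q).toTopologicalSpace

noncomputable instance instChartedHigherTangent :
    ChartedSpace (JetCoord n m) (HigherTangent n m Q) :=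
  (higherTangentCore n m Q).toChartedSpace

instance instManifoldHigherTangent :
    IsManifold 𝓘(ℝ, JetCoord n m) ∞ (HigherTangent n m Q) := by
  refine isManifold_of_contDiffOn _ _ _ fun e e' he he' => ?_
  obtain ⟨_, ⟨_, rfl⟩, _, ⟨⟨a, rfl⟩, rfl⟩, he⟩ := he
  obtain ⟨_, ⟨_, rfl⟩, _, ⟨⟨b, rfl⟩, rfl⟩, he'⟩ := he'
  rw [mem_singleton_iff] at he he'
  subst he he'
  have h := contDiffOn_natChart_trans (n := n) (m := m) (Q := Q) a b
  simp only [modelWithCornersSelf_coe, modelWithCornersSelf_coe_symm, Function.id_comp,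
    Function.comp_id, preimage_id, range_id, inter_univ]
  exact h

end HigherTangentBundle

section ManifoldNotions

variable {V : Type*} [NormedAddCommGroup V] [NormedSpace ℝ V]
  {M : Type*} [TopologicalSpace M] [ChartedSpace V M]
  {W : Type*} [NormedAddCommGroup W] [NormedSpace ℝ W]
  {N : Type*} [TopologicalSpace N] [ChartedSpace W N]

/-- The differential `df` of a real function on a manifold, as a 1-form. -/
noncomputable def differential (f : M → ℝ) (z : M) : TangentSpace 𝓘(ℝ, V) z →ₗ[ℝ] ℝ :=
  (mfderiv 𝓘(ℝ, V) 𝓘(ℝ, ℝ) f z).toLinearMap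

/-- The tangent map `T_x f` between the tangent spaces at `x` and at `f x`. -/
noncomputable def tangentAt (f : M → N) (x : M) :
    TangentSpace 𝓘(ℝ, V) x →ₗ[ℝ] TangentSpace 𝓘(ℝ, W) (f x) :=
  (mfderiv 𝓘(ℝ, V) 𝓘(ℝ, W) f x).toLinearMap

/-- Wedge product of two covectors: `(α ∧ β)(v, w) = α(v) β(w) - β(v) α(w)`. -/
def wedge {T : Type*} [AddCommGroup T] [Module ℝ T] (α β : T →ₗ[ℝ] ℝ) :
    T →ₗ[ℝ] T →ₗ[ℝ] ℝ :=
  α.smulRight β - β.smulRight α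

/-- The pull-back `f^* θ` of a 1-form. -/
noncomputable def pullbackOne (f : M → N) (θ : (z : N) → TangentSpace 𝓘(ℝ, W) z →ₗ[ℝ] ℝ) (x : M) :
    TangentSpace 𝓘(ℝ, V) x →ₗ[ℝ] ℝ :=
  (θ (f x)).comp (tangentAt f x)

/-- The pull-back `f^* Ω` of a 2-form. -/
noncomputable def pullbackTwo (f : M → N)
    (Ω : (z : N) → TangentSpace 𝓘(ℝ, W) z →ₗ[ℝ] TangentSpace 𝓘(ℝ, W) z →ₗ[ℝ] ℝ) (x : M) :
    TangentSpace 𝓘(ℝ, V) x →ₗ[ℝ] TangentSpace 𝓘(ℝ, V) x →ₗ[ℝ] ℝ :=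
  (Ω (f x)).compl₁₂ (tangentAt f x) (tangentAt f x)

/-- A smooth vector field. -/
def IsSmoothVF [IsManifold 𝓘(ℝ, V) ∞ M] (X : (x : M) → TangentSpace 𝓘(ℝ, V) x) : Prop :=
  ContMDiff 𝓘(ℝ, V) 𝓘(ℝ, V).tangent ∞ (fun x => (⟨x, X x⟩ : TangentBundle 𝓘(ℝ, V) M))

/-- `f` sends the integral curves of `X` (on open intervals) to integral curves of `Y`. -/
def MapsIntegralCurves (f : M → N) (X : (x : M) → TangentSpace 𝓘(ℝ, V) x)
    (Y : (z : N) → TangentSpace 𝓘(ℝ, W) z) : Prop :=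
  ∀ (γ : ℝ → M) (J : Set ℝ), IsOpen J → J.OrdConnected →
    IsMIntegralCurveOn γ X J → IsMIntegralCurveOn (f ∘ γ) Y J

/-- `X` and `Y` are `f`-related: `Y ∘ f = T f ∘ X`. -/
def AreRelated (f : M → N) (X : (x : M) → TangentSpace 𝓘(ℝ, V) x)
    (Y : (z : N) → TangentSpace 𝓘(ℝ, W) z) : Prop :=
  ∀ x, Y (f x) = tangentAt f x (X x)

/-- `Y` is tangent to the image of the immersion `f`. -/
def IsTangentToImage (f : M → N) (Y : (z : N) → TangentSpace 𝓘(ℝ, W) z) : Prop :=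
  ∀ x : M, Y (f x) ∈ LinearMap.range (tangentAt (V := V) f x)

/-- `S` is invariant by the (local) flow of `Y`: an integral curve of `Y` on an open interval
that meets `S` stays in `S`. -/
def IsFlowInvariant (S : Set N) (Y : (z : N) → TangentSpace 𝓘(ℝ, W) z) : Prop :=
  ∀ (σ : ℝ → N) (J : Set ℝ), IsOpen J → J.OrdConnected → IsMIntegralCurveOn σ Y J →
    ∀ t₀ ∈ J, σ t₀ ∈ S → ∀ t ∈ J, σ t ∈ S

/-- `p` sends the integral curves of `Y` that start in `S` to integral curves of `X`. -/
def ProjectsIntegralCurves (p : N → M) (S : Set N) (Y : (z : N) → TangentSpace 𝓘(ℝ, W) z)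
    (X : (x : M) → TangentSpace 𝓘(ℝ, V) x) : Prop :=
  ∀ (σ : ℝ → N) (J : Set ℝ), IsOpen J → J.OrdConnected → IsMIntegralCurveOn σ Y J →
    ∀ t₀ ∈ J, σ t₀ ∈ S → IsMIntegralCurveOn (p ∘ σ) X J

/-- The image of the embedding `f` is Lagrangian for the 2-form `Ω`: each of its tangent spaces
is equal to its own `Ω`-orthogonal. -/
def IsLagrangianImage (f : M → N)
    (Ω : (z : N) → TangentSpace 𝓘(ℝ, W) z →ₗ[ℝ] TangentSpace 𝓘(ℝ, W) z →ₗ[ℝ] ℝ) : Prop :=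
  ∀ (x : M) (v : TangentSpace 𝓘(ℝ, W) (f x)),
    v ∈ LinearMap.range (tangentAt (V := V) f x) ↔
      ∀ u ∈ LinearMap.range (tangentAt (V := V) f x), Ω (f x) v u = 0

/-- Every point has an open neighbourhood `U` with a smooth function `S` on `U` such that
`θ = dS` on `U`. -/
def HasLocalPotentials (θ : (x : M) → TangentSpace 𝓘(ℝ, V) x →ₗ[ℝ] ℝ) : Prop :=
  ∀ x : M, ∃ (U : Set M) (S : M → ℝ), IsOpen U ∧ x ∈ U ∧
    ContMDiffOn 𝓘(ℝ, V) 𝓘(ℝ, ℝ) ∞ S U ∧ ∀ y ∈ U, θ y = differential S y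

end ManifoldNotions

section Lagrangian

variable {n : ℕ}

/-- `∂f/∂q_j^A` in natural coordinates. -/
noncomputable def partialCoord {m : ℕ} (f : JetCoord n m → ℝ) (j : Fin (m + 1)) (A : Fin n) :
    JetCoord n m → ℝ := fun u =>
  fderiv ℝ f u (Pi.single j (EuclideanSpace.single A 1))

/-- The total time derivative
`d_T f (q_0, …, q_{m+1}) = ∑ i, q_{i+1} ∂f/∂q_i (q_0, …, q_m)`, for `0 ≤ i ≤ m`. -/
noncomputable def totalDeriv {m : ℕ} (f : JetCoord n m → ℝ) : JetCoord n (m + 1) → ℝ := fun u =>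
  ∑ i : Fin (m + 1), ∑ A : Fin n, u i.succ A * partialCoord f i A (fun j => u j.castSucc)

/-- The iterated total time derivative `d_T^i`. -/
noncomputable def totalDerivIter {m : ℕ} (f : JetCoord n m → ℝ) :
    (i : ℕ) → JetCoord n (m + i) → ℝ
  | 0 => f
  | i + 1 => totalDeriv (totalDerivIter f i)

/-- The projection `(q_0, …, q_m) ↦ (q_0, …, q_l)`. -/
def truncCoord {l m : ℕ} (h : l ≤ m) (u : JetCoord n m) : JetCoord n l := fun i =>
  u (Fin.castLE (Nat.succ_le_succ h) i)

variable {k : ℕ} {Q : Type*} [TopologicalSpace Q] [ChartedSpace (EuclideanSpace ℝ (Fin n)) Q]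
  [IsManifold (𝓡 n) ∞ Q]

/-- The Lagrangian in the natural coordinates over the chart of `Q` at `a`. -/
noncomputable def localLagrangian (L : HigherTangent n k Q → ℝ) (a : Q) : JetCoord n k → ℝ :=
  L ∘ (natChart a).symm

/-- The function `∑ i, (-1)^i d_T^i (∂L/∂q_{r+1+i}^A)`, for `0 ≤ i ≤ k - (r + 1)`, on the domain
of `T^{2k-1} Q` over the chart of `Q` at `a`: the momentum conjugate to `q_r^A`. -/
noncomputable def momentum (L : HigherTangent n k Q → ℝ) (a : Q) (r : Fin k) (A : Fin n)
    (z : HigherTangent n (2 * k - 1) Q) : ℝ :=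
  ∑ i : Fin (k - r), (-1) ^ (i : ℕ) *
    totalDerivIter (partialCoord (localLagrangian L a) ⟨r + 1 + i, by omega⟩ A) i
      (truncCoord (by omega) (natCoord a z))

/-- The coordinate function `q_j^A` over the chart of `Q` at `a`. -/
noncomputable def coordFun {m : ℕ} (a : Q) (j : Fin (m + 1)) (A : Fin n)
    (z : HigherTangent n m Q) : ℝ :=
  natCoord a z j A

/-- The Poincaré-Cartan 1-form `θ_L = ∑ p_r^A dq_r^A`. The expression does not depend on the
chart; at each point the preferred one is used. -/
noncomputable def thetaL (L : HigherTangent n k Q → ℝ) (z : HigherTangent n (2 * k - 1) Q) :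
    TangentSpace 𝓘(ℝ, JetCoord n (2 * k - 1)) z →ₗ[ℝ] ℝ :=
  ∑ r : Fin k, ∑ A : Fin n, momentum L z.base r A z •
    differential (coordFun z.base ⟨r, by omega⟩ A) z

/-- The Poincaré-Cartan 2-form `ω_L = -dθ_L = ∑ -dp_r^A ∧ dq_r^A`, with
`dp_r^A = ∑ i, (-1)^i d_T^i d(∂L/∂q_{r+1+i}^A)`. -/
noncomputable def omegaL (L : HigherTangent n k Q → ℝ) (z : HigherTangent n (2 * k - 1) Q) :
    TangentSpace 𝓘(ℝ, JetCoord n (2 * k - 1)) z →ₗ[ℝ]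
      TangentSpace 𝓘(ℝ, JetCoord n (2 * k - 1)) z →ₗ[ℝ] ℝ :=
  ∑ r : Fin k, ∑ A : Fin n, -wedge (differential (momentum L z.base r A) z)
    (differential (coordFun z.base ⟨r, by omega⟩ A) z)

/-- The Lagrangian energy
`E_L = ∑ r, q_r^A ∑ i, (-1)^i d_T^i (∂L/∂q_{r+i}^A) - L`, for `1 ≤ r ≤ k`, `0 ≤ i ≤ k - r`. -/
noncomputable def energyL (hk : 1 ≤ k) (L : HigherTangent n k Q → ℝ)
    (z : HigherTangent n (2 * k - 1) Q) : ℝ :=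
  (∑ r : Fin k, ∑ A : Fin n,
    coordFun z.base ⟨r + 1, by omega⟩ A z * momentum L z.base r A z)
    - L (z.proj (by omega : k ≤ 2 * k - 1))

/-- The Lagrangian is regular: `ω_L`, which is exact, is nondegenerate, that is, symplectic. -/
def IsRegularLagrangian (L : HigherTangent n k Q → ℝ) : Prop :=
  ∀ (z : HigherTangent n (2 * k - 1) Q) (v : TangentSpace 𝓘(ℝ, JetCoord n (2 * k - 1)) z),
    (∀ w, omegaL L z v w = 0) → v = 0

open Classical in
/-- The Lagrangian vector field: the solution `X_L` of `i(X_L) ω_L = dE_L`, which exists and is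
unique when the Lagrangian is regular. -/
noncomputable def lagrangianVF (hk : 1 ≤ k) (L : HigherTangent n k Q → ℝ)
    (z : HigherTangent n (2 * k - 1) Q) : TangentSpace 𝓘(ℝ, JetCoord n (2 * k - 1)) z :=
  if h : ∃ v : TangentSpace 𝓘(ℝ, JetCoord n (2 * k - 1)) z,
    omegaL L z v = differential (energyL hk L) z then h.choose else 0

/-- The projection `ρ : T^{2k-1} Q → T^{k-1} Q`. -/
def rho (z : HigherTangent n (2 * k - 1) Q) : HigherTangent n (k - 1) Q :=
  z.proj (by omega : k - 1 ≤ 2 * k - 1)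

/-- The vector field `T ρ ∘ X_L ∘ s` on `T^{k-1} Q` associated with a section `s` of `ρ`: the
tangent vector on the right lives at `ρ (s x)`, which is the point `x`. -/
noncomputable def associatedVF (hk : 1 ≤ k) (L : HigherTangent n k Q → ℝ)
    (s : HigherTangent n (k - 1) Q → HigherTangent n (2 * k - 1) Q) (hs : ∀ x, rho (s x) = x)
    (x : HigherTangent n (k - 1) Q) : TangentSpace 𝓘(ℝ, JetCoord n (k - 1)) x :=
  hs x ▸ tangentAt rho (s x) (lagrangianVF hk L (s x))

end Lagrangian

end HJ

open HJ

namespace HJ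

/-! ### Derivatives in time of maps depending on a parameter -/

section ParametricDerivatives

variable {V : Type*} [NormedAddCommGroup V] [NormedSpace ℝ V]
  {W : Type*} [NormedAddCommGroup W] [NormedSpace ℝ W]

/-! The Hamilton–Jacobi equivalences rest on four facts: `ω_L` is nondegenerate, the fibres of `ρ`
are isotropic (`omegaL_vertical`), `X_L` is smooth (`isSmoothVF_lagrangianVF`), and an integral
curve of `X_L` is determined by its projection (`eq_of_rho_comp_eventuallyEq`).

Every condition of (A) and (B) is compared with the single relation `X_L ∘ s = Ts ∘ X_s`. Since `Tρ
∘ Ts = id`, a field related to `X_L` can only be `X_s`, and tangency to the image is the same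
relation. A flow-invariant image gives tangency by differentiating `s ∘ ρ ∘ σ = σ`; conversely,
relatedness gives invariance by uniqueness of integral curves and connectedness of the time
interval. For the symplectic condition, the vector `Ts X_s - X_L` is always vertical, and `i(X_s)
s^*ω_L = d(s^*E_L)` says that it is orthogonal to the image. Vertical vectors and the image together
span, and vertical vectors are orthogonal to each other, so nondegeneracy forces it to vanish
(`eq_zero_of_vertical`). The same argument shows that an isotropic section is Lagrangian, with no
dimension count.

Condition 5 of (A) does not presuppose `X = X_s`. Two integral curves of `X_L` with the same
projection agree, because `X_L` is a semispray: each coordinate `q_{i+1}` is the velocity of `q_i`.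
This brings a projected integral curve back into the image of `s`. In (C), `s^*ω_L = 0` reduces the
symplectic condition to `d(s^*E_L) = 0`, and local generating functions come from the Poincaré
lemma.

The analytic work is in `X_L`. The forms are written at each point in that point's own chart, so
their independence of the chart has to be proved. Along a curve the momenta solve the downward
recursion `p_r = ∂L/∂q_{r+1} - (d/dt) p_{r+1}` with `p_k = 0`, and the Jacobian of a prolonged
change of coordinates consists of Leibniz coefficients that obey a matching recursion
(`ostrogradsky_transform`). This makes `θ_L` natural; `ω_L` follows by exterior differentiation, and
`E_L` by pairing `θ_L` with the jet of the velocity. The semispray property comes from solving the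
equation of motion in the coordinates `(q, p)` (`semispray_of_localOmega_eq`). -/

theorem iteratedDeriv_succ_param {G : V × ℝ → W} {U : Set (V × ℝ)} (hU : IsOpen U)
    (hG : ContDiffOn ℝ ∞ G U) (i : ℕ) {v : V} (hv : (v, (0 : ℝ)) ∈ U) :
    iteratedDeriv (i + 1) (fun t => G (v, t)) 0
      = iteratedDeriv i (fun t => fderiv ℝ G (v, t) (0, 1)) 0 := by
  rw [iteratedDeriv_succ']
  apply Filter.EventuallyEq.iteratedDeriv_eq
  have hc : ContinuousAt (fun t : ℝ => (v, t)) 0 := by fun_prop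
  filter_upwards [hc.eventually (hU.mem_nhds hv)] with t ht
  have hGd : HasFDerivAt G (fderiv ℝ G (v, t)) (v, t) :=
    ((hG.contDiffAt (hU.mem_nhds ht)).differentiableAt (by simp)).hasFDerivAt
  have hl : HasDerivAt (fun t : ℝ => (v, t)) (0, 1) t :=
    (hasDerivAt_const t v).prodMk (hasDerivAt_id t)
  exact (hGd.comp_hasDerivAt t hl).deriv

/-- Derivatives in the parameter commute with derivatives in time. -/
theorem fderiv_iteratedDeriv_param (i : ℕ) : ∀ {G : V × ℝ → W} {U : Set (V × ℝ)},
    IsOpen U → ContDiffOn ℝ ∞ G U → ∀ {v : V} (h : V), (v, (0 : ℝ)) ∈ U →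
    fderiv ℝ (fun v => iteratedDeriv i (fun t => G (v, t)) 0) v h
      = iteratedDeriv i (fun t => fderiv ℝ G (v, t) (h, 0)) 0 := by
  induction i with
  | zero =>
    intro G U hU hG v h hv
    simp only [iteratedDeriv_zero]
    have hGd : HasFDerivAt G (fderiv ℝ G (v, 0)) (v, 0) :=
      ((hG.contDiffAt (hU.mem_nhds hv)).differentiableAt (by simp)).hasFDerivAt
    have hl : HasFDerivAt (fun v : V => (v, (0 : ℝ))) (ContinuousLinearMap.inl ℝ V ℝ) v :=
      hasFDerivAt_prodMk_left v 0
    have := (hGd.comp v hl).fderiv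
    change fderiv ℝ (G ∘ fun v : V => (v, (0 : ℝ))) v h = _
    rw [this]
    rfl
  | succ i ih =>
    intro G U hU hG v h hv
    have hD : ContDiffOn ℝ ∞ (fderiv ℝ G) U := hG.fderiv_of_isOpen (m := ∞) hU (by simp)
    have hev : (fun v => iteratedDeriv (i + 1) (fun t => G (v, t)) 0) =ᶠ[𝓝 v]
        fun v => iteratedDeriv i (fun t => fderiv ℝ G (v, t) (0, 1)) 0 := by
      have hc : ContinuousAt (fun v : V => (v, (0 : ℝ))) v := by fun_prop
      filter_upwards [hc.eventually (hU.mem_nhds hv)] with v' hv'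
      exact iteratedDeriv_succ_param hU hG i hv'
    rw [hev.fderiv_eq, ih (G := fun x => fderiv ℝ G x (0, 1)) hU
      (hD.clm_apply contDiffOn_const) h hv, iteratedDeriv_succ']
    apply Filter.EventuallyEq.iteratedDeriv_eq
    have hc : ContinuousAt (fun t : ℝ => (v, t)) 0 := by fun_prop
    filter_upwards [hc.eventually (hU.mem_nhds hv)] with t ht
    have hDd : HasFDerivAt (fderiv ℝ G) (fderiv ℝ (fderiv ℝ G) (v, t)) (v, t) :=
      ((hD.contDiffAt (hU.mem_nhds ht)).differentiableAt (by simp)).hasFDerivAt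
    have hl : HasDerivAt (fun t : ℝ => (v, t)) (0, 1) t :=
      (hasDerivAt_const t v).prodMk (hasDerivAt_id t)
    have h1 := hDd.clm_apply (hasFDerivAt_const ((0 : V), (1 : ℝ)) (v, t))
    have h2 := (hDd.comp_hasDerivAt t hl).clm_apply (hasDerivAt_const t (h, (0 : ℝ)))
    -- The induction hypothesis was applied to the time derivative of `G`; symmetry of the second
    -- derivative exchanges the time direction with `h`.
    have hsymm : IsSymmSndFDerivAt ℝ G (v, t) :=
      (hG.contDiffAt (hU.mem_nhds ht)).isSymmSndFDerivAt (by simp; exact ENat.LEInfty.out)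
    rw [h1.fderiv]
    have h3 := h2.deriv
    simp only [Function.comp_def] at h3
    rw [h3]
    simpa using hsymm.eq (h, 0) (0, 1)

theorem contDiffOn_iteratedDeriv {f : ℝ → W} {J : Set ℝ} (hJ : IsOpen J)
    (hf : ContDiffOn ℝ ∞ f J) (i : ℕ) : ContDiffOn ℝ ∞ (iteratedDeriv i f) J := by
  induction i with
  | zero => simpa using hf
  | succ i ih =>
    rw [iteratedDeriv_succ]
    exact ih.deriv_of_isOpen (m := ∞) hJ (by simp)

theorem hasDerivAt_iteratedDeriv {f : ℝ → W} {J : Set ℝ} (hJ : IsOpen J)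
    (hf : ContDiffOn ℝ ∞ f J) (i : ℕ) {t : ℝ} (ht : t ∈ J) :
    HasDerivAt (iteratedDeriv i f) (iteratedDeriv (i + 1) f t) t := by
  rw [iteratedDeriv_succ]
  exact (((contDiffOn_iteratedDeriv hJ hf i).contDiffAt (hJ.mem_nhds ht)).differentiableAt
    (by simp)).hasDerivAt

theorem iteratedDeriv_congr_of_isOpen {f g : ℝ → W} {J : Set ℝ} (hJ : IsOpen J)
    (h : EqOn f g J) (i : ℕ) {t : ℝ} (ht : t ∈ J) :
    iteratedDeriv i f t = iteratedDeriv i g t :=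
  (h.eventuallyEq_of_mem (hJ.mem_nhds ht)).iteratedDeriv_eq i

theorem ContinuousLinearMap.iteratedDeriv_comp_left_of_isOpen (T : V →L[ℝ] W) {f : ℝ → V}
    {J : Set ℝ} (hJ : IsOpen J) (hf : ContDiffOn ℝ ∞ f J) (i : ℕ) {t : ℝ} (ht : t ∈ J) :
    iteratedDeriv i (fun t => T (f t)) t = T (iteratedDeriv i f t) := by
  induction i generalizing t with
  | zero => simp
  | succ i ih =>
    have hev : iteratedDeriv i (fun t => T (f t)) =ᶠ[𝓝 t] fun t => T (iteratedDeriv i f t) := by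
      filter_upwards [hJ.mem_nhds ht] with x hx using ih hx
    rw [iteratedDeriv_succ, hev.deriv_eq]
    exact (T.hasFDerivAt.comp_hasDerivAt t (hasDerivAt_iteratedDeriv hJ hf i ht)).deriv

end ParametricDerivatives

/-! ### Leibniz rule for a curve of linear maps applied to a curve of vectors -/

section Leibniz

variable {V : Type*} [NormedAddCommGroup V] [NormedSpace ℝ V]
  {W : Type*} [NormedAddCommGroup W] [NormedSpace ℝ W]

/-- The coefficient of `h^(r)` in the `s`-th derivative of the product `A h`. -/
noncomputable def leibnizCoeff (A : ℝ → V →L[ℝ] W) : ℕ → ℕ → ℝ → V →L[ℝ] W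
  | 0, 0 => A
  | 0, _ + 1 => 0
  | s + 1, 0 => deriv (leibnizCoeff A s 0)
  | s + 1, r + 1 => deriv (leibnizCoeff A s (r + 1)) + leibnizCoeff A s r

variable {A : ℝ → V →L[ℝ] W} {J : Set ℝ}

theorem contDiffOn_leibnizCoeff (hJ : IsOpen J) (hA : ContDiffOn ℝ ∞ A J) :
    ∀ s r, ContDiffOn ℝ ∞ (leibnizCoeff A s r) J
  | 0, 0 => hA
  | 0, _ + 1 => contDiffOn_const (c := (0 : V →L[ℝ] W))
  | s + 1, 0 => (contDiffOn_leibnizCoeff hJ hA s 0).deriv_of_isOpen (m := ∞) hJ (by simp)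
  | s + 1, r + 1 => ((contDiffOn_leibnizCoeff hJ hA s (r + 1)).deriv_of_isOpen (m := ∞) hJ
      (by simp)).add (contDiffOn_leibnizCoeff hJ hA s r)

/-- At most `s` of the `s` derivatives can fall on the vector. This lower triangularity truncates
the sums in every later transformation formula. -/
theorem leibnizCoeff_eq_zero : ∀ {s r : ℕ}, s < r → leibnizCoeff A s r = 0
  | 0, 0, h => absurd h (lt_irrefl _)
  | 0, _ + 1, _ => rfl
  | s + 1, 0, h => absurd h (by omega)
  | s + 1, r + 1, h => by
    rw [leibnizCoeff, leibnizCoeff_eq_zero (show s < r + 1 by omega),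
      leibnizCoeff_eq_zero (show s < r by omega)]
    ext
    simp

/-- The defining recursion, solved for the derivative. It is the counterpart of the recursion for
the momenta in `hasDerivAt_ostrogradsky_succ`, and the two are combined in `ostrogradsky_transform`.
-/
theorem hasDerivAt_leibnizCoeff_succ (hJ : IsOpen J) (hA : ContDiffOn ℝ ∞ A J) (s r : ℕ) {t : ℝ}
    (ht : t ∈ J) : HasDerivAt (leibnizCoeff A s (r + 1))
      (leibnizCoeff A (s + 1) (r + 1) t - leibnizCoeff A s r t) t := by
  have := (((contDiffOn_leibnizCoeff hJ hA s (r + 1)).contDiffAt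
    (hJ.mem_nhds ht)).differentiableAt (by simp)).hasDerivAt
  exact this.congr_deriv (add_sub_cancel_right _ _).symm

theorem iteratedDeriv_clm_apply (hJ : IsOpen J) (hA : ContDiffOn ℝ ∞ A J) {h : ℝ → V}
    (hh : ContDiffOn ℝ ∞ h J) (s : ℕ) : ∀ {t : ℝ}, t ∈ J →
    iteratedDeriv s (fun t => A t (h t)) t
      = ∑ r ∈ Finset.range (s + 1), leibnizCoeff A s r t (iteratedDeriv r h t) := by
  induction s with
  | zero => intro t _; simp [leibnizCoeff]
  | succ s ih =>
    intro t ht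
    have hev : iteratedDeriv s (fun t => A t (h t)) =ᶠ[𝓝 t] fun t =>
        ∑ r ∈ Finset.range (s + 1), leibnizCoeff A s r t (iteratedDeriv r h t) := by
      filter_upwards [hJ.mem_nhds ht] with x hx using ih hx
    rw [iteratedDeriv_succ, hev.deriv_eq]
    have hd : ∀ r ∈ Finset.range (s + 1), HasDerivAt
        (fun t => leibnizCoeff A s r t (iteratedDeriv r h t))
        (deriv (leibnizCoeff A s r) t (iteratedDeriv r h t)
          + leibnizCoeff A s r t (iteratedDeriv (r + 1) h t)) t := fun r _ =>
      (((contDiffOn_leibnizCoeff hJ hA s r).contDiffAt (hJ.mem_nhds ht)).differentiableAt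
        (by simp)).hasDerivAt.clm_apply (hasDerivAt_iteratedDeriv hJ hh r ht)
    rw [(HasDerivAt.fun_sum hd).deriv, Finset.sum_add_distrib, Finset.sum_range_succ' _ (s + 1)]
    have h1 : ∑ r ∈ Finset.range (s + 1), deriv (leibnizCoeff A s (r + 1)) t
          (iteratedDeriv (r + 1) h t) + deriv (leibnizCoeff A s 0) t (iteratedDeriv 0 h t)
        = ∑ r ∈ Finset.range (s + 1), deriv (leibnizCoeff A s r) t (iteratedDeriv r h t) := by
      rw [← Finset.sum_range_succ' (fun r => deriv (leibnizCoeff A s r) t (iteratedDeriv r h t)),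
        Finset.sum_range_succ, leibnizCoeff_eq_zero (Nat.lt_succ_self s)]
      simp
    simp only [leibnizCoeff, Pi.add_apply, add_apply, Finset.sum_add_distrib]
    rw [← h1]
    abel

end Leibniz

/-! ### Ostrogradsky momenta along a curve and their change under linear substitutions -/

section Ostrogradsky

variable {X : Type*} [NormedAddCommGroup X] [NormedSpace ℝ X]

/-- The Ostrogradsky momenta `∑ i, (-1)^i f_{r+1+i}^(i)`, for `0 ≤ i ≤ k - (r + 1)`, of a family
of functions of time. -/
noncomputable def ostrogradsky (k : ℕ) (f : ℕ → ℝ → X) (r : ℕ) (t : ℝ) : X :=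
  ∑ i ∈ Finset.range (k - r), (-1 : ℝ) ^ i • iteratedDeriv i (f (r + 1 + i)) t

variable {k : ℕ} {f : ℕ → ℝ → X} {J : Set ℝ}

theorem contDiffOn_ostrogradsky (hJ : IsOpen J) (hf : ∀ r, ContDiffOn ℝ ∞ (f r) J) (r : ℕ) :
    ContDiffOn ℝ ∞ (ostrogradsky k f r) J :=
  ContDiffOn.sum fun i _ => contDiffOn_const.smul (contDiffOn_iteratedDeriv hJ (hf _) i)

/-- Truncated subtraction empties the sum. The value zero at `r = k` is the terminal condition that
starts the downward recursion. -/
theorem ostrogradsky_of_le {r : ℕ} (h : k ≤ r) : ostrogradsky k f r = 0 := by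
  ext t
  simp [ostrogradsky, Nat.sub_eq_zero_of_le h]

/-- Differentiating the alternating sum shifts its index by one and flips its signs; only the
leading term of the previous momentum is missing. -/
theorem hasDerivAt_ostrogradsky_succ (hJ : IsOpen J) (hf : ∀ r, ContDiffOn ℝ ∞ (f r) J) {r : ℕ}
    (hr : r < k) {t : ℝ} (ht : t ∈ J) :
    HasDerivAt (ostrogradsky k f (r + 1)) (f (r + 1) t - ostrogradsky k f r t) t := by
  have hd : ∀ i ∈ Finset.range (k - (r + 1)), HasDerivAt
      (fun t => (-1 : ℝ) ^ i • iteratedDeriv i (f (r + 1 + 1 + i)) t)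
      ((-1 : ℝ) ^ i • iteratedDeriv (i + 1) (f (r + 1 + 1 + i)) t) t := fun i _ =>
    (hasDerivAt_iteratedDeriv hJ (hf _) i ht).const_smul _
  refine (HasDerivAt.fun_sum hd).congr_deriv ?_
  rw [ostrogradsky, show k - r = k - (r + 1) + 1 by omega, Finset.sum_range_succ']
  simp only [pow_zero, iteratedDeriv_zero, one_smul, add_zero]
  rw [sub_add_cancel_right, ← Finset.sum_neg_distrib]
  refine Finset.sum_congr rfl fun i _ => ?_
  rw [pow_succ, show r + 1 + (i + 1) = r + 1 + 1 + i by omega]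
  simp

variable {V : Type*} [NormedAddCommGroup V] [NormedSpace ℝ V]
  {W : Type*} [NormedAddCommGroup W] [NormedSpace ℝ W]

/-- Ostrogradsky momenta transform like the forms they are the coefficients of. -/
theorem ostrogradsky_transform (hJ : IsOpen J) {A : ℝ → V →L[ℝ] W} (hA : ContDiffOn ℝ ∞ A J)
    {f : ℕ → ℝ → V →L[ℝ] ℝ} {g : ℕ → ℝ → W →L[ℝ] ℝ} (hf : ∀ r, ContDiffOn ℝ ∞ (f r) J)
    (hg : ∀ r, ContDiffOn ℝ ∞ (g r) J)
    (hfg : ∀ r ≤ k, ∀ t ∈ J,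
      f r t = ∑ s ∈ Finset.range (k + 1), (g s t).comp (leibnizCoeff A s r t))
    {r : ℕ} (hr : r ≤ k) : ∀ {t : ℝ}, t ∈ J → ostrogradsky k f r t
      = ∑ s ∈ Finset.range k, (ostrogradsky k g s t).comp (leibnizCoeff A s r t) := by
  induction hr using Nat.decreasingInduction with
  | self =>
    intro t _
    -- At `r = k` the left side is an empty sum, and on the right every `s < k` has a coefficient
    -- above the diagonal.
    rw [ostrogradsky_of_le le_rfl, Finset.sum_eq_zero]
    · rfl
    · intro s hs
      rw [leibnizCoeff_eq_zero (Finset.mem_range.1 hs)]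
      simp
  | of_succ r hr ih =>
    intro t ht
    have hP := hasDerivAt_ostrogradsky_succ hJ hf hr ht
    have hev : ostrogradsky k f (r + 1) =ᶠ[𝓝 t] fun t => ∑ s ∈ Finset.range k,
        (ostrogradsky k g s t).comp (leibnizCoeff A s (r + 1) t) := by
      filter_upwards [hJ.mem_nhds ht] with x hx using ih hx
    have hd : ∀ s ∈ Finset.range k, HasDerivAt
        (fun t => (ostrogradsky k g s t).comp (leibnizCoeff A s (r + 1) t))
        ((deriv (ostrogradsky k g s) t).comp (leibnizCoeff A s (r + 1) t)
          + (ostrogradsky k g s t).comp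
            (leibnizCoeff A (s + 1) (r + 1) t - leibnizCoeff A s r t)) t := fun s _ =>
      (((contDiffOn_ostrogradsky hJ hg s).contDiffAt (hJ.mem_nhds ht)).differentiableAt
        (by simp)).hasDerivAt.clm_comp (hasDerivAt_leibnizCoeff_succ hJ hA s r ht)
    -- The derivative of the momentum of index `r + 1` is found twice, by the recursion and from the
    -- formula already known at `r + 1`; equating the two determines the momentum of index `r`.
    have h1 := hP.unique ((HasDerivAt.fun_sum hd).congr_of_eventuallyEq hev)
    -- The recursion for `g` replaces each momentum by `g (s + 1)` minus a derivative, and the index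
    -- is shifted down by one. The boundary terms vanish: the coefficient with `s = 0` lies above
    -- the diagonal, and the momentum with `s = k` is zero.
    have h2 : ∑ s ∈ Finset.range k, (ostrogradsky k g s t).comp (leibnizCoeff A (s + 1) (r + 1) t)
        = ∑ s ∈ Finset.range (k + 1), (g s t).comp (leibnizCoeff A s (r + 1) t)
          - ∑ s ∈ Finset.range k, (deriv (ostrogradsky k g s) t).comp
            (leibnizCoeff A s (r + 1) t) := by
      have h3 : ∀ s ∈ Finset.range k, (ostrogradsky k g s t).comp
          (leibnizCoeff A (s + 1) (r + 1) t)
          = (g (s + 1) t).comp (leibnizCoeff A (s + 1) (r + 1) t)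
            - (deriv (ostrogradsky k g (s + 1)) t).comp (leibnizCoeff A (s + 1) (r + 1) t) := by
        intro s hs
        rw [(hasDerivAt_ostrogradsky_succ hJ hg (Finset.mem_range.1 hs) ht).deriv,
          ← ContinuousLinearMap.sub_comp, sub_sub_cancel]
      have h4 := Finset.sum_range_succ' (fun s => (deriv (ostrogradsky k g s) t).comp
        (leibnizCoeff A s (r + 1) t)) k
      rw [Finset.sum_range_succ, ostrogradsky_of_le le_rfl] at h4
      have h5 : leibnizCoeff A 0 (r + 1) = 0 := rfl
      rw [Finset.sum_congr rfl h3, Finset.sum_sub_distrib, Finset.sum_range_succ' _ k]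
      simp only [h5, Pi.zero_apply, ContinuousLinearMap.comp_zero, add_zero] at h4 ⊢
      rw [← h4]
      have h6 : deriv (0 : ℝ → W →L[ℝ] ℝ) t = 0 := deriv_const t (0 : W →L[ℝ] ℝ)
      rw [h6]
      simp
    simp only [ContinuousLinearMap.comp_sub, Finset.sum_add_distrib, Finset.sum_sub_distrib] at h1
    rw [h2, hfg (r + 1) hr t ht] at h1
    have h7 := h1
    rw [sub_eq_iff_eq_add] at h7
    have h8 : ∀ a b c d : V →L[ℝ] ℝ, a = b + (a - b - c) + d → d = c := by
      intro a b c d h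
      have : d - c = 0 := by
        calc d - c = (b + (a - b - c) + d) - a := by abel
          _ = 0 := by rw [← h, sub_self]
      exact sub_eq_zero.1 this
    exact h8 _ _ _ _ h7

end Ostrogradsky

/-! ### Jets of curves in `ℝⁿ` and the total derivative along them -/

section JetsOfCurves

variable {n : ℕ}

local notation "𝔼" => EuclideanSpace ℝ (Fin n)

/-- The `m`-jet at time `t` of a curve in `ℝⁿ`. -/
noncomputable def jetOf (m : ℕ) (c : ℝ → EuclideanSpace ℝ (Fin n)) (t : ℝ) : JetCoord n m :=
  fun i => iteratedDeriv i c t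

/-- The jets over an open set of `ℝⁿ`. -/
def jetDomain (m : ℕ) (O : Set (EuclideanSpace ℝ (Fin n))) : Set (JetCoord n m) := {v | v 0 ∈ O}

theorem isOpen_jetDomain {m : ℕ} {O : Set 𝔼} (hO : IsOpen O) : IsOpen (jetDomain m O) :=
  hO.preimage (continuous_apply 0)

variable {m : ℕ} {c : ℝ → EuclideanSpace ℝ (Fin n)} {J : Set ℝ}

theorem jetOf_mem_jetDomain {O : Set 𝔼} {t : ℝ} : jetOf m c t ∈ jetDomain m O ↔ c t ∈ O := by
  simp [jetOf, jetDomain]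

theorem truncCoord_jetOf {l : ℕ} (h : l ≤ m) (t : ℝ) :
    truncCoord h (jetOf m c t) = jetOf l c t := rfl

theorem truncCoord_mem_jetDomain {l : ℕ} (h : l ≤ m) {O : Set 𝔼} {u : JetCoord n m} :
    truncCoord h u ∈ jetDomain l O ↔ u ∈ jetDomain m O := Iff.rfl

theorem contDiff_truncCoord {l : ℕ} (h : l ≤ m) :
    ContDiff ℝ ∞ (truncCoord h : JetCoord n m → JetCoord n l) := by
  unfold truncCoord
  fun_prop

theorem jetOf_jetPoly (u : JetCoord n m) : jetOf m (jetPoly u) 0 = u :=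
  funext fun i => iteratedDeriv_jetPoly u i

theorem jetOf_deriv (t : ℝ) :
    jetOf m (deriv c) t = fun i : Fin (m + 1) => iteratedDeriv ((i : ℕ) + 1) c t :=
  funext fun _ => (congrFun iteratedDeriv_succ' t).symm

theorem hasDerivAt_jetOf (hJ : IsOpen J) (hc : ContDiffOn ℝ ∞ c J) {t : ℝ} (ht : t ∈ J) :
    HasDerivAt (jetOf m c) (jetOf m (deriv c) t) t := by
  rw [jetOf_deriv]
  exact hasDerivAt_pi.2 fun i => hasDerivAt_iteratedDeriv hJ hc i ht

theorem contDiffOn_jetOf (hJ : IsOpen J) (hc : ContDiffOn ℝ ∞ c J) :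
    ContDiffOn ℝ ∞ (jetOf m c) J :=
  contDiffOn_pi.2 fun i => contDiffOn_iteratedDeriv hJ hc i

theorem contDiffOn_partialCoord {f : JetCoord n m → ℝ} {U : Set (JetCoord n m)} (hU : IsOpen U)
    (hf : ContDiffOn ℝ ∞ f U) (j : Fin (m + 1)) (A : Fin n) :
    ContDiffOn ℝ ∞ (partialCoord f j A) U :=
  (hf.fderiv_of_isOpen (m := ∞) hU (by simp)).clm_apply contDiffOn_const

theorem sum_smul_single (x : 𝔼) : ∑ A, x A • EuclideanSpace.single A (1 : ℝ) = x := by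
  ext B
  simp [Finset.sum_apply, Pi.single_apply]

theorem sum_mul_clm_single (T : 𝔼 →L[ℝ] ℝ) (x : 𝔼) :
    ∑ A, x A * T (EuclideanSpace.single A 1) = T x := by
  conv_rhs => rw [← sum_smul_single x, map_sum]
  simp

theorem sum_mul_partialCoord (f : JetCoord n m → ℝ) (j : Fin (m + 1)) (u : JetCoord n m)
    (x : 𝔼) : ∑ A, x A * partialCoord f j A u = fderiv ℝ f u (Pi.single j x) :=
  sum_mul_clm_single ((fderiv ℝ f u).comp
    (ContinuousLinearMap.single ℝ (fun _ : Fin (m + 1) => 𝔼) j)) x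

/-- The coordinate sum contracts the differential with the shifted jet `(q_1, …, q_{m+1})`. In this
form the chain rule along a jet curve applies directly. -/
theorem totalDeriv_eq_fderiv (f : JetCoord n m → ℝ) (u : JetCoord n (m + 1)) :
    totalDeriv f u = fderiv ℝ f (fun j => u j.castSucc) (fun j => u j.succ) := by
  simp only [totalDeriv, sum_mul_partialCoord]
  rw [← map_sum, Finset.univ_sum_single (fun j : Fin (m + 1) => u j.succ)]

theorem totalDeriv_jetOf {f : JetCoord n m → ℝ} (hJ : IsOpen J) (hc : ContDiffOn ℝ ∞ c J) {t : ℝ}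
    (ht : t ∈ J) (hf : DifferentiableAt ℝ f (jetOf m c t)) :
    totalDeriv f (jetOf (m + 1) c t) = deriv (fun t => f (jetOf m c t)) t := by
  rw [totalDeriv_eq_fderiv]
  have := hf.hasFDerivAt.comp_hasDerivAt t (hasDerivAt_jetOf hJ hc ht)
  change _ = deriv (f ∘ jetOf m c) t
  rw [this.deriv, jetOf_deriv]
  rfl

variable {O : Set (EuclideanSpace ℝ (Fin n))}

theorem contDiffOn_totalDeriv {f : JetCoord n m → ℝ} (hO : IsOpen O)
    (hf : ContDiffOn ℝ ∞ f (jetDomain m O)) :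
    ContDiffOn ℝ ∞ (totalDeriv f) (jetDomain (m + 1) O) := by
  have h1 := (hf.fderiv_of_isOpen (m := ∞) (isOpen_jetDomain hO) (by simp)).comp
    (s := jetDomain (m + 1) O) (g := fderiv ℝ f)
    (f := fun (u : JetCoord n (m + 1)) (j : Fin (m + 1)) => u j.castSucc)
    (ContDiff.contDiffOn (by fun_prop)) (fun v hv => hv)
  refine (h1.clm_apply (g := fun (u : JetCoord n (m + 1)) (j : Fin (m + 1)) => u j.succ)
    (ContDiff.contDiffOn (by fun_prop))).congr fun u _ => totalDeriv_eq_fderiv f u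

theorem contDiffOn_totalDerivIter {f : JetCoord n m → ℝ} (hO : IsOpen O)
    (hf : ContDiffOn ℝ ∞ f (jetDomain m O)) :
    ∀ i, ContDiffOn ℝ ∞ (totalDerivIter f i) (jetDomain (m + i) O)
  | 0 => hf
  | i + 1 => contDiffOn_totalDeriv hO (contDiffOn_totalDerivIter hO hf i)

/-- Iterated chain rule: on jets of a curve, `d_T` is ordinary differentiation in time. This turns
identities between jet functions into identities between functions of one variable. -/
theorem totalDerivIter_jetOf {f : JetCoord n m → ℝ} (hO : IsOpen O)
    (hf : ContDiffOn ℝ ∞ f (jetDomain m O)) (hJ : IsOpen J) (hc : ContDiffOn ℝ ∞ c J)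
    (hcO : MapsTo c J O) (i : ℕ) : ∀ {t : ℝ}, t ∈ J →
    totalDerivIter f i (jetOf (m + i) c t) = iteratedDeriv i (fun t => f (jetOf m c t)) t := by
  induction i with
  | zero => intro t _; simp [totalDerivIter]
  | succ i ih =>
    intro t ht
    have hev : iteratedDeriv i (fun t => f (jetOf m c t))
        =ᶠ[𝓝 t] fun t => totalDerivIter f i (jetOf (m + i) c t) := by
      filter_upwards [hJ.mem_nhds ht] with x hx using (ih hx).symm
    rw [iteratedDeriv_succ, hev.deriv_eq]
    exact totalDeriv_jetOf hJ hc ht (((contDiffOn_totalDerivIter hO hf i).contDiffAt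
      ((isOpen_jetDomain hO).mem_nhds (jetOf_mem_jetDomain.2 (hcO ht)))).differentiableAt (by simp))

end JetsOfCurves

/-! ### Momenta and energy in natural coordinates -/

section LocalMomenta

variable {n k : ℕ}

local notation "𝔼" => EuclideanSpace ℝ (Fin n)

/-- The derivative of a Lagrangian with respect to `q_j` along a curve, as a covector. -/
noncomputable def lagrangianPartial (Λ : JetCoord n k → ℝ) (c : ℝ → EuclideanSpace ℝ (Fin n))
    (j : ℕ) (t : ℝ) : EuclideanSpace ℝ (Fin n) →L[ℝ] ℝ :=
  if h : j < k + 1 then (fderiv ℝ Λ (jetOf k c t)).comp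
    (ContinuousLinearMap.single ℝ (fun _ : Fin (k + 1) => EuclideanSpace ℝ (Fin n)) ⟨j, h⟩) else 0

/-- The momentum conjugate to `q_r^A` in natural coordinates. -/
noncomputable def localMomentum (Λ : JetCoord n k → ℝ) (r : Fin k) (A : Fin n)
    (u : JetCoord n (2 * k - 1)) : ℝ :=
  ∑ i : Fin (k - r), (-1) ^ (i : ℕ) *
    totalDerivIter (partialCoord Λ ⟨r + 1 + i, by omega⟩ A) i (truncCoord (by omega) u)

/-- The energy in natural coordinates. -/
noncomputable def localEnergy (hk : 1 ≤ k) (Λ : JetCoord n k → ℝ)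
    (u : JetCoord n (2 * k - 1)) : ℝ :=
  (∑ r : Fin k, ∑ A : Fin n, u ⟨r + 1, by omega⟩ A * localMomentum Λ r A u)
    - Λ (truncCoord (by omega : k ≤ 2 * k - 1) u)

variable {Λ : JetCoord n k → ℝ} {O : Set (EuclideanSpace ℝ (Fin n))}
  {c : ℝ → EuclideanSpace ℝ (Fin n)} {J : Set ℝ}

theorem contDiffOn_localMomentum (hO : IsOpen O) (hΛ : ContDiffOn ℝ ∞ Λ (jetDomain k O))
    (r : Fin k) (A : Fin n) :
    ContDiffOn ℝ ∞ (localMomentum Λ r A) (jetDomain (2 * k - 1) O) := by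
  unfold localMomentum
  refine ContDiffOn.sum fun i _ => contDiffOn_const.mul ?_
  exact (contDiffOn_totalDerivIter hO
    (contDiffOn_partialCoord (isOpen_jetDomain hO) hΛ _ A) i).comp
    (contDiff_truncCoord _).contDiffOn fun v hv => hv

theorem contDiffOn_localEnergy (hk : 1 ≤ k) (hO : IsOpen O)
    (hΛ : ContDiffOn ℝ ∞ Λ (jetDomain k O)) :
    ContDiffOn ℝ ∞ (localEnergy hk Λ) (jetDomain (2 * k - 1) O) := by
  unfold localEnergy
  refine ContDiffOn.sub (ContDiffOn.sum fun r _ => ContDiffOn.sum fun A _ =>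
    ContDiffOn.mul (ContDiff.contDiffOn (by fun_prop)) (contDiffOn_localMomentum hO hΛ r A))
    (hΛ.comp (contDiff_truncCoord _).contDiffOn fun v hv => hv)

/-- The summand with index `i` applies `d_T` exactly `i ≤ k - r - 1` times to a function of order
`k`, so it has order at most `2k - 1 - r`. -/
theorem localMomentum_congr (r : Fin k) (A : Fin n) {u u' : JetCoord n (2 * k - 1)}
    (h : ∀ i : Fin (2 * k - 1 + 1), (i : ℕ) + r < 2 * k → u i = u' i) :
    localMomentum Λ r A u = localMomentum Λ r A u' := by
  unfold localMomentum
  refine Finset.sum_congr rfl fun i _ => ?_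
  congr 2
  funext j
  refine h _ ?_
  have := j.2
  have := i.2
  simp only [Fin.val_castLE]
  omega

theorem contDiffOn_lagrangianPartial (hO : IsOpen O) (hΛ : ContDiffOn ℝ ∞ Λ (jetDomain k O))
    (hJ : IsOpen J) (hc : ContDiffOn ℝ ∞ c J) (hcO : MapsTo c J O) (j : ℕ) :
    ContDiffOn ℝ ∞ (lagrangianPartial Λ c j) J := by
  unfold lagrangianPartial
  split_ifs with h
  · exact ((hΛ.fderiv_of_isOpen (m := ∞) (isOpen_jetDomain hO) (by simp)).comp
      (contDiffOn_jetOf hJ hc)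
      (fun t ht => jetOf_mem_jetDomain.2 (hcO ht))).clm_comp contDiffOn_const
  · exact contDiffOn_const

theorem localMomentum_jetOf (hO : IsOpen O) (hΛ : ContDiffOn ℝ ∞ Λ (jetDomain k O))
    (hJ : IsOpen J) (hc : ContDiffOn ℝ ∞ c J) (hcO : MapsTo c J O) (r : Fin k) (A : Fin n) {t : ℝ}
    (ht : t ∈ J) : localMomentum Λ r A (jetOf (2 * k - 1) c t)
      = ostrogradsky k (lagrangianPartial Λ c) r t (EuclideanSpace.single A 1) := by
  unfold localMomentum ostrogradsky
  rw [sum_apply, ← Fin.sum_univ_eq_sum_range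
    (fun i => ((-1 : ℝ) ^ i • iteratedDeriv i (lagrangianPartial Λ c (r + 1 + i)) t)
      (EuclideanSpace.single A 1))]
  refine Finset.sum_congr rfl fun i _ => ?_
  rw [truncCoord_jetOf, totalDerivIter_jetOf hO
    (contDiffOn_partialCoord (isOpen_jetDomain hO) hΛ _ A) hJ hc hcO i ht]
  have h := (ContinuousLinearMap.apply ℝ ℝ (EuclideanSpace.single A (1 : ℝ)
    : 𝔼)).iteratedDeriv_comp_left_of_isOpen hJ
      (contDiffOn_lagrangianPartial hO hΛ hJ hc hcO (r + 1 + i)) i ht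
  rw [smul_apply, smul_eq_mul]
  congr 1
  refine Eq.trans ?_ h
  congr 1
  funext t
  have : (r : ℕ) + 1 + i < k + 1 := by omega
  simp [lagrangianPartial, this, partialCoord]

theorem sum_localMomentum_jetOf (hO : IsOpen O) (hΛ : ContDiffOn ℝ ∞ Λ (jetDomain k O))
    (hJ : IsOpen J) (hc : ContDiffOn ℝ ∞ c J) (hcO : MapsTo c J O) {t : ℝ} (ht : t ∈ J)
    (w : JetCoord n (2 * k - 1)) :
    ∑ r : Fin k, ∑ A, localMomentum Λ r A (jetOf (2 * k - 1) c t) * w ⟨r, by omega⟩ A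
      = ∑ r : Fin k, ostrogradsky k (lagrangianPartial Λ c) r t (w ⟨r, by omega⟩) := by
  refine Finset.sum_congr rfl fun r _ => ?_
  rw [← sum_mul_clm_single]
  refine Finset.sum_congr rfl fun A _ => ?_
  rw [localMomentum_jetOf hO hΛ hJ hc hcO r A ht, mul_comm]

theorem contDiff_jetPoly_mapsTo {m : ℕ} (hO : IsOpen O) {u : JetCoord n m}
    (hu : u ∈ jetDomain m O) : IsOpen (jetPoly u ⁻¹' O) ∧ (0 : ℝ) ∈ jetPoly u ⁻¹' O := by
  refine ⟨hO.preimage (contDiff_jetPoly u).continuous, ?_⟩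
  rw [mem_preimage, jetPoly_zero]
  exact hu

/-- The total derivative of a momentum, in terms of the previous momentum. -/
theorem fderiv_localMomentum_shift (hO : IsOpen O) (hΛ : ContDiffOn ℝ ∞ Λ (jetDomain k O))
    {r : ℕ} (hr : r + 1 < k) (A : Fin n) {u : JetCoord n (2 * k - 1)}
    (hu : u ∈ jetDomain (2 * k - 1) O) :
    fderiv ℝ (localMomentum Λ ⟨r + 1, hr⟩ A) u (jetOf (2 * k - 1) (deriv (jetPoly u)) 0)
      = partialCoord Λ ⟨r + 1, by omega⟩ A (truncCoord (by omega) u)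
        - localMomentum Λ ⟨r, by omega⟩ A u := by
  obtain ⟨hJ, h0⟩ := contDiff_jetPoly_mapsTo hO hu
  set J := jetPoly u ⁻¹' O
  have hc : ContDiffOn ℝ ∞ (jetPoly u) J := (contDiff_jetPoly u).contDiffOn
  have hcO : MapsTo (jetPoly u) J O := fun t ht => ht
  have hp : DifferentiableAt ℝ (localMomentum Λ ⟨r + 1, hr⟩ A) (jetOf (2 * k - 1) (jetPoly u) 0) := by
    rw [jetOf_jetPoly]
    exact ((contDiffOn_localMomentum hO hΛ _ A).contDiffAt
      ((isOpen_jetDomain hO).mem_nhds hu)).differentiableAt (by simp)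
  have h1 := hp.hasFDerivAt.comp_hasDerivAt (0 : ℝ) (hasDerivAt_jetOf hJ hc h0)
  have hf := contDiffOn_lagrangianPartial hO hΛ hJ hc hcO
  have h2 := (hasDerivAt_ostrogradsky_succ hJ hf (show r < k by omega) h0).clm_apply
    (hasDerivAt_const (0 : ℝ) (EuclideanSpace.single A (1 : ℝ) : 𝔼))
  have hev : localMomentum Λ ⟨r + 1, hr⟩ A ∘ jetOf (2 * k - 1) (jetPoly u) =ᶠ[𝓝 0] fun t =>
      ostrogradsky k (lagrangianPartial Λ (jetPoly u)) (r + 1) t (EuclideanSpace.single A 1) := by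
    filter_upwards [hJ.mem_nhds h0] with t ht
    exact localMomentum_jetOf hO hΛ hJ hc hcO ⟨r + 1, hr⟩ A ht
  -- The momentum is differentiated along the jets of the polynomial curve through `u` in two ways:
  -- by the chain rule, in the direction `(q_1, …, q_{2k-1}, 0)`, and by the Ostrogradsky recursion.
  have h3 := h1.unique (h2.congr_of_eventuallyEq hev)
  have h4 := localMomentum_jetOf hO hΛ hJ hc hcO ⟨r, by omega⟩ A h0
  rw [jetOf_jetPoly] at h3 h4
  rw [h3, h4]
  have h5 : r + 1 < k + 1 := by omega
  have h6 : jetOf k (jetPoly u) 0 = truncCoord (by omega) u := by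
    conv_rhs => rw [← jetOf_jetPoly u]
    rfl
  simp [lagrangianPartial, h5, partialCoord, h6]

theorem localMomentum_last (hk : 1 ≤ k) (A : Fin n) (u : JetCoord n (2 * k - 1)) :
    localMomentum Λ ⟨k - 1, by omega⟩ A u
      = partialCoord Λ (Fin.last k) A (truncCoord (by omega) u) := by
  unfold localMomentum
  have h1 : k - (k - 1) = 1 := by omega
  rw [Finset.sum_eq_single ⟨0, by simp only; omega⟩]
  · simp only [pow_zero, one_mul, totalDerivIter]
    congr 2
    omega
  · intro i _ hi
    exact absurd (Fin.ext (by simp only; have := i.2; simp only at this; omega)) hi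
  · simp

end LocalMomenta

/-! ### Prolongation of maps of `ℝⁿ` to jets -/

section JetTransition

variable {n : ℕ}

local notation "𝔼" => EuclideanSpace ℝ (Fin n)

/-- The map induced on `m`-jets by a map of `ℝⁿ`. -/
noncomputable def jetTrans (ψ : EuclideanSpace ℝ (Fin n) → EuclideanSpace ℝ (Fin n)) (m : ℕ)
    (u : JetCoord n m) : JetCoord n m :=
  fun i => iteratedDeriv i (fun t => ψ (jetPoly u t)) 0

variable {m : ℕ} {ψ : EuclideanSpace ℝ (Fin n) → EuclideanSpace ℝ (Fin n)}
  {O : Set (EuclideanSpace ℝ (Fin n))} {c : ℝ → EuclideanSpace ℝ (Fin n)} {J : Set ℝ}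

theorem isOpen_jetPoly_preimage (hO : IsOpen O) :
    IsOpen ((fun x : JetCoord n m × ℝ => jetPoly x.1 x.2) ⁻¹' O) :=
  hO.preimage contDiff_jetPoly_uncurry.continuous

theorem contDiffOn_comp_jetPoly (hψ : ContDiffOn ℝ ∞ ψ O) :
    ContDiffOn ℝ ∞ (fun x : JetCoord n m × ℝ => ψ (jetPoly x.1 x.2))
      ((fun x : JetCoord n m × ℝ => jetPoly x.1 x.2) ⁻¹' O) :=
  hψ.comp contDiff_jetPoly_uncurry.contDiffOn fun _ hx => hx

theorem mem_jetDomain_iff_jetPoly {u : JetCoord n m} : u ∈ jetDomain m O ↔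
    (u, (0 : ℝ)) ∈ (fun x : JetCoord n m × ℝ => jetPoly x.1 x.2) ⁻¹' O := by
  simp only [jetDomain, mem_ofPred_eq, mem_preimage, jetPoly_zero]

theorem contDiffOn_jetTrans (hO : IsOpen O) (hψ : ContDiffOn ℝ ∞ ψ O) :
    ContDiffOn ℝ ∞ (jetTrans ψ m) (jetDomain m O) := by
  refine contDiffOn_pi.2 fun i => ?_
  refine (contDiffOn_iteratedDeriv_param i (isOpen_jetPoly_preimage hO)
    (contDiffOn_comp_jetPoly hψ)).mono fun u hu => ?_
  exact mem_jetDomain_iff_jetPoly.1 hu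

theorem differentiableAt_jetTrans (hO : IsOpen O) (hψ : ContDiffOn ℝ ∞ ψ O) {u : JetCoord n m}
    (hu : u ∈ jetDomain m O) : DifferentiableAt ℝ (jetTrans ψ m) u :=
  ((contDiffOn_jetTrans hO hψ).contDiffAt ((isOpen_jetDomain hO).mem_nhds hu)).differentiableAt
    (by simp)

theorem jetPoly_add (u w : JetCoord n m) (t : ℝ) :
    jetPoly (u + w) t = jetPoly u t + jetPoly w t := by
  simp [jetPoly, Finset.sum_add_distrib]

theorem jetPoly_smul (a : ℝ) (w : JetCoord n m) (t : ℝ) :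
    jetPoly (a • w) t = a • jetPoly w t := by
  simp only [jetPoly, Pi.smul_apply, Finset.smul_sum]
  exact Finset.sum_congr rfl fun i _ => smul_comm _ _ _

/-- Parameter and time derivatives commute, so the prolonged map can be linearized before the jet is
taken. -/
theorem fderiv_jetTrans_apply (hO : IsOpen O) (hψ : ContDiffOn ℝ ∞ ψ O) {u : JetCoord n m}
    (hu : u ∈ jetDomain m O) (w : JetCoord n m) (i : Fin (m + 1)) :
    fderiv ℝ (jetTrans ψ m) u w i
      = iteratedDeriv i (fun t => fderiv ℝ ψ (jetPoly u t) (jetPoly w t)) 0 := by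
  have h1 : fderiv ℝ (jetTrans ψ m) u w i = fderiv ℝ (fun u => jetTrans ψ m u i) u w := by
    rw [fderiv_apply (differentiableAt_jetTrans hO hψ hu)]
    rfl
  rw [h1]
  have hu' := mem_jetDomain_iff_jetPoly.1 hu
  refine (fderiv_iteratedDeriv_param i (isOpen_jetPoly_preimage hO)
    (contDiffOn_comp_jetPoly hψ) w hu').trans ?_
  apply Filter.EventuallyEq.iteratedDeriv_eq
  have hc : ContinuousAt (fun t : ℝ => (u, t)) 0 := by fun_prop
  filter_upwards [hc.eventually ((isOpen_jetPoly_preimage hO).mem_nhds hu')] with t ht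
  have hψd : HasFDerivAt ψ (fderiv ℝ ψ (jetPoly u t)) (jetPoly u t) :=
    ((hψ.contDiffAt (hO.mem_nhds ht)).differentiableAt (by simp)).hasFDerivAt
  have hj : DifferentiableAt ℝ (fun x : JetCoord n m × ℝ => jetPoly x.1 x.2) (u, t) :=
    contDiff_jetPoly_uncurry.contDiffAt.differentiableAt (by simp)
  have h2 := (hψd.comp (u, t) hj.hasFDerivAt).fderiv
  simp only [Function.comp_def] at h2
  rw [h2, ContinuousLinearMap.comp_apply]
  congr 1
  -- `jetPoly` is linear in its coefficients, so its derivative in the direction `w` is `jetPoly w`;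
  -- restricting to the line `u + a • w` shows it.
  have hl : HasDerivAt (fun a : ℝ => (u + a • w, t)) ((1 : ℝ) • w, 0) 0 :=
    (((hasDerivAt_id (0 : ℝ)).smul_const w).const_add u).prodMk (hasDerivAt_const _ t)
  have hj0 : HasFDerivAt (fun x : JetCoord n m × ℝ => jetPoly x.1 x.2)
      (fderiv ℝ (fun x : JetCoord n m × ℝ => jetPoly x.1 x.2) (u, t)) (u + (0 : ℝ) • w, t) := by
    simpa using hj.hasFDerivAt
  have h3 := HasFDerivAt.comp_hasDerivAt (0 : ℝ) hj0 hl
  have h4 : HasDerivAt (fun a : ℝ => jetPoly u t + a • jetPoly w t) ((1 : ℝ) • jetPoly w t) 0 :=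
    ((hasDerivAt_id (0 : ℝ)).smul_const _).const_add _
  have h5 : ((fun x : JetCoord n m × ℝ => jetPoly x.1 x.2) ∘ fun a : ℝ => (u + a • w, t))
      = fun a : ℝ => jetPoly u t + a • jetPoly w t := by
    funext a
    simp [jetPoly_add, jetPoly_smul]
  rw [h5] at h3
  simpa using h3.unique h4

theorem contDiffAt_comp_const_add (hJ : IsOpen J) {X : Type*} [NormedAddCommGroup X]
    [NormedSpace ℝ X] {f : ℝ → X} (hf : ContDiffOn ℝ ∞ f J) {t : ℝ} (ht : t ∈ J) :
    ContDiffAt ℝ ∞ (fun s => f (t + s)) 0 := by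
  have h : ContDiffAt ℝ ∞ f (t + 0) := by
    rw [add_zero]
    exact hf.contDiffAt (hJ.mem_nhds ht)
  exact h.comp (0 : ℝ) (by fun_prop)

theorem iteratedDeriv_comp_const_add_zero {X : Type*} [NormedAddCommGroup X]
    [NormedSpace ℝ X] (f : ℝ → X) (i : ℕ) (t : ℝ) :
    iteratedDeriv i (fun s => f (t + s)) 0 = iteratedDeriv i f t := by
  rw [iteratedDeriv_comp_const_add]
  simp

/-- The polynomial used to define the prolongation may be replaced by any curve with the same jet,
since composition with a smooth map preserves contact. -/
theorem jetTrans_jetOf (hO : IsOpen O) (hψ : ContDiffOn ℝ ∞ ψ O) (hJ : IsOpen J)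
    (hc : ContDiffOn ℝ ∞ c J) (hcO : MapsTo c J O) {t : ℝ} (ht : t ∈ J) :
    jetTrans ψ m (jetOf m c t) = jetOf m (ψ ∘ c) t := by
  funext i
  have h0 : jetPoly (jetOf m c t) 0 = c t := by
    rw [jetPoly_zero]
    simp [jetOf]
  have h := iteratedDeriv_comp_congr (F := ψ) (c := jetPoly (jetOf m c t))
    (d := fun s => c (t + s)) i (contDiff_jetPoly _).contDiffAt
    (contDiffAt_comp_const_add hJ hc ht)
    (by rw [h0]; exact hψ.contDiffAt (hO.mem_nhds (hcO ht))) (by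
      intro j hj
      rw [iteratedDeriv_comp_const_add_zero]
      exact iteratedDeriv_jetPoly (jetOf m c t) ⟨j, by omega⟩)
  refine h.trans ?_
  exact iteratedDeriv_comp_const_add_zero (ψ ∘ c) i t

theorem iteratedDeriv_prodMk {X Y : Type*} [NormedAddCommGroup X] [NormedSpace ℝ X]
    [NormedAddCommGroup Y] [NormedSpace ℝ Y] {f : ℝ → X} {g : ℝ → Y} {t : ℝ} {i : ℕ}
    (hf : ContDiffAt ℝ i f t) (hg : ContDiffAt ℝ i g t) :
    iteratedDeriv i (fun t => (f t, g t)) t = (iteratedDeriv i f t, iteratedDeriv i g t) := by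
  have hp := hf.prodMk hg
  have h1 := (ContinuousLinearMap.fst ℝ X Y).iteratedFDeriv_comp_left hp (i := i) le_rfl
  have h2 := (ContinuousLinearMap.snd ℝ X Y).iteratedFDeriv_comp_left hp (i := i) le_rfl
  ext
  · have := congrArg (fun f => f (fun _ => (1 : ℝ))) h1
    simpa [iteratedDeriv, Function.comp_def] using this.symm
  · have := congrArg (fun f => f (fun _ => (1 : ℝ))) h2
    simpa [iteratedDeriv, Function.comp_def] using this.symm

/-- The derivative of the map on jets, on the jets of a variation of a curve. -/
theorem fderiv_jetTrans_jetOf (hO : IsOpen O) (hψ : ContDiffOn ℝ ∞ ψ O) (hJ : IsOpen J)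
    (hc : ContDiffOn ℝ ∞ c J) (hcO : MapsTo c J O) {h : ℝ → 𝔼} (hh : ContDiffOn ℝ ∞ h J) {t : ℝ}
    (ht : t ∈ J) : fderiv ℝ (jetTrans ψ m) (jetOf m c t) (jetOf m h t)
      = jetOf m (fun t => fderiv ℝ ψ (c t) (h t)) t := by
  funext i
  rw [fderiv_jetTrans_apply hO hψ (jetOf_mem_jetDomain.2 (hcO ht))]
  have h0 : (jetPoly (jetOf m c t) 0, jetPoly (jetOf m h t) 0) = (c t, h t) := by
    rw [jetPoly_zero, jetPoly_zero]
    simp [jetOf]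
  have hF : ContDiffAt ℝ ∞ (fun x : 𝔼 × 𝔼 => fderiv ℝ ψ x.1 x.2) (c t, h t) :=
    (ContDiffAt.comp (c t, h t) ((hψ.contDiffAt (hO.mem_nhds (hcO ht))).fderiv_right
      (m := ∞) (by simp)) contDiffAt_fst).clm_apply contDiffAt_snd
  have hle : ∀ {X : Type} [NormedAddCommGroup X] [NormedSpace ℝ X] {f : ℝ → X} {j : ℕ} {t : ℝ},
      ContDiffAt ℝ ∞ f t → ContDiffAt ℝ j f t := fun hf => hf.of_le (by exact_mod_cast le_top)
  have hc' := contDiffAt_comp_const_add hJ hc ht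
  have hh' := contDiffAt_comp_const_add hJ hh ht
  -- Contact is now applied to the pair formed by a curve and its variation, mapped by `(x, v) ↦
  -- Dψ(x) v`.
  have key := iteratedDeriv_comp_congr (F := fun x : 𝔼 × 𝔼 => fderiv ℝ ψ x.1 x.2)
    (c := fun s => (jetPoly (jetOf m c t) s, jetPoly (jetOf m h t) s))
    (d := fun s => (c (t + s), h (t + s))) i
    ((contDiff_jetPoly _).contDiffAt.prodMk (contDiff_jetPoly _).contDiffAt)
    (hc'.prodMk hh') (by rw [h0]; exact hF) (by
      intro j hj
      rw [iteratedDeriv_prodMk (hle (contDiff_jetPoly _).contDiffAt)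
        (hle (contDiff_jetPoly _).contDiffAt), iteratedDeriv_prodMk (hle hc') (hle hh'),
        iteratedDeriv_comp_const_add_zero, iteratedDeriv_comp_const_add_zero]
      have h1 := iteratedDeriv_jetPoly (jetOf m c t) ⟨j, by omega⟩
      have h2 := iteratedDeriv_jetPoly (jetOf m h t) ⟨j, by omega⟩
      simp only at h1 h2
      rw [h1, h2]
      rfl)
  refine key.trans ?_
  exact iteratedDeriv_comp_const_add_zero (fun t => fderiv ℝ ψ (c t) (h t)) i t

end JetTransition

/-! ### Independence of coordinates for the Poincaré–Cartan 1-form and the energy -/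

section Covariance

variable {n k : ℕ}

local notation "𝔼" => EuclideanSpace ℝ (Fin n)

variable {Λ Λ' : JetCoord n k → ℝ} {O O' : Set (EuclideanSpace ℝ (Fin n))}
  {ψ : EuclideanSpace ℝ (Fin n) → EuclideanSpace ℝ (Fin n)}
  {c : ℝ → EuclideanSpace ℝ (Fin n)} {J : Set ℝ}

theorem contDiffOn_fderiv_comp (hO : IsOpen O) (hψ : ContDiffOn ℝ ∞ ψ O)
    (hc : ContDiffOn ℝ ∞ c J) (hcO : MapsTo c J O) :
    ContDiffOn ℝ ∞ (fun t => fderiv ℝ ψ (c t)) J :=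
  (hψ.fderiv_of_isOpen (m := ∞) hO (by simp)).comp hc hcO

/-- A variation whose jet at `t` has one nonzero slot isolates one column of the Jacobian; the
Leibniz rule for `Dψ` along the curve then reads off its entries. -/
theorem fderiv_jetTrans_single {m : ℕ} (hO : IsOpen O) (hψ : ContDiffOn ℝ ∞ ψ O) (hJ : IsOpen J)
    (hc : ContDiffOn ℝ ∞ c J) (hcO : MapsTo c J O) {t : ℝ} (ht : t ∈ J) (r i : Fin (m + 1))
    (x : 𝔼) : fderiv ℝ (jetTrans ψ m) (jetOf m c t) (Pi.single r x) i
      = leibnizCoeff (fun t => fderiv ℝ ψ (c t)) i r t x := by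
  -- The polynomial is recentred at `t`, so that the prescribed jet occurs at time `t` instead of
  -- time zero.
  set h : ℝ → 𝔼 := fun s => jetPoly (Pi.single r x : JetCoord n m) (-t + s) with hdef
  have hh : ContDiffOn ℝ ∞ h J :=
    ((contDiff_jetPoly _).comp (contDiff_const.add contDiff_id)).contDiffOn
  have hj : jetOf m h t = Pi.single r x := by
    conv_rhs => rw [← jetOf_jetPoly (Pi.single r x : JetCoord n m)]
    funext j
    simp [jetOf, hdef, iteratedDeriv_comp_const_add]
  have h1 := congrFun (fderiv_jetTrans_jetOf (m := m) hO hψ hJ hc hcO hh ht) i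
  rw [hj] at h1
  rw [h1]
  refine (iteratedDeriv_clm_apply hJ (contDiffOn_fderiv_comp hO hψ hc hcO) hh i ht).trans ?_
  have h2 : ∀ j ≤ m, iteratedDeriv j h t = if j = r then x else 0 := by
    intro j hjm
    have h3 := congrFun hj ⟨j, by omega⟩
    simp only [jetOf] at h3
    rw [h3, Pi.single_apply]
    simp [Fin.ext_iff]
  by_cases hri : (r : ℕ) ≤ i
  · rw [Finset.sum_eq_single (r : ℕ)]
    · rw [h2 r (by omega), if_pos rfl]
    · intro j hj hne
      rw [h2 j (by have := Finset.mem_range.1 hj; omega), if_neg hne, map_zero]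
    · intro h
      exact absurd (Finset.mem_range.2 (by omega)) h
  · rw [leibnizCoeff_eq_zero (by omega : (i : ℕ) < r), Finset.sum_eq_zero]
    · rfl
    · intro j hj
      have := Finset.mem_range.1 hj
      rw [h2 j (by omega), if_neg (by omega), map_zero]

/-- Chain rule for the change of Lagrangian, with the Jacobian written in Leibniz coefficients. It
supplies the compatibility hypothesis of `ostrogradsky_transform`. -/
theorem lagrangianPartial_transform (hO : IsOpen O) (hψ : ContDiffOn ℝ ∞ ψ O) (hO' : IsOpen O')
    (hψO : MapsTo ψ O O') (hΛ' : ContDiffOn ℝ ∞ Λ' (jetDomain k O'))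
    (hΛψ : ∀ u ∈ jetDomain k O, Λ u = Λ' (jetTrans ψ k u)) (hJ : IsOpen J)
    (hc : ContDiffOn ℝ ∞ c J) (hcO : MapsTo c J O) {r : ℕ} (hr : r ≤ k) {t : ℝ} (ht : t ∈ J) :
    lagrangianPartial Λ c r t = ∑ s ∈ Finset.range (k + 1),
      (lagrangianPartial Λ' (ψ ∘ c) s t).comp
        (leibnizCoeff (fun t => fderiv ℝ ψ (c t)) s r t) := by
  have hu : jetOf k c t ∈ jetDomain k O := jetOf_mem_jetDomain.2 (hcO ht)
  have hev : Λ =ᶠ[𝓝 (jetOf k c t)] Λ' ∘ jetTrans ψ k := by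
    filter_upwards [(isOpen_jetDomain hO).mem_nhds hu] with u hu using hΛψ u hu
  have hτ := jetTrans_jetOf (m := k) hO hψ hJ hc hcO ht
  have hd' : DifferentiableAt ℝ Λ' (jetTrans ψ k (jetOf k c t)) := by
    rw [hτ]
    exact (hΛ'.contDiffAt ((isOpen_jetDomain hO').mem_nhds
      (jetOf_mem_jetDomain.2 (hψO (hcO ht))))).differentiableAt (by simp)
  have h1 := fderiv_comp _ hd' (differentiableAt_jetTrans hO hψ hu)
  ext x
  have hr' : r < k + 1 := by omega
  rw [sum_apply, ← Fin.sum_univ_eq_sum_range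
    (fun s => ((lagrangianPartial Λ' (ψ ∘ c) s t).comp
        (leibnizCoeff (fun t => fderiv ℝ ψ (c t)) s r t)) x)]
  simp only [lagrangianPartial, hr', dif_pos, hev.fderiv_eq, h1, Fin.is_lt, Fin.eta,
    ContinuousLinearMap.comp_apply, ContinuousLinearMap.single_apply]
  rw [hτ, ← map_sum]
  congr 1
  rw [← Finset.univ_sum_single (fderiv ℝ (jetTrans ψ k) (jetOf k c t) (Pi.single ⟨r, hr'⟩ x))]
  refine Finset.sum_congr rfl fun s _ => ?_
  rw [fderiv_jetTrans_single hO hψ hJ hc hcO ht]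

/-- The Poincaré-Cartan form is natural under changes of coordinates. -/
theorem sum_localMomentum_transform (hO : IsOpen O) (hψ : ContDiffOn ℝ ∞ ψ O) (hO' : IsOpen O')
    (hψO : MapsTo ψ O O') (hΛ : ContDiffOn ℝ ∞ Λ (jetDomain k O))
    (hΛ' : ContDiffOn ℝ ∞ Λ' (jetDomain k O'))
    (hΛψ : ∀ u ∈ jetDomain k O, Λ u = Λ' (jetTrans ψ k u)) {u : JetCoord n (2 * k - 1)}
    (hu : u ∈ jetDomain (2 * k - 1) O) (w : JetCoord n (2 * k - 1)) :
    ∑ r : Fin k, ∑ A, localMomentum Λ r A u * w ⟨r, by omega⟩ A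
      = ∑ r : Fin k, ∑ A, localMomentum Λ' r A (jetTrans ψ (2 * k - 1) u)
        * fderiv ℝ (jetTrans ψ (2 * k - 1)) u w ⟨r, by omega⟩ A := by
  obtain ⟨hJ, h0⟩ := contDiff_jetPoly_mapsTo hO hu
  set J := jetPoly u ⁻¹' O
  have hc : ContDiffOn ℝ ∞ (jetPoly u) J := (contDiff_jetPoly u).contDiffOn
  have hcO : MapsTo (jetPoly u) J O := fun t ht => ht
  have hc' : ContDiffOn ℝ ∞ (ψ ∘ jetPoly u) J := hψ.comp hc hcO
  have hcO' : MapsTo (ψ ∘ jetPoly u) J O' := hψO.comp hcO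
  have h1 := sum_localMomentum_jetOf hO hΛ hJ hc hcO h0 w
  have h2 := sum_localMomentum_jetOf hO' hΛ' hJ hc' hcO' h0
    (fderiv ℝ (jetTrans ψ (2 * k - 1)) u w)
  have hτ := jetTrans_jetOf (m := 2 * k - 1) hO hψ hJ hc hcO h0
  rw [← hτ] at h2
  rw [jetOf_jetPoly] at h1 h2
  rw [h1, h2]
  have hA := contDiffOn_fderiv_comp hO hψ hc hcO
  have h3 : ∀ r : Fin k, ostrogradsky k (lagrangianPartial Λ (jetPoly u)) r 0
      = ∑ s : Fin k, (ostrogradsky k (lagrangianPartial Λ' (ψ ∘ jetPoly u)) s 0).comp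
        (leibnizCoeff (fun t => fderiv ℝ ψ (jetPoly u t)) s r 0) := by
    intro r
    rw [ostrogradsky_transform hJ hA (contDiffOn_lagrangianPartial hO hΛ hJ hc hcO)
      (contDiffOn_lagrangianPartial hO' hΛ' hJ hc' hcO')
      (fun r hr t ht => lagrangianPartial_transform hO hψ hO' hψO hΛ' hΛψ hJ hc hcO hr ht)
      r.2.le h0]
    exact (Fin.sum_univ_eq_sum_range (fun s =>
      (ostrogradsky k (lagrangianPartial Λ' (ψ ∘ jetPoly u)) s 0).comp
        (leibnizCoeff (fun t => fderiv ℝ ψ (jetPoly u t)) s r 0)) k).symm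
  have h4 : ∀ s : Fin k, fderiv ℝ (jetTrans ψ (2 * k - 1)) u w ⟨s, by omega⟩
      = ∑ r : Fin k, leibnizCoeff (fun t => fderiv ℝ ψ (jetPoly u t)) s r 0 (w ⟨r, by omega⟩) := by
    intro s
    conv_lhs => rw [← Finset.univ_sum_single w, map_sum, Finset.sum_apply]
    have h5 : ∀ r : Fin (2 * k - 1 + 1),
        fderiv ℝ (jetTrans ψ (2 * k - 1)) u (Pi.single r (w r)) ⟨s, by omega⟩
          = leibnizCoeff (fun t => fderiv ℝ ψ (jetPoly u t)) s r 0 (w r) := by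
      intro r
      have := fderiv_jetTrans_single (m := 2 * k - 1) hO hψ hJ hc hcO h0 r ⟨s, by omega⟩ (w r)
      rwa [jetOf_jetPoly] at this
    simp only [h5]
    have hk : k ≤ 2 * k - 1 + 1 := by omega
    symm
    -- The vector `w` has `2k` slots, but rows `s < k` of the triangular Jacobian only see the first
    -- `k`. Hence the 1-form, which has no `dq_r` with `r ≥ k`, is mapped to one of the same shape.
    refine (Finset.sum_map Finset.univ (Fin.castLEEmb hk) (fun r : Fin (2 * k - 1 + 1) =>
      leibnizCoeff (fun t => fderiv ℝ ψ (jetPoly u t)) s r 0 (w r))).symm.trans ?_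
    refine Finset.sum_subset (Finset.subset_univ _) fun r _ hr => ?_
    have hr' : k ≤ (r : ℕ) := by
      by_contra hlt
      exact hr (Finset.mem_map.2 ⟨⟨r, by omega⟩, Finset.mem_univ _, rfl⟩)
    rw [leibnizCoeff_eq_zero (by omega : (s : ℕ) < r)]
    rfl
  simp only [h3, h4, sum_apply, ContinuousLinearMap.comp_apply, map_sum]
  exact Finset.sum_comm

/-- The energy is natural under changes of coordinates. -/
theorem localEnergy_transform (hk : 1 ≤ k) (hO : IsOpen O) (hψ : ContDiffOn ℝ ∞ ψ O)
    (hO' : IsOpen O') (hψO : MapsTo ψ O O') (hΛ : ContDiffOn ℝ ∞ Λ (jetDomain k O))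
    (hΛ' : ContDiffOn ℝ ∞ Λ' (jetDomain k O'))
    (hΛψ : ∀ u ∈ jetDomain k O, Λ u = Λ' (jetTrans ψ k u)) {u : JetCoord n (2 * k - 1)}
    (hu : u ∈ jetDomain (2 * k - 1) O) :
    localEnergy hk Λ u = localEnergy hk Λ' (jetTrans ψ (2 * k - 1) u) := by
  obtain ⟨hJ, h0⟩ := contDiff_jetPoly_mapsTo hO hu
  set J := jetPoly u ⁻¹' O
  have hc : ContDiffOn ℝ ∞ (jetPoly u) J := (contDiff_jetPoly u).contDiffOn
  have hcO : MapsTo (jetPoly u) J O := fun t ht => ht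
  -- `E_L + L` is the 1-form paired with the jet of the velocity of a curve through `u`.
  -- Prolongation sends this vector to the jet of the velocity of the image curve, so naturality of
  -- the 1-form gives that of the energy.
  have h1 := sum_localMomentum_transform hO hψ hO' hψO hΛ hΛ' hΛψ hu
    (jetOf (2 * k - 1) (deriv (jetPoly u)) 0)
  have h2 := fderiv_jetTrans_jetOf (m := 2 * k - 1) hO hψ hJ hc hcO
    (hc.deriv_of_isOpen (m := ∞) hJ (by simp)) h0
  have h3 : jetOf (2 * k - 1) (fun t => fderiv ℝ ψ (jetPoly u t) (deriv (jetPoly u) t)) 0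
      = jetOf (2 * k - 1) (deriv (ψ ∘ jetPoly u)) 0 := by
    funext i
    refine iteratedDeriv_congr_of_isOpen hJ (fun t ht => ?_) i h0
    exact (fderiv_comp_deriv t ((hψ.contDiffAt (hO.mem_nhds ht)).differentiableAt (by simp))
      ((contDiff_jetPoly u).contDiffAt.differentiableAt (by simp))).symm
  have hτ := jetTrans_jetOf (m := 2 * k - 1) hO hψ hJ hc hcO h0
  rw [jetOf_jetPoly] at h2 hτ
  rw [h2, h3, jetOf_deriv, jetOf_deriv] at h1
  have h4 : ∀ r : Fin k, iteratedDeriv ((r : ℕ) + 1) (jetPoly u) 0 = u ⟨r + 1, by omega⟩ :=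
    fun r => iteratedDeriv_jetPoly u ⟨r + 1, by omega⟩
  have h5 : ∀ r : Fin k, iteratedDeriv ((r : ℕ) + 1) (ψ ∘ jetPoly u) 0
      = jetTrans ψ (2 * k - 1) u ⟨r + 1, by omega⟩ := by
    intro r
    rw [hτ]
    rfl
  simp only [h4, h5] at h1
  unfold localEnergy
  have h6 : truncCoord (by omega : k ≤ 2 * k - 1) (jetTrans ψ (2 * k - 1) u)
      = jetTrans ψ k (truncCoord (by omega) u) := by
    have h7 := jetTrans_jetOf (m := k) hO hψ hJ hc hcO h0
    rw [hτ, truncCoord_jetOf, ← h7]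
    conv_rhs => rw [← jetOf_jetPoly u]
    rfl
  rw [h6, ← hΛψ _ hu]
  congr 1
  simpa only [mul_comm] using h1

end Covariance

/-! ### The equation of motion in natural coordinates: semispray property and smoothness -/

section LocalDynamics

variable {n k : ℕ}

local notation "𝔼" => EuclideanSpace ℝ (Fin n)

/-- The coordinate `q_j^A` as a continuous linear form. -/
noncomputable def coordCLM (n m : ℕ) (j : Fin (m + 1)) (A : Fin n) : JetCoord n m →L[ℝ] ℝ :=
  (EuclideanSpace.proj A).comp
    (ContinuousLinearMap.proj (R := ℝ) (φ := fun _ : Fin (m + 1) => EuclideanSpace ℝ (Fin n)) j)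

@[simp]
theorem coordCLM_apply {m : ℕ} (j : Fin (m + 1)) (A : Fin n) (u : JetCoord n m) :
    coordCLM n m j A u = u j A := rfl

/-- The Poincaré-Cartan 2-form in natural coordinates. -/
noncomputable def localOmega (Λ : JetCoord n k → ℝ) (u : JetCoord n (2 * k - 1)) :
    JetCoord n (2 * k - 1) →L[ℝ] JetCoord n (2 * k - 1) →L[ℝ] ℝ :=
  ∑ r : Fin k, ∑ A : Fin n,
    ((coordCLM n (2 * k - 1) ⟨r, by omega⟩ A).smulRight (fderiv ℝ (localMomentum Λ r A) u)
      - (fderiv ℝ (localMomentum Λ r A) u).smulRight (coordCLM n (2 * k - 1) ⟨r, by omega⟩ A))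

variable {Λ : JetCoord n k → ℝ} {O : Set (EuclideanSpace ℝ (Fin n))}

theorem localOmega_apply (u v w : JetCoord n (2 * k - 1)) :
    localOmega Λ u v w = ∑ r : Fin k, ∑ A : Fin n,
      (v ⟨r, by omega⟩ A * fderiv ℝ (localMomentum Λ r A) u w
        - fderiv ℝ (localMomentum Λ r A) u v * w ⟨r, by omega⟩ A) := by
  simp [localOmega, sum_apply]

theorem contDiffOn_localOmega (hO : IsOpen O) (hΛ : ContDiffOn ℝ ∞ Λ (jetDomain k O)) :
    ContDiffOn ℝ ∞ (localOmega Λ) (jetDomain (2 * k - 1) O) := by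
  unfold localOmega
  have h : ∀ (r : Fin k) (A : Fin n),
      ContDiffOn ℝ ∞ (fderiv ℝ (localMomentum Λ r A)) (jetDomain (2 * k - 1) O) := fun r A =>
    (contDiffOn_localMomentum hO hΛ r A).fderiv_of_isOpen (m := ∞) (isOpen_jetDomain hO) (by simp)
  exact ContDiffOn.sum fun r _ => ContDiffOn.sum fun A _ =>
    (contDiffOn_const.smulRight (h r A)).sub ((h r A).smulRight contDiffOn_const)

/-- The coordinates `(q_r^A, p_r^A)` differentiated at a point. -/
noncomputable def canonicalMap (Λ : JetCoord n k → ℝ) (u : JetCoord n (2 * k - 1)) :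
    JetCoord n (2 * k - 1) →ₗ[ℝ] (Fin k → Fin n → ℝ) × (Fin k → Fin n → ℝ) :=
  (LinearMap.pi fun r : Fin k => LinearMap.pi fun A =>
      (coordCLM n (2 * k - 1) ⟨r, by omega⟩ A).toLinearMap).prod
    (LinearMap.pi fun r => LinearMap.pi fun A =>
      (fderiv ℝ (localMomentum Λ r A) u).toLinearMap)

theorem canonicalMap_apply (u w : JetCoord n (2 * k - 1)) : canonicalMap Λ u w
    = (fun (r : Fin k) A => w ⟨r, by omega⟩ A, fun r A => fderiv ℝ (localMomentum Λ r A) u w) := rfl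

/-- The form is built from the `dq_r` and `dp_r` alone, so a vector killed by all of them lies in
its kernel. Both spaces have dimension `2kn`, so regularity makes `(q, p)` infinitesimal
coordinates. -/
theorem bijective_canonicalMap (hk : 1 ≤ k) {u : JetCoord n (2 * k - 1)}
    (hnd : ∀ v, (∀ w, localOmega Λ u v w = 0) → v = 0) :
    Function.Bijective (canonicalMap Λ u) := by
  have hinj : Function.Injective (canonicalMap Λ u) := by
    rw [← LinearMap.ker_eq_bot, LinearMap.ker_eq_bot']
    intro v hv
    rw [canonicalMap_apply, Prod.mk_eq_zero] at hv
    refine hnd v fun w => ?_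
    rw [localOmega_apply]
    refine Finset.sum_eq_zero fun r _ => Finset.sum_eq_zero fun A _ => ?_
    have h1 := congrFun (congrFun hv.1 r) A
    have h2 := congrFun (congrFun hv.2 r) A
    simp only [Pi.zero_apply] at h1 h2
    rw [h1, h2]
    simp
  refine ⟨hinj, (LinearMap.injective_iff_surjective_of_finrank_eq_finrank ?_).1 hinj⟩
  have h2 : 2 * k - 1 + 1 = k + k := by omega
  simp [Module.finrank_pi_fintype, h2, add_mul]

theorem fderiv_localEnergy_apply (hk : 1 ≤ k) (hO : IsOpen O)
    (hΛ : ContDiffOn ℝ ∞ Λ (jetDomain k O)) {u : JetCoord n (2 * k - 1)}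
    (hu : u ∈ jetDomain (2 * k - 1) O) (w : JetCoord n (2 * k - 1)) :
    fderiv ℝ (localEnergy hk Λ) u w = (∑ r : Fin k, ∑ A,
      (u ⟨r + 1, by omega⟩ A * fderiv ℝ (localMomentum Λ r A) u w
        + localMomentum Λ r A u * w ⟨r + 1, by omega⟩ A))
      - ∑ i : Fin (k + 1), ∑ A, w ⟨i, by omega⟩ A * partialCoord Λ i A (truncCoord (by omega) u) := by
  have hp : ∀ (r : Fin k) (A : Fin n), HasFDerivAt (localMomentum Λ r A)
      (fderiv ℝ (localMomentum Λ r A) u) u := fun r A =>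
    (((contDiffOn_localMomentum hO hΛ r A).contDiffAt
      ((isOpen_jetDomain hO).mem_nhds hu)).differentiableAt (by simp)).hasFDerivAt
  have hq : ∀ (j : Fin (2 * k - 1 + 1)) (A : Fin n), HasFDerivAt
      (fun u : JetCoord n (2 * k - 1) => u j A) (coordCLM n (2 * k - 1) j A) u := fun j A =>
    (coordCLM n (2 * k - 1) j A).hasFDerivAt
  have hΛu : DifferentiableAt ℝ Λ (truncCoord (by omega : k ≤ 2 * k - 1) u) :=
    (hΛ.contDiffAt ((isOpen_jetDomain hO).mem_nhds
      ((truncCoord_mem_jetDomain _).2 hu))).differentiableAt (by simp)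
  let T : JetCoord n (2 * k - 1) →L[ℝ] JetCoord n k := ContinuousLinearMap.pi fun i =>
    ContinuousLinearMap.proj (R := ℝ) (φ := fun _ : Fin (2 * k - 1 + 1) => 𝔼)
      (Fin.castLE (by omega) i)
  have hT : HasFDerivAt (truncCoord (by omega : k ≤ 2 * k - 1) :
      JetCoord n (2 * k - 1) → JetCoord n k) T u := T.hasFDerivAt
  have hE := (HasFDerivAt.fun_sum fun r (_ : r ∈ Finset.univ) =>
    HasFDerivAt.fun_sum fun A (_ : A ∈ Finset.univ) =>
      (hq ⟨(r : Fin k) + 1, by omega⟩ A).mul (hp r A)).sub (hΛu.hasFDerivAt.comp u hT)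
  have hE' : fderiv ℝ (localEnergy hk Λ) u = _ := hE.fderiv
  rw [hE']
  simp only [sub_apply, sum_apply, add_apply, smul_apply, smul_eq_mul, coordCLM_apply,
    ContinuousLinearMap.comp_apply, sum_mul_partialCoord]
  rw [← map_sum]
  congr 2
  exact (Finset.univ_sum_single (T w)).symm

/-- The right-hand sides of the equations of motion for the momenta. -/
noncomputable def momentumRate (Λ : JetCoord n k → ℝ) (r : Fin k) (A : Fin n)
    (u : JetCoord n (2 * k - 1)) : ℝ :=
  if (r : ℕ) = 0 then partialCoord Λ 0 A (truncCoord (by omega) u)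
  else fderiv ℝ (localMomentum Λ r A) u (jetOf (2 * k - 1) (deriv (jetPoly u)) 0)

/-- Terms are collected by the slot of `w`: slot `0` leaves `-∂L/∂q_0`, the middle slots combine
through `fderiv_localMomentum_shift`, and slot `k` cancels because the last momentum is `∂L/∂q_k`.
Hence `dE_L` involves only the `dp_r` and the `dq_r` with `r < k`. -/
theorem sum_localMomentum_sub_partialCoord (hk : 1 ≤ k) (hO : IsOpen O)
    (hΛ : ContDiffOn ℝ ∞ Λ (jetDomain k O)) {u : JetCoord n (2 * k - 1)}
    (hu : u ∈ jetDomain (2 * k - 1) O) (w : JetCoord n (2 * k - 1)) :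
    (∑ r : Fin k, ∑ A, localMomentum Λ r A u * w ⟨r + 1, by omega⟩ A)
      - ∑ i : Fin (k + 1), ∑ A, w ⟨i, by omega⟩ A * partialCoord Λ i A (truncCoord (by omega) u)
      = - ∑ r : Fin k, ∑ A, w ⟨r, by omega⟩ A * momentumRate Λ r A u := by
  obtain ⟨K, rfl⟩ : ∃ K, k = K + 1 := ⟨k - 1, by omega⟩
  rw [Fin.sum_univ_succ (n := K + 1), Fin.sum_univ_castSucc (n := K),
    Fin.sum_univ_castSucc (n := K), Fin.sum_univ_succ (n := K)]
  have h1 : ∀ A, momentumRate Λ (0 : Fin (K + 1)) A u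
      = partialCoord Λ 0 A (truncCoord (by omega) u) := fun A => by simp [momentumRate]
  have h2 : ∀ (r : Fin K) A, momentumRate Λ r.succ A u
      = partialCoord Λ r.castSucc.succ A (truncCoord (by omega) u)
        - localMomentum Λ r.castSucc A u := by
    intro r A
    have hr : ((r.succ : Fin (K + 1)) : ℕ) ≠ 0 := by simp
    rw [momentumRate, if_neg hr]
    exact fderiv_localMomentum_shift hO hΛ (r := r) (by omega) A hu
  have h3 : ∀ A, localMomentum Λ (Fin.last K) A u
      = partialCoord Λ (Fin.last K).succ A (truncCoord (by omega) u) := fun A =>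
    localMomentum_last (k := K + 1) hk A u
  simp only [h1, h2, h3, mul_sub, Finset.sum_sub_distrib, Fin.val_succ, Fin.val_castSucc,
    Fin.val_zero, Fin.val_last]
  have h4 : ∑ A, partialCoord Λ (Fin.last K).succ A (truncCoord (by omega) u)
        * w ⟨K + 1, by omega⟩ A
      = ∑ A, w ⟨K + 1, by omega⟩ A
        * partialCoord Λ (Fin.last K).succ A (truncCoord (by omega) u) :=
    Finset.sum_congr rfl fun A _ => mul_comm _ _
  have h5 : ∑ r : Fin K, ∑ A, localMomentum Λ r.castSucc A u * w ⟨r + 1, by omega⟩ A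
      = ∑ r : Fin K, ∑ A, w ⟨r + 1, by omega⟩ A * localMomentum Λ r.castSucc A u :=
    Finset.sum_congr rfl fun r _ => Finset.sum_congr rfl fun A _ => mul_comm _ _
  rw [h4, h5]
  ring

/-- For `r ≥ 1` the momentum has order at most `2k - 2`, so only `p_0` can depend on the top
coordinate. -/
theorem fderiv_localMomentum_single_last (hO : IsOpen O) (hΛ : ContDiffOn ℝ ∞ Λ (jetDomain k O))
    {u : JetCoord n (2 * k - 1)} (hu : u ∈ jetDomain (2 * k - 1) O) {r : Fin k} (hr : (r : ℕ) ≠ 0)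
    (A : Fin n) (x : 𝔼) :
    fderiv ℝ (localMomentum Λ r A) u (Pi.single (Fin.last (2 * k - 1)) x) = 0 := by
  have hp : DifferentiableAt ℝ (localMomentum Λ r A) u :=
    ((contDiffOn_localMomentum hO hΛ r A).contDiffAt
      ((isOpen_jetDomain hO).mem_nhds hu)).differentiableAt (by simp)
  rw [← hp.lineDeriv_eq_fderiv]
  have h : (fun t : ℝ => localMomentum Λ r A
      (u + t • (Pi.single (Fin.last (2 * k - 1)) x : JetCoord n (2 * k - 1))))
      = fun _ => localMomentum Λ r A u := by
    funext t
    refine localMomentum_congr r A fun i hi => ?_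
    have hne : i ≠ Fin.last (2 * k - 1) := by
      rintro rfl
      rw [Fin.val_last] at hi
      omega
    simp [hne]
  rw [lineDeriv, h, deriv_const]

/-- The solution of the equation of motion of a regular Lagrangian is a semispray of type 1. -/
theorem semispray_of_localOmega_eq (hk : 1 ≤ k) (hO : IsOpen O)
    (hΛ : ContDiffOn ℝ ∞ Λ (jetDomain k O)) {u : JetCoord n (2 * k - 1)}
    (hu : u ∈ jetDomain (2 * k - 1) O) (hnd : ∀ v, (∀ w, localOmega Λ u v w = 0) → v = 0)
    {ξ : JetCoord n (2 * k - 1)} (hξ : localOmega Λ u ξ = fderiv ℝ (localEnergy hk Λ) u) (i : ℕ)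
    (hi : i < 2 * k - 1) : ξ ⟨i, by omega⟩ = u ⟨i + 1, by omega⟩ := by
  obtain ⟨hinj, hsurj⟩ := bijective_canonicalMap hk hnd
  -- The equation of motion with the `dp_r` and the `dq_r` separated. As `(dq, dp)` is bijective,
  -- testing on dual basis vectors makes each coefficient vanish, which gives Hamilton's equations
  -- `hq` and `hp`.
  have key : ∀ w : JetCoord n (2 * k - 1), ∑ r : Fin k, ∑ A,
      (ξ ⟨r, by omega⟩ A - u ⟨r + 1, by omega⟩ A) * fderiv ℝ (localMomentum Λ r A) u w
      = ∑ r : Fin k, ∑ A, w ⟨r, by omega⟩ A *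
        (fderiv ℝ (localMomentum Λ r A) u ξ - momentumRate Λ r A u) := by
    intro w
    have h1 := congrArg (fun T => T w) hξ
    simp only [localOmega_apply, fderiv_localEnergy_apply hk hO hΛ hu] at h1
    have h2 := sum_localMomentum_sub_partialCoord hk hO hΛ hu w
    simp only [sub_mul, mul_sub, Finset.sum_sub_distrib, Finset.sum_add_distrib] at h1 h2 ⊢
    have h3 : ∑ r : Fin k, ∑ A, fderiv ℝ (localMomentum Λ r A) u ξ * w ⟨r, by omega⟩ A
        = ∑ r : Fin k, ∑ A, w ⟨r, by omega⟩ A * fderiv ℝ (localMomentum Λ r A) u ξ :=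
      Finset.sum_congr rfl fun r _ => Finset.sum_congr rfl fun A _ => mul_comm _ _
    rw [h3] at h1
    linarith
  have hsum : ∀ (f : Fin k → Fin n → ℝ) (r : Fin k) (A : Fin n),
      ∑ r', ∑ A', f r' A' * Pi.single (M := fun _ => Fin n → ℝ) r (Pi.single A (1 : ℝ)) r' A'
        = f r A := by
    intro f r A
    rw [Finset.sum_eq_single r, Finset.sum_eq_single A]
    · simp
    · intro A' _ h
      simp [h]
    · simp
    · intro r' _ h
      simp [h]
    · simp
  have hq : ∀ (r : Fin k) (A : Fin n), ξ ⟨r, by omega⟩ A = u ⟨r + 1, by omega⟩ A := by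
    intro r A
    obtain ⟨w, hw⟩ := hsurj (0, Pi.single r (Pi.single A 1))
    rw [canonicalMap_apply, Prod.mk.injEq] at hw
    have h := key w
    have h1 : ∀ r' A', w ⟨(r' : Fin k), by omega⟩ A' = 0 := fun r' A' =>
      congrFun (congrFun hw.1 r') A'
    have h2 : ∀ r' A', fderiv ℝ (localMomentum Λ r' A') u w
      = Pi.single (M := fun _ => Fin n → ℝ) r (Pi.single A (1 : ℝ)) r' A' := fun r' A' =>
      congrFun (congrFun hw.2 r') A'
    simp only [h1, h2, zero_mul, Finset.sum_const_zero] at h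
    rw [hsum (fun r A => ξ ⟨r, by omega⟩ A - u ⟨r + 1, by omega⟩ A)] at h
    exact sub_eq_zero.1 h
  have hp : ∀ (r : Fin k) (A : Fin n),
      fderiv ℝ (localMomentum Λ r A) u ξ = momentumRate Λ r A u := by
    intro r A
    obtain ⟨w, hw⟩ := hsurj (Pi.single r (Pi.single A 1), 0)
    rw [canonicalMap_apply, Prod.mk.injEq] at hw
    have h := key w
    have h1 : ∀ r' A', w ⟨(r' : Fin k), by omega⟩ A'
      = Pi.single (M := fun _ => Fin n → ℝ) r (Pi.single A (1 : ℝ)) r' A' := fun r' A' =>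
      congrFun (congrFun hw.1 r') A'
    simp only [h1, hq, sub_self, zero_mul, Finset.sum_const_zero] at h
    simp only [mul_comm (Pi.single (M := fun _ => Fin n → ℝ) r (Pi.single A (1 : ℝ)) _ _)] at h
    rw [hsum (fun r A => fderiv ℝ (localMomentum Λ r A) u ξ - momentumRate Λ r A u)] at h
    exact sub_eq_zero.1 h.symm
  set σ := jetOf (2 * k - 1) (deriv (jetPoly u)) 0 with hσ
  have hσi : ∀ (i : ℕ) (_ : i < 2 * k - 1), σ ⟨i, by omega⟩ = u ⟨i + 1, by omega⟩ := by
    intro i hi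
    rw [hσ, jetOf_deriv]
    exact iteratedDeriv_jetPoly u ⟨i + 1, by omega⟩
  have hlast : ∀ (x : 𝔼) (r : Fin k),
      (Pi.single (Fin.last (2 * k - 1)) x : JetCoord n (2 * k - 1)) ⟨r, by omega⟩ = 0 := by
    intro x r
    refine Pi.single_eq_of_ne ?_ _
    intro h
    have := congrArg Fin.val h
    simp only [Fin.val_last] at this
    omega
  -- Hamilton's equations fix `ξ` directly only in the slots below `k`. For the others, `ξ` is
  -- compared with `σ = (q_1, …, q_{2k-1}, 0)`. The map `B` is `dp_0` in the top coordinate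
  -- directions; a vector on which all `dq_r` with `r < k` and all `dp_r` with `r ≥ 1` vanish is
  -- determined by `dp_0`.
  let B : 𝔼 →ₗ[ℝ] (Fin n → ℝ) := LinearMap.pi fun A =>
    (fderiv ℝ (localMomentum Λ ⟨0, hk⟩ A) u).toLinearMap.comp
      (LinearMap.single ℝ (fun _ : Fin (2 * k - 1 + 1) => 𝔼) (Fin.last (2 * k - 1)))
  have hB : ∀ x A, B x A = fderiv ℝ (localMomentum Λ ⟨0, hk⟩ A) u
      (Pi.single (Fin.last (2 * k - 1)) x) := fun x A => rfl
  have hcan : ∀ (x : 𝔼) (η : JetCoord n (2 * k - 1)), (∀ r : Fin k, η ⟨r, by omega⟩ = 0) →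
      (∀ (r : Fin k) A, (r : ℕ) ≠ 0 → fderiv ℝ (localMomentum Λ r A) u η = 0) →
      (∀ A, B x A = fderiv ℝ (localMomentum Λ ⟨0, hk⟩ A) u η) →
      Pi.single (Fin.last (2 * k - 1)) x = η := by
    intro x η h1 h2 h3
    apply hinj
    rw [canonicalMap_apply, canonicalMap_apply, Prod.mk.injEq]
    refine ⟨?_, ?_⟩
    · funext r A
      rw [hlast, h1]
    · funext r A
      by_cases hr : (r : ℕ) = 0
      · obtain rfl : r = ⟨0, hk⟩ := Fin.ext hr
        exact h3 A
      · rw [h2 r A hr, fderiv_localMomentum_single_last hO hΛ hu hr]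
  have hBinj : Function.Injective B := by
    rw [← LinearMap.ker_eq_bot, LinearMap.ker_eq_bot']
    intro x hx
    have h := hcan x 0 (fun _ => rfl) (fun _ _ _ => map_zero _) fun A => by
      rw [hx, map_zero]
      rfl
    simpa using h
  have hBsurj : Function.Surjective B :=
    (LinearMap.injective_iff_surjective_of_finrank_eq_finrank (by simp)).1 hBinj
  -- A top-slot vector has the same `dp_0` as `ξ - σ`, and both vanish under the other forms. They
  -- are therefore equal, so `ξ` and `σ` differ only in the last slot.
  obtain ⟨x, hx⟩ := hBsurj fun A => fderiv ℝ (localMomentum Λ ⟨0, hk⟩ A) u (ξ - σ)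
  have hη := hcan x (ξ - σ) (fun r => by
      ext A
      rw [Pi.sub_apply, hσi r (by omega)]
      simpa [sub_eq_zero] using hq r A)
    (fun r A hr => by
      rw [map_sub, hp, momentumRate, if_neg hr, sub_self])
    fun A => congrFun hx A
  have h := congrFun hη ⟨i, by omega⟩
  rw [Pi.single_eq_of_ne, Pi.sub_apply, hσi i hi] at h
  · exact sub_eq_zero.1 h.symm
  · intro h
    have := congrArg Fin.val h
    simp only [Fin.val_last] at this
    omega

/-- A nondegenerate bilinear form, as an isomorphism onto the dual. -/
theorem exists_equiv_of_nondegenerate {F : Type*} [NormedAddCommGroup F] [NormedSpace ℝ F]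
    [FiniteDimensional ℝ F] {T : F →L[ℝ] F →L[ℝ] ℝ} (hT : ∀ v, (∀ w, T v w = 0) → v = 0) :
    ∃ e : F ≃L[ℝ] (F →L[ℝ] ℝ), (e : F →L[ℝ] F →L[ℝ] ℝ) = T := by
  have hinj : Function.Injective T.toLinearMap := by
    rw [← LinearMap.ker_eq_bot, LinearMap.ker_eq_bot']
    intro v hv
    exact hT v fun w => congrArg (fun S : F →L[ℝ] ℝ => S w) hv
  have hfin : Module.finrank ℝ F = Module.finrank ℝ (F →L[ℝ] ℝ) := by
    rw [← (LinearMap.toContinuousLinearMap (𝕜 := ℝ) (E := F) (F' := ℝ)).finrank_eq]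
    exact (Subspace.dual_finrank_eq (K := ℝ) (V := F)).symm
  refine ⟨(LinearEquiv.ofInjectiveOfFinrankEq T.toLinearMap hinj hfin).toContinuousLinearEquiv, ?_⟩
  ext v w
  rfl

/-- The Lagrangian vector field in natural coordinates. -/
noncomputable def localVF (hk : 1 ≤ k) (Λ : JetCoord n k → ℝ) (u : JetCoord n (2 * k - 1)) :
    JetCoord n (2 * k - 1) :=
  (localOmega Λ u).inverse (fderiv ℝ (localEnergy hk Λ) u)

theorem eq_localVF (hk : 1 ≤ k) {u ξ : JetCoord n (2 * k - 1)}
    (hnd : ∀ v, (∀ w, localOmega Λ u v w = 0) → v = 0)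
    (hξ : localOmega Λ u ξ = fderiv ℝ (localEnergy hk Λ) u) : ξ = localVF hk Λ u := by
  obtain ⟨e, he⟩ := exists_equiv_of_nondegenerate hnd
  rw [localVF, ← hξ, ← he, ContinuousLinearMap.inverse_equiv]
  simp

/-- Inversion of continuous linear maps is smooth at an isomorphism. Nondegeneracy at `u` supplies
one, so the default value of `ContinuousLinearMap.inverse` plays no role. -/
theorem contDiffAt_localVF (hk : 1 ≤ k) (hO : IsOpen O) (hΛ : ContDiffOn ℝ ∞ Λ (jetDomain k O))
    {u : JetCoord n (2 * k - 1)} (hu : u ∈ jetDomain (2 * k - 1) O)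
    (hnd : ∀ v, (∀ w, localOmega Λ u v w = 0) → v = 0) : ContDiffAt ℝ ∞ (localVF hk Λ) u := by
  obtain ⟨e, he⟩ := exists_equiv_of_nondegenerate hnd
  have hU := (isOpen_jetDomain (m := 2 * k - 1) hO).mem_nhds hu
  have h1 : ContDiffAt ℝ ∞ ContinuousLinearMap.inverse (localOmega Λ u) := by
    rw [← he]
    exact contDiffAt_map_inverse e
  have h2 := h1.comp u ((contDiffOn_localOmega hO hΛ).contDiffAt hU)
  exact h2.clm_apply (((contDiffOn_localEnergy hk hO hΛ).fderiv_of_isOpen (m := ∞)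
    (isOpen_jetDomain hO) (by simp)).contDiffAt hU)

end LocalDynamics

/-! ### Independence of coordinates for the Poincaré–Cartan 2-form -/

section ExteriorDerivative

/-- The exterior derivative of the 1-form `∑ P_i dQ_i` is `∑ dP_i ∧ dQ_i`. -/
theorem fderiv_sum_smul_fderiv_sub {F : Type*} [NormedAddCommGroup F] [NormedSpace ℝ F]
    {ι : Type*} [Fintype ι] {P Q : ι → F → ℝ} {u : F} (hP : ∀ i, DifferentiableAt ℝ (P i) u)
    (hQ : ∀ i, ContDiffAt ℝ ∞ (Q i) u) (v w : F) :
    fderiv ℝ (fun u => ∑ i, P i u • fderiv ℝ (Q i) u) u v w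
        - fderiv ℝ (fun u => ∑ i, P i u • fderiv ℝ (Q i) u) u w v
      = ∑ i, (fderiv ℝ (P i) u v * fderiv ℝ (Q i) u w
        - fderiv ℝ (P i) u w * fderiv ℝ (Q i) u v) := by
  have hQ' : ∀ i, DifferentiableAt ℝ (fderiv ℝ (Q i)) u := fun i =>
    ((hQ i).fderiv_right (m := ∞) (by simp)).differentiableAt (by simp)
  have h := HasFDerivAt.fun_sum fun i (_ : i ∈ Finset.univ) =>
    (hP i).hasFDerivAt.smul (hQ' i).hasFDerivAt
  have h' : HasFDerivAt (fun u => ∑ i, P i u • fderiv ℝ (Q i) u) _ u := h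
  rw [h'.fderiv]
  simp only [sum_apply, add_apply, smul_apply, ContinuousLinearMap.smulRight_apply, smul_eq_mul]
  rw [← Finset.sum_sub_distrib]
  refine Finset.sum_congr rfl fun i _ => ?_
  have hs : fderiv ℝ (fderiv ℝ (Q i)) u v w = fderiv ℝ (fderiv ℝ (Q i)) u w v :=
    ((hQ i).isSymmSndFDerivAt (by simp; exact ENat.LEInfty.out)).eq v w
  rw [hs]
  ring

variable {n k : ℕ} {Λ Λ' : JetCoord n k → ℝ} {O O' : Set (EuclideanSpace ℝ (Fin n))}
  {ψ : EuclideanSpace ℝ (Fin n) → EuclideanSpace ℝ (Fin n)}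

/-- The Poincaré-Cartan 2-form is natural under changes of coordinates. -/
theorem localOmega_transform (hO : IsOpen O) (hψ : ContDiffOn ℝ ∞ ψ O) (hO' : IsOpen O')
    (hψO : MapsTo ψ O O') (hΛ : ContDiffOn ℝ ∞ Λ (jetDomain k O))
    (hΛ' : ContDiffOn ℝ ∞ Λ' (jetDomain k O'))
    (hΛψ : ∀ u ∈ jetDomain k O, Λ u = Λ' (jetTrans ψ k u)) {u : JetCoord n (2 * k - 1)}
    (hu : u ∈ jetDomain (2 * k - 1) O) (v w : JetCoord n (2 * k - 1)) :
    localOmega Λ u v w = localOmega Λ' (jetTrans ψ (2 * k - 1) u)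
      (fderiv ℝ (jetTrans ψ (2 * k - 1)) u v) (fderiv ℝ (jetTrans ψ (2 * k - 1)) u w) := by
  set τ := jetTrans ψ (2 * k - 1) with hτdef
  have hU := (isOpen_jetDomain (m := 2 * k - 1) hO).mem_nhds hu
  have hτu : ∀ y ∈ jetDomain (2 * k - 1) O, τ y ∈ jetDomain (2 * k - 1) O' := by
    intro y hy
    have : τ y 0 = ψ (y 0) := by simp [hτdef, jetTrans, jetPoly_zero]
    change τ y 0 ∈ O'
    rw [this]
    exact hψO hy
  have hτ : ContDiffAt ℝ ∞ τ u := (contDiffOn_jetTrans hO hψ).contDiffAt hU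
  have hp : ∀ (i : Fin k × Fin n), DifferentiableAt ℝ (localMomentum Λ i.1 i.2) u := fun i =>
    ((contDiffOn_localMomentum hO hΛ i.1 i.2).contDiffAt hU).differentiableAt (by simp)
  have hp' : ∀ (i : Fin k × Fin n), DifferentiableAt ℝ (localMomentum Λ' i.1 i.2) (τ u) :=
    fun i => ((contDiffOn_localMomentum hO' hΛ' i.1 i.2).contDiffAt
      ((isOpen_jetDomain hO').mem_nhds (hτu u hu))).differentiableAt (by simp)
  let q : Fin k × Fin n → JetCoord n (2 * k - 1) →L[ℝ] ℝ := fun i =>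
    coordCLM n (2 * k - 1) ⟨i.1, by omega⟩ i.2
  have hqa : ∀ i y, q i y = y ⟨i.1, by omega⟩ i.2 := fun i y => rfl
  have hqd : ∀ i y, fderiv ℝ (q i) y = q i := fun i y => (q i).fderiv
  have hqτ : ∀ i, ∀ y ∈ jetDomain (2 * k - 1) O,
      fderiv ℝ (fun y => q i (τ y)) y = (q i).comp (fderiv ℝ τ y) := fun i y hy =>
    ((q i).hasFDerivAt.comp y (differentiableAt_jetTrans hO hψ hy).hasFDerivAt).fderiv
  have hpτ : ∀ i : Fin k × Fin n, fderiv ℝ (fun y => localMomentum Λ' i.1 i.2 (τ y)) u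
      = (fderiv ℝ (localMomentum Λ' i.1 i.2) (τ u)).comp (fderiv ℝ τ u) := fun i =>
    ((hp' i).hasFDerivAt.comp u (hτ.differentiableAt (by simp)).hasFDerivAt).fderiv
  -- The two 1-forms must agree on a neighbourhood, since the equality is about to be
  -- differentiated.
  have hev : (fun y => ∑ i : Fin k × Fin n, localMomentum Λ i.1 i.2 y • fderiv ℝ (q i) y)
      =ᶠ[𝓝 u] fun y => ∑ i : Fin k × Fin n, localMomentum Λ' i.1 i.2 (τ y) •
        fderiv ℝ (fun y => q i (τ y)) y := by
    filter_upwards [hU] with y hy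
    ext x
    simp only [hqd, hqτ _ y hy, sum_apply, smul_apply, smul_eq_mul, Fintype.sum_prod_type]
    exact sum_localMomentum_transform hO hψ hO' hψO hΛ hΛ' hΛψ hy x
  -- The arguments are taken in the order `w`, `v` to absorb the sign in `ω_L = -dθ_L`.
  have h1 := fderiv_sum_smul_fderiv_sub (P := fun i : Fin k × Fin n => localMomentum Λ i.1 i.2)
    (Q := fun i => q i) hp (fun i => (q i).contDiff.contDiffAt) w v
  have h2 := fderiv_sum_smul_fderiv_sub
    (P := fun (i : Fin k × Fin n) y => localMomentum Λ' i.1 i.2 (τ y))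
    (Q := fun i y => q i (τ y)) (fun i => (hp' i).comp u (hτ.differentiableAt (by simp)))
    (fun i => (q i).contDiff.contDiffAt.comp u hτ) w v
  rw [← hev.fderiv_eq, h1] at h2
  simp only [hqd, hqτ _ u hu, hpτ, Fintype.sum_prod_type, ContinuousLinearMap.comp_apply] at h2
  rw [localOmega_apply, localOmega_apply]
  simp only [hqa] at h2
  simpa only [mul_comm] using h2

end ExteriorDerivative

/-! ### Natural charts, projections and the Hausdorff property of `T^m Q` -/

section Charts

variable {n m k : ℕ} {Q : Type*} [TopologicalSpace Q] [ChartedSpace (EuclideanSpace ℝ (Fin n)) Q]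

local notation "𝔼" => EuclideanSpace ℝ (Fin n)

/-- The jets over the domain of the chart of `Q` at `a`. -/
def natSource (m : ℕ) (a : Q) : Set (HigherTangent n m Q) :=
  {z | z.base ∈ (chartAt (EuclideanSpace ℝ (Fin n)) a).source}

theorem mem_natSource_base (z : HigherTangent n m Q) : z ∈ natSource m z.base :=
  mem_chart_source (EuclideanSpace ℝ (Fin n)) z.base

theorem base_proj {l : ℕ} (h : l ≤ m) (z : HigherTangent n m Q) : (z.proj h).base = z.base := by
  induction z using Quotient.inductionOn
  rfl

theorem natCoord_proj {l : ℕ} (h : l ≤ m) {a : Q} {z : HigherTangent n m Q}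
    (hz : z ∈ natSource m a) : natCoord a (z.proj h) = truncCoord h (natCoord a z) := by
  induction z using Quotient.inductionOn with
  | h γ =>
    funext i
    have h1 := natCoord_mk (m := l) a γ hz i
    have h2 := natCoord_mk (m := m) a γ hz (Fin.castLE (Nat.succ_le_succ h) i)
    exact h1.trans h2.symm

/-- The change of coordinates of `Q` between the charts at `a` and at `b`. -/
noncomputable def baseTrans (a b : Q) :
    OpenPartialHomeomorph (EuclideanSpace ℝ (Fin n)) (EuclideanSpace ℝ (Fin n)) :=
  (chartAt (EuclideanSpace ℝ (Fin n)) a).symm ≫ₕ chartAt (EuclideanSpace ℝ (Fin n)) b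

theorem mapsTo_baseTrans (a b : Q) : MapsTo (baseTrans (n := n) a b)
    (baseTrans (n := n) a b).source (chartAt (EuclideanSpace ℝ (Fin n)) b).target := fun x hx => by
  have h : x ∈ ((chartAt 𝔼 a).symm ≫ₕ chartAt 𝔼 b).source := hx
  rw [OpenPartialHomeomorph.trans_source] at h
  exact (chartAt 𝔼 b).map_source h.2

variable [IsManifold (𝓡 n) ∞ Q]

/-- The natural chart over the chart of `Q` at `a`, as a homeomorphism. -/
noncomputable def natHomeo (m : ℕ) (a : Q) :
    OpenPartialHomeomorph (HigherTangent n m Q) (JetCoord n m) :=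
  (higherTangentCore n m Q).openPartialHomeomorph (natChart a) (mem_range_self a)

theorem natHomeo_mem_atlas (a : Q) :
    natHomeo m a ∈ atlas (JetCoord n m) (HigherTangent n m Q) := by
  change natHomeo m a ∈ ⋃ (e : PartialEquiv (HigherTangent n m Q) (JetCoord n m))
    (he : e ∈ (higherTangentCore n m Q).atlas),
      {(higherTangentCore n m Q).openPartialHomeomorph e he}
  simp only [mem_iUnion, mem_singleton_iff]
  exact ⟨natChart a, mem_range_self a, rfl⟩

theorem natHomeo_mem_maximalAtlas (a : Q) :
    natHomeo m a ∈ IsManifold.maximalAtlas 𝓘(ℝ, JetCoord n m) ∞ (HigherTangent n m Q) :=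
  IsManifold.subset_maximalAtlas (natHomeo_mem_atlas a)

theorem isOpen_natSource (a : Q) : IsOpen (natSource (n := n) m a) := (natHomeo m a).open_source

theorem natSource_mem_nhds {a : Q} {z : HigherTangent n m Q} (hz : z ∈ natSource m a) :
    natSource m a ∈ 𝓝 z := (isOpen_natSource a).mem_nhds hz

theorem natCoord_mem_jetDomain {a : Q} {z : HigherTangent n m Q} (hz : z ∈ natSource m a) :
    natCoord a z ∈ jetDomain m (chartAt (EuclideanSpace ℝ (Fin n)) a).target :=
  (natHomeo m a).map_source hz

theorem contMDiffAt_natCoord {a : Q} {z : HigherTangent n m Q} (hz : z ∈ natSource m a) :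
    ContMDiffAt 𝓘(ℝ, JetCoord n m) 𝓘(ℝ, JetCoord n m) ∞ (natCoord a) z :=
  contMDiffAt_of_mem_maximalAtlas (natHomeo_mem_maximalAtlas a) hz

theorem contMDiffOn_natChart_symm (a : Q) :
    ContMDiffOn 𝓘(ℝ, JetCoord n m) 𝓘(ℝ, JetCoord n m) ∞ (natChart (n := n) (m := m) a).symm
      (jetDomain m (chartAt (EuclideanSpace ℝ (Fin n)) a).target) :=
  contMDiffOn_symm_of_mem_maximalAtlas (natHomeo_mem_maximalAtlas (m := m) a)

theorem natCoord_injOn (a : Q) : InjOn (natCoord a : HigherTangent n m Q → JetCoord n m)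
    (natSource m a) := (natHomeo m a).injOn

theorem continuous_base : Continuous (HigherTangent.base : HigherTangent n m Q → Q) := by
  rw [continuous_iff_continuousAt]
  intro z
  set φ := chartAt 𝔼 z.base with hφ
  have hz := mem_natSource_base z
  have hev : HigherTangent.base =ᶠ[𝓝 z] fun y : HigherTangent n m Q =>
      φ.symm (natCoord z.base y 0) := by
    filter_upwards [natSource_mem_nhds hz] with y hy
    rw [natCoord_zero, φ.left_inv hy]
  refine ContinuousAt.congr ?_ hev.symm
  have h1 : ContinuousAt (fun y : HigherTangent n m Q => natCoord z.base y 0) z :=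
    ContinuousAt.comp (g := fun u : JetCoord n m => u 0) (f := natCoord z.base)
      (continuous_apply 0).continuousAt (contMDiffAt_natCoord hz).continuousAt
  exact ContinuousAt.comp (f := fun y : HigherTangent n m Q => natCoord z.base y 0)
    (φ.continuousAt_symm (natCoord_mem_jetDomain hz)) h1

/-- Jets over distinct points are separated in `Q`; jets over the same point lie in a common natural
chart and are separated there. The closedness step of flow invariance needs this. -/
instance instT2HigherTangent [T2Space Q] : T2Space (HigherTangent n m Q) := by
  refine ⟨fun z w hzw => ?_⟩
  by_cases hb : z.base = w.base
  · have hz := mem_natSource_base z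
    have hw : w ∈ natSource m z.base := by
      change w.base ∈ (chartAt 𝔼 z.base).source
      rw [← hb]
      exact hz
    have hne : natCoord z.base z ≠ natCoord z.base w := fun h => hzw (natCoord_injOn _ hz hw h)
    obtain ⟨U, V, hU, hV, hzU, hwV, hUV⟩ := t2_separation hne
    refine ⟨natSource m z.base ∩ natCoord z.base ⁻¹' U, natSource m z.base ∩ natCoord z.base ⁻¹' V,
      (natHomeo m z.base).isOpen_inter_preimage hU, (natHomeo m z.base).isOpen_inter_preimage hV,
      ⟨hz, hzU⟩, ⟨hw, hwV⟩, ?_⟩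
    exact (hUV.preimage _).mono inter_subset_right inter_subset_right
  · obtain ⟨U, V, hU, hV, hzU, hwV, hUV⟩ := t2_separation hb
    exact ⟨_, _, hU.preimage continuous_base, hV.preimage continuous_base, hzU, hwV,
      hUV.preimage _⟩

theorem contMDiff_proj {l : ℕ} (h : l ≤ m) : ContMDiff 𝓘(ℝ, JetCoord n m) 𝓘(ℝ, JetCoord n l) ∞
    (HigherTangent.proj h : HigherTangent n m Q → HigherTangent n l Q) := by
  intro z
  have hz := mem_natSource_base z
  have hev : HigherTangent.proj h =ᶠ[𝓝 z] fun y : HigherTangent n m Q =>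
      (natChart z.base).symm (truncCoord h (natCoord z.base y)) := by
    filter_upwards [natSource_mem_nhds hz] with y hy
    rw [← natCoord_proj h hy]
    refine ((natChart z.base).left_inv ?_).symm
    change (y.proj h).base ∈ (chartAt 𝔼 z.base).source
    rw [base_proj]
    exact hy
  refine ContMDiffAt.congr_of_eventuallyEq ?_ hev
  have h1 : ContMDiffAt 𝓘(ℝ, JetCoord n m) 𝓘(ℝ, JetCoord n l) ∞
      (fun y : HigherTangent n m Q => truncCoord h (natCoord z.base y)) z :=
    (contDiff_truncCoord h).contMDiff.contMDiffAt.comp z (contMDiffAt_natCoord hz)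
  have h2 := (contMDiffOn_natChart_symm (n := n) (m := l) z.base).contMDiffAt
    ((isOpen_jetDomain (chartAt 𝔼 z.base).open_target).mem_nhds
      (show truncCoord h (natCoord z.base z) ∈ _ from natCoord_mem_jetDomain hz))
  exact ContMDiffAt.comp z h2 h1

theorem contDiffOn_baseTrans (a b : Q) :
    ContDiffOn ℝ ∞ (baseTrans (n := n) a b) (baseTrans (n := n) a b).source :=
  contDiffOn_transition _ _ (chart_mem_atlas _ a) (chart_mem_atlas _ b)

theorem natCoord_eq_jetTrans {a b : Q} {z : HigherTangent n m Q} (ha : z ∈ natSource m a)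
    (hb : z ∈ natSource m b) : natCoord a z ∈ jetDomain m (baseTrans a b).source ∧
      natCoord b z = jetTrans (baseTrans a b) m (natCoord a z) := by
  have hv := natCoord_mem_jetDomain ha
  have hs : (chartAt 𝔼 a).symm (natCoord a z 0) = z.base := by
    rw [natCoord_zero, (chartAt 𝔼 a).left_inv ha]
  have hs' : (chartAt 𝔼 a).symm (natCoord a z 0) ∈ (chartAt 𝔼 b).source := by
    rw [hs]
    exact hb
  refine ⟨?_, ?_⟩
  · change natCoord a z 0 ∈ ((chartAt 𝔼 a).symm ≫ₕ chartAt 𝔼 b).source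
    rw [OpenPartialHomeomorph.trans_source]
    exact ⟨hv, hs'⟩
  · conv_lhs => rw [← mk_polyCurve_natCoord a z ha]
    funext i
    exact natCoord_mk_polyCurve a b (natCoord a z) hv hs' i

variable {L : HigherTangent n k Q → ℝ}

theorem contDiffOn_localLagrangian (hL : ContMDiff 𝓘(ℝ, JetCoord n k) 𝓘(ℝ, ℝ) ∞ L) (a : Q) :
    ContDiffOn ℝ ∞ (localLagrangian L a) (jetDomain k (chartAt (EuclideanSpace ℝ (Fin n)) a).target)
    := contMDiffOn_iff_contDiffOn.1 (hL.comp_contMDiffOn (contMDiffOn_natChart_symm a))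

theorem localLagrangian_natCoord {a : Q} {z : HigherTangent n k Q} (hz : z ∈ natSource k a) :
    localLagrangian L a (natCoord a z) = L z :=
  congrArg L ((natChart a).left_inv hz)

theorem localLagrangian_transform {a b : Q} {u : JetCoord n k}
    (hu : u ∈ jetDomain k (baseTrans a b).source) :
    localLagrangian L a u = localLagrangian L b (jetTrans (baseTrans a b) k u) := by
  change u 0 ∈ ((chartAt 𝔼 a).symm ≫ₕ chartAt 𝔼 b).source at hu
  rw [OpenPartialHomeomorph.trans_source] at hu
  have ha : (natChart (n := n) a).symm u ∈ natSource k a := (natChart a).map_target hu.1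
  have hua : natCoord a ((natChart (n := n) a).symm u) = u := (natChart a).right_inv hu.1
  have hb : (natChart (n := n) a).symm u ∈ natSource k b := by
    change HigherTangent.base _ ∈ (chartAt 𝔼 b).source
    have h0 := natCoord_zero a ((natChart (n := n) a).symm u)
    rw [hua] at h0
    have h1 : ((natChart (n := n) a).symm u).base = (chartAt 𝔼 a).symm (u 0) := by
      rw [h0, (chartAt 𝔼 a).left_inv ha]
    rw [h1]
    exact hu.2
  have h := natCoord_eq_jetTrans ha hb
  rw [hua] at h
  rw [← h.2, localLagrangian_natCoord hb]
  rfl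

end Charts

/-! ### The Poincaré–Cartan forms, energy and Lagrangian vector field on `T^{2k-1} Q` -/

section LagrangianGeometry

variable {n m k : ℕ} {Q : Type*} [TopologicalSpace Q] [ChartedSpace (EuclideanSpace ℝ (Fin n)) Q]
  [IsManifold (𝓡 n) ∞ Q]

local notation "𝔼" => EuclideanSpace ℝ (Fin n)

/-- The natural coordinates of a tangent vector. -/
noncomputable def natTangent (a : Q) (z : HigherTangent n m Q) :
    TangentSpace 𝓘(ℝ, JetCoord n m) z →L[ℝ] JetCoord n m :=
  mfderiv 𝓘(ℝ, JetCoord n m) 𝓘(ℝ, JetCoord n m) (natCoord a) z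

theorem hasMFDerivAt_natCoord {a : Q} {z : HigherTangent n m Q} (hz : z ∈ natSource m a) :
    HasMFDerivAt 𝓘(ℝ, JetCoord n m) 𝓘(ℝ, JetCoord n m) (natCoord a) z (natTangent a z) :=
  ((contMDiffAt_natCoord hz).mdifferentiableAt (by simp)).hasMFDerivAt

theorem bijective_natTangent {a : Q} {z : HigherTangent n m Q} (hz : z ∈ natSource m a) :
    Function.Bijective (natTangent a z) :=
  (mdifferentiable_of_mem_atlas (I := 𝓘(ℝ, JetCoord n m))
    (natHomeo_mem_atlas (n := n) (m := m) a)).mfderiv_bijective hz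

theorem differential_comp_natCoord {a : Q} {z : HigherTangent n m Q} (hz : z ∈ natSource m a)
    {g : JetCoord n m → ℝ} (hg : DifferentiableAt ℝ g (natCoord a z))
    {f : HigherTangent n m Q → ℝ} (hf : ∀ y ∈ natSource m a, f y = g (natCoord a y))
    (v : TangentSpace 𝓘(ℝ, JetCoord n m) z) :
    differential f z v = fderiv ℝ g (natCoord a z) (natTangent a z v) := by
  have h : HasMFDerivAt 𝓘(ℝ, JetCoord n m) 𝓘(ℝ, ℝ) (g ∘ natCoord a) z
      ((fderiv ℝ g (natCoord a z)).comp (natTangent a z)) :=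
    HasMFDerivAt.comp z hg.hasFDerivAt.hasMFDerivAt (hasMFDerivAt_natCoord hz)
  have hev : f =ᶠ[𝓝 z] g ∘ natCoord a := by
    filter_upwards [natSource_mem_nhds hz] with y hy using hf y hy
  rw [differential, (h.congr_of_eventuallyEq hev).mfderiv]
  rfl

theorem differential_coordFun {a : Q} {z : HigherTangent n m Q} (hz : z ∈ natSource m a)
    (j : Fin (m + 1)) (A : Fin n) (v : TangentSpace 𝓘(ℝ, JetCoord n m) z) :
    differential (coordFun a j A) z v = natTangent a z v j A := by
  rw [differential_comp_natCoord hz (g := coordCLM n m j A) (f := coordFun a j A)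
    (coordCLM n m j A).differentiableAt (fun _ _ => rfl), ContinuousLinearMap.fderiv]
  rfl

theorem natTangent_transform {a b : Q} {z : HigherTangent n m Q} (ha : z ∈ natSource m a)
    (hb : z ∈ natSource m b) (v : TangentSpace 𝓘(ℝ, JetCoord n m) z) :
    natTangent b z v = fderiv ℝ (jetTrans (baseTrans a b) m) (natCoord a z) (natTangent a z v) := by
  have hd := differentiableAt_jetTrans (m := m) (baseTrans a b).open_source
    (contDiffOn_baseTrans (n := n) a b) (natCoord_eq_jetTrans ha hb).1
  have h : HasMFDerivAt 𝓘(ℝ, JetCoord n m) 𝓘(ℝ, JetCoord n m)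
      (jetTrans (baseTrans a b) m ∘ natCoord a) z
      ((fderiv ℝ (jetTrans (baseTrans a b) m) (natCoord a z)).comp (natTangent a z)) :=
    HasMFDerivAt.comp z hd.hasFDerivAt.hasMFDerivAt (hasMFDerivAt_natCoord ha)
  have hev : natCoord b =ᶠ[𝓝 z] jetTrans (baseTrans a b) m ∘ natCoord a := by
    filter_upwards [natSource_mem_nhds ha, natSource_mem_nhds hb] with y hya hyb
    exact (natCoord_eq_jetTrans hya hyb).2
  have h1 := (h.congr_of_eventuallyEq hev).mfderiv
  rw [natTangent, h1]
  rfl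

variable {L : HigherTangent n k Q → ℝ}

theorem contDiffOn_localLagrangian_baseTrans (hL : ContMDiff 𝓘(ℝ, JetCoord n k) 𝓘(ℝ, ℝ) ∞ L)
    (a b : Q) : ContDiffOn ℝ ∞ (localLagrangian L a) (jetDomain k (baseTrans a b).source) := by
  refine (contDiffOn_localLagrangian hL a).mono fun u hu => ?_
  have h : u 0 ∈ ((chartAt 𝔼 a).symm ≫ₕ chartAt 𝔼 b).source := hu
  rw [OpenPartialHomeomorph.trans_source] at h
  exact h.1

theorem differentiableAt_localMomentum (hL : ContMDiff 𝓘(ℝ, JetCoord n k) 𝓘(ℝ, ℝ) ∞ L) {a : Q}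
    {z : HigherTangent n (2 * k - 1) Q} (hz : z ∈ natSource (2 * k - 1) a) (r : Fin k)
    (A : Fin n) : DifferentiableAt ℝ (localMomentum (localLagrangian L a) r A) (natCoord a z) :=
  ((contDiffOn_localMomentum (chartAt 𝔼 a).open_target (contDiffOn_localLagrangian hL a)
    r A).contDiffAt ((isOpen_jetDomain (chartAt 𝔼 a).open_target).mem_nhds
      (natCoord_mem_jetDomain hz))).differentiableAt (by simp)

theorem differential_momentum (hL : ContMDiff 𝓘(ℝ, JetCoord n k) 𝓘(ℝ, ℝ) ∞ L) {a : Q}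
    {z : HigherTangent n (2 * k - 1) Q} (hz : z ∈ natSource (2 * k - 1) a) (r : Fin k)
    (A : Fin n) (v : TangentSpace 𝓘(ℝ, JetCoord n (2 * k - 1)) z) :
    differential (momentum L a r A) z v
      = fderiv ℝ (localMomentum (localLagrangian L a) r A) (natCoord a z) (natTangent a z v) :=
  differential_comp_natCoord hz (differentiableAt_localMomentum hL hz r A) (fun _ _ => rfl) v

/-- The Poincaré-Cartan 1-form in any natural chart. -/
theorem thetaL_apply (hL : ContMDiff 𝓘(ℝ, JetCoord n k) 𝓘(ℝ, ℝ) ∞ L) {a : Q}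
    {z : HigherTangent n (2 * k - 1) Q} (hz : z ∈ natSource (2 * k - 1) a)
    (v : TangentSpace 𝓘(ℝ, JetCoord n (2 * k - 1)) z) :
    thetaL L z v = ∑ r : Fin k, ∑ A,
      momentum L a r A z * natTangent a z v ⟨r, by omega⟩ A := by
  have hb := mem_natSource_base z
  have h := natCoord_eq_jetTrans hz hb
  have key := sum_localMomentum_transform (baseTrans a z.base).open_source
    (contDiffOn_baseTrans a z.base) (chartAt 𝔼 z.base).open_target (mapsTo_baseTrans a z.base)
    (contDiffOn_localLagrangian_baseTrans hL a z.base) (contDiffOn_localLagrangian hL z.base)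
    (fun u hu => localLagrangian_transform hu) h.1 (natTangent a z v)
  rw [← natTangent_transform hz hb, ← h.2] at key
  refine Eq.trans ?_ key.symm
  simp only [thetaL, LinearMap.sum_apply, LinearMap.smul_apply, smul_eq_mul,
    differential_coordFun hb]
  rfl

/-- The Poincaré-Cartan 2-form in any natural chart. -/
theorem omegaL_apply (hL : ContMDiff 𝓘(ℝ, JetCoord n k) 𝓘(ℝ, ℝ) ∞ L) {a : Q}
    {z : HigherTangent n (2 * k - 1) Q} (hz : z ∈ natSource (2 * k - 1) a)
    (v w : TangentSpace 𝓘(ℝ, JetCoord n (2 * k - 1)) z) :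
    omegaL L z v w = localOmega (localLagrangian L a) (natCoord a z) (natTangent a z v)
      (natTangent a z w) := by
  have hb := mem_natSource_base z
  have h := natCoord_eq_jetTrans hz hb
  rw [localOmega_transform (baseTrans a z.base).open_source
    (contDiffOn_baseTrans a z.base) (chartAt 𝔼 z.base).open_target (mapsTo_baseTrans a z.base)
    (contDiffOn_localLagrangian_baseTrans hL a z.base) (contDiffOn_localLagrangian hL z.base)
    (fun u hu => localLagrangian_transform hu) h.1, ← natTangent_transform hz hb,
    ← natTangent_transform hz hb, ← h.2, localOmega_apply]
  simp only [omegaL, LinearMap.sum_apply, LinearMap.neg_apply, wedge, LinearMap.sub_apply,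
    LinearMap.smulRight_apply, LinearMap.smul_apply, smul_eq_mul, differential_coordFun hb,
    differential_momentum hL hb, neg_sub]

/-- The energy in any natural chart. -/
theorem energyL_eq (hk : 1 ≤ k) (hL : ContMDiff 𝓘(ℝ, JetCoord n k) 𝓘(ℝ, ℝ) ∞ L) {a : Q}
    {z : HigherTangent n (2 * k - 1) Q} (hz : z ∈ natSource (2 * k - 1) a) :
    energyL hk L z = localEnergy hk (localLagrangian L a) (natCoord a z) := by
  have hb := mem_natSource_base z
  have h := natCoord_eq_jetTrans hz hb
  rw [localEnergy_transform hk (baseTrans a z.base).open_source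
    (contDiffOn_baseTrans a z.base) (chartAt 𝔼 z.base).open_target (mapsTo_baseTrans a z.base)
    (contDiffOn_localLagrangian_baseTrans hL a z.base) (contDiffOn_localLagrangian hL z.base)
    (fun u hu => localLagrangian_transform hu) h.1, ← h.2]
  unfold energyL localEnergy
  have h1 : z.proj (by omega : k ≤ 2 * k - 1) ∈ natSource k z.base := by
    change HigherTangent.base _ ∈ (chartAt 𝔼 z.base).source
    rw [base_proj]
    exact hb
  rw [← natCoord_proj _ hb, localLagrangian_natCoord h1]
  rfl

theorem contDiffAt_localEnergy (hk : 1 ≤ k) (hL : ContMDiff 𝓘(ℝ, JetCoord n k) 𝓘(ℝ, ℝ) ∞ L)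
    {a : Q} {z : HigherTangent n (2 * k - 1) Q} (hz : z ∈ natSource (2 * k - 1) a) :
    ContDiffAt ℝ ∞ (localEnergy hk (localLagrangian L a)) (natCoord a z) :=
  (contDiffOn_localEnergy hk (chartAt 𝔼 a).open_target
    (contDiffOn_localLagrangian hL a)).contDiffAt
    ((isOpen_jetDomain (chartAt 𝔼 a).open_target).mem_nhds (natCoord_mem_jetDomain hz))

theorem contMDiff_energyL (hk : 1 ≤ k) (hL : ContMDiff 𝓘(ℝ, JetCoord n k) 𝓘(ℝ, ℝ) ∞ L) :
    ContMDiff 𝓘(ℝ, JetCoord n (2 * k - 1)) 𝓘(ℝ, ℝ) ∞ (energyL hk L) := by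
  intro z
  have hb := mem_natSource_base z
  have h : ContMDiffAt 𝓘(ℝ, JetCoord n (2 * k - 1)) 𝓘(ℝ, ℝ) ∞
      (localEnergy hk (localLagrangian L z.base) ∘ natCoord z.base) z :=
    ContMDiffAt.comp z (contDiffAt_localEnergy hk hL hb).contMDiffAt (contMDiffAt_natCoord hb)
  refine h.congr_of_eventuallyEq ?_
  filter_upwards [natSource_mem_nhds hb] with y hy using energyL_eq hk hL hy

theorem differential_energyL (hk : 1 ≤ k) (hL : ContMDiff 𝓘(ℝ, JetCoord n k) 𝓘(ℝ, ℝ) ∞ L) {a : Q}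
    {z : HigherTangent n (2 * k - 1) Q} (hz : z ∈ natSource (2 * k - 1) a)
    (v : TangentSpace 𝓘(ℝ, JetCoord n (2 * k - 1)) z) : differential (energyL hk L) z v
      = fderiv ℝ (localEnergy hk (localLagrangian L a)) (natCoord a z) (natTangent a z v) :=
  differential_comp_natCoord hz ((contDiffAt_localEnergy hk hL hz).differentiableAt (by simp))
    (fun _ hy => energyL_eq hk hL hy) v

theorem localOmega_nondegenerate (hL : ContMDiff 𝓘(ℝ, JetCoord n k) 𝓘(ℝ, ℝ) ∞ L)
    (hreg : IsRegularLagrangian L) {a : Q} {z : HigherTangent n (2 * k - 1) Q}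
    (hz : z ∈ natSource (2 * k - 1) a) (v : JetCoord n (2 * k - 1))
    (hv : ∀ w, localOmega (localLagrangian L a) (natCoord a z) v w = 0) : v = 0 := by
  obtain ⟨v', rfl⟩ := (bijective_natTangent hz).2 v
  rw [hreg z v' fun w => by rw [omegaL_apply hL hz]; exact hv _, map_zero]

/-- The equation of motion. -/
theorem omegaL_lagrangianVF (hk : 1 ≤ k) (hL : ContMDiff 𝓘(ℝ, JetCoord n k) 𝓘(ℝ, ℝ) ∞ L)
    (hreg : IsRegularLagrangian L) (z : HigherTangent n (2 * k - 1) Q) :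
    omegaL L z (lagrangianVF hk L z) = differential (energyL hk L) z := by
  have h : ∃ v : TangentSpace 𝓘(ℝ, JetCoord n (2 * k - 1)) z,
      omegaL L z v = differential (energyL hk L) z := by
    have hb := mem_natSource_base z
    obtain ⟨e, he⟩ := exists_equiv_of_nondegenerate (localOmega_nondegenerate hL hreg hb)
    obtain ⟨v, hv⟩ := (bijective_natTangent hb).2
      (e.symm (fderiv ℝ (localEnergy hk (localLagrangian L z.base)) (natCoord z.base z)))
    refine ⟨v, LinearMap.ext fun w => ?_⟩
    rw [omegaL_apply hL hb, hv, differential_energyL hk hL hb, ← he,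
      ContinuousLinearEquiv.coe_coe, ContinuousLinearEquiv.apply_symm_apply]
  rw [lagrangianVF, dif_pos h]
  exact h.choose_spec

theorem localOmega_natTangent_lagrangianVF (hk : 1 ≤ k)
    (hL : ContMDiff 𝓘(ℝ, JetCoord n k) 𝓘(ℝ, ℝ) ∞ L) (hreg : IsRegularLagrangian L) {a : Q}
    {z : HigherTangent n (2 * k - 1) Q} (hz : z ∈ natSource (2 * k - 1) a) :
    localOmega (localLagrangian L a) (natCoord a z) (natTangent a z (lagrangianVF hk L z))
      = fderiv ℝ (localEnergy hk (localLagrangian L a)) (natCoord a z) := by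
  ext1 w
  obtain ⟨w', rfl⟩ := (bijective_natTangent hz).2 w
  rw [← omegaL_apply hL hz, omegaL_lagrangianVF hk hL hreg, differential_energyL hk hL hz]

/-- The field is defined by a choice at each point. Uniqueness identifies it, throughout a fixed
chart, with an explicit formula from which smoothness can be read off. -/
theorem natTangent_lagrangianVF (hk : 1 ≤ k) (hL : ContMDiff 𝓘(ℝ, JetCoord n k) 𝓘(ℝ, ℝ) ∞ L)
    (hreg : IsRegularLagrangian L) {a : Q} {z : HigherTangent n (2 * k - 1) Q}
    (hz : z ∈ natSource (2 * k - 1) a) : natTangent a z (lagrangianVF hk L z)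
      = localVF hk (localLagrangian L a) (natCoord a z) :=
  eq_localVF hk (localOmega_nondegenerate hL hreg hz)
    (localOmega_natTangent_lagrangianVF hk hL hreg hz)

/-- The Lagrangian vector field is a semispray of type 1. -/
theorem natTangent_lagrangianVF_apply (hk : 1 ≤ k)
    (hL : ContMDiff 𝓘(ℝ, JetCoord n k) 𝓘(ℝ, ℝ) ∞ L) (hreg : IsRegularLagrangian L) {a : Q}
    {z : HigherTangent n (2 * k - 1) Q} (hz : z ∈ natSource (2 * k - 1) a) (i : ℕ)
    (hi : i < 2 * k - 1) :
    natTangent a z (lagrangianVF hk L z) ⟨i, by omega⟩ = natCoord a z ⟨i + 1, by omega⟩ :=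
  semispray_of_localOmega_eq hk (chartAt 𝔼 a).open_target (contDiffOn_localLagrangian hL a)
    (natCoord_mem_jetDomain hz) (localOmega_nondegenerate hL hreg hz)
    (localOmega_natTangent_lagrangianVF hk hL hreg hz) i hi

theorem isSmoothVF_lagrangianVF (hk : 1 ≤ k) (hL : ContMDiff 𝓘(ℝ, JetCoord n k) 𝓘(ℝ, ℝ) ∞ L)
    (hreg : IsRegularLagrangian L) : IsSmoothVF (lagrangianVF hk L) := by
  intro z₀
  have hb := mem_natSource_base z₀
  refine (Bundle.contMDiffAt_section z₀).2 ?_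
  have h : ContMDiffAt 𝓘(ℝ, JetCoord n (2 * k - 1)) 𝓘(ℝ, JetCoord n (2 * k - 1)) ∞
      (localVF hk (localLagrangian L z₀.base) ∘ natCoord z₀.base) z₀ :=
    ContMDiffAt.comp z₀ (contDiffAt_localVF hk (chartAt 𝔼 z₀.base).open_target
      (contDiffOn_localLagrangian hL z₀.base) (natCoord_mem_jetDomain hb)
      (localOmega_nondegenerate hL hreg hb)).contMDiffAt (contMDiffAt_natCoord hb)
  refine h.congr_of_eventuallyEq ?_
  filter_upwards [natSource_mem_nhds hb] with z hz
  rw [Function.comp_apply, ← natTangent_lagrangianVF hk hL hreg hz]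
  -- The trivialization of the tangent bundle at `z₀` is the derivative of the preferred chart
  -- there, which is the natural chart over `z₀.base`.
  have h1 := TangentBundle.continuousLinearMapAt_trivializationAt (I := 𝓘(ℝ, JetCoord n (2 * k - 1)))
    (x₀ := z₀) (x := z) hz
  have h2 := congrArg (fun T => T (lagrangianVF hk L z)) h1
  refine Eq.trans ?_ h2
  rw [Bundle.Trivialization.continuousLinearMapAt_apply,
    Bundle.Trivialization.linearMapAt_apply, if_pos]
  exact hz

end LagrangianGeometry

/-! ### Sections, related vector fields and integral curves -/

section RelatedVectorFields

variable {V : Type*} [NormedAddCommGroup V] [NormedSpace ℝ V]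
  {N : Type*} [TopologicalSpace N] [ChartedSpace V N]
  {W : Type*} [NormedAddCommGroup W] [NormedSpace ℝ W]
  {M : Type*} [TopologicalSpace M] [ChartedSpace W M]

theorem isMIntegralCurveOn_comp {f : N → M} (hf : MDifferentiable 𝓘(ℝ, V) 𝓘(ℝ, W) f)
    {X : (x : N) → TangentSpace 𝓘(ℝ, V) x} {Y : (z : M) → TangentSpace 𝓘(ℝ, W) z}
    {γ : ℝ → N} {J : Set ℝ} (hγ : IsMIntegralCurveOn γ X J)
    (h : ∀ t ∈ J, tangentAt f (γ t) (X (γ t)) = Y (f (γ t))) :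
    IsMIntegralCurveOn (f ∘ γ) Y J := by
  intro t ht
  have h1 := (hf (γ t)).hasMFDerivAt.comp_hasMFDerivWithinAt t (hγ t ht)
  refine h1.congr_mfderiv (ContinuousLinearMap.ext_ring ?_)
  change (mfderiv 𝓘(ℝ, V) 𝓘(ℝ, W) f (γ t)) ((1 : ℝ) • X (γ t)) = (1 : ℝ) • Y (f (γ t))
  rw [one_smul, one_smul]
  exact h t ht

theorem IsMIntegralCurveAt.eq_of_hasMFDerivAt {X : (x : N) → TangentSpace 𝓘(ℝ, V) x} {γ : ℝ → N}
    {t : ℝ} (hγ : IsMIntegralCurveAt γ X t) {v : TangentSpace 𝓘(ℝ, V) (γ t)}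
    (h : HasMFDerivAt 𝓘(ℝ, ℝ) 𝓘(ℝ, V) γ t ((1 : ℝ →L[ℝ] ℝ).smulRight v)) : v = X (γ t) := by
  have h1 := hasMFDerivAt_unique h hγ.hasMFDerivAt
  have h2 := congrArg (fun T => T (1 : ℝ)) h1
  change (1 : ℝ) • v = (1 : ℝ) • X (γ t) at h2
  rwa [one_smul, one_smul] at h2

theorem IsMIntegralCurveAt.eq_tangentAt {f : N → M} {X : (x : N) → TangentSpace 𝓘(ℝ, V) x}
    {Y : (z : M) → TangentSpace 𝓘(ℝ, W) z} {γ : ℝ → N} {t : ℝ}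
    (hf : MDifferentiableAt 𝓘(ℝ, V) 𝓘(ℝ, W) f (γ t)) (hγ : IsMIntegralCurveAt γ X t)
    (h : IsMIntegralCurveAt (f ∘ γ) Y t) : tangentAt f (γ t) (X (γ t)) = Y (f (γ t)) := by
  have h1 := hf.hasMFDerivAt.comp t hγ.hasMFDerivAt
  refine IsMIntegralCurveAt.eq_of_hasMFDerivAt h ?_
  refine h1.congr_mfderiv (ContinuousLinearMap.ext_ring ?_)
  change (mfderiv 𝓘(ℝ, V) 𝓘(ℝ, W) f (γ t)) ((1 : ℝ) • X (γ t))
    = (1 : ℝ) • tangentAt f (γ t) (X (γ t))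
  rw [one_smul, one_smul]
  rfl

theorem exists_isMIntegralCurveOn_ball [CompleteSpace V] [IsManifold 𝓘(ℝ, V) ∞ N]
    {X : (x : N) → TangentSpace 𝓘(ℝ, V) x} (hX : IsSmoothVF X) (x : N) (t₀ : ℝ) :
    ∃ γ : ℝ → N, γ t₀ = x ∧ ∃ ε > 0, IsMIntegralCurveOn γ X (Metric.ball t₀ ε) := by
  obtain ⟨γ, hγ, h⟩ := exists_isMIntegralCurveAt_of_contMDiffAt_boundaryless t₀
    ((hX x).of_le (by exact_mod_cast le_top : (1 : WithTop ℕ∞) ≤ ∞))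
  exact ⟨γ, hγ, isMIntegralCurveAt_iff'.1 h⟩

theorem eventuallyEq_of_isMIntegralCurveAt [IsManifold 𝓘(ℝ, V) ∞ N]
    {X : (x : N) → TangentSpace 𝓘(ℝ, V) x} (hX : IsSmoothVF X) {γ γ' : ℝ → N} {t : ℝ}
    (hγ : IsMIntegralCurveAt γ X t) (hγ' : IsMIntegralCurveAt γ' X t) (h : γ t = γ' t) :
    γ =ᶠ[𝓝 t] γ' :=
  isMIntegralCurveAt_eventuallyEq_of_contMDiffAt_boundaryless
    ((hX (γ t)).of_le (by exact_mod_cast le_top : (1 : WithTop ℕ∞) ≤ ∞)) hγ hγ' h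

theorem isOpen_and_ordConnected_ball (t ε : ℝ) :
    IsOpen (Metric.ball t ε) ∧ (Metric.ball t ε).OrdConnected := by
  refine ⟨Metric.isOpen_ball, ?_⟩
  rw [Real.ball_eq_Ioo]
  exact ordConnected_Ioo

/-- An integral curve of `X` passes through every point; comparing initial velocities gives the
relation, and the chain rule gives the converse. -/
theorem mapsIntegralCurves_iff_areRelated [CompleteSpace V] [IsManifold 𝓘(ℝ, V) ∞ N] {s : N → M}
    (hs : MDifferentiable 𝓘(ℝ, V) 𝓘(ℝ, W) s) {X : (x : N) → TangentSpace 𝓘(ℝ, V) x}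
    (hX : IsSmoothVF X) (Y : (z : M) → TangentSpace 𝓘(ℝ, W) z) :
    MapsIntegralCurves s X Y ↔ AreRelated s X Y := by
  refine ⟨fun h x => ?_, fun h γ J _ _ hγ => isMIntegralCurveOn_comp hs hγ fun t _ => (h _).symm⟩
  obtain ⟨γ, hγ, ε, hε, hγX⟩ := exists_isMIntegralCurveOn_ball hX x 0
  obtain ⟨ho, hc⟩ := isOpen_and_ordConnected_ball 0 ε
  have hn := Metric.ball_mem_nhds (0 : ℝ) hε
  have h1 := h γ _ ho hc hγX
  have h2 := IsMIntegralCurveAt.eq_tangentAt (hs (γ 0)) (hγX.isMIntegralCurveAt hn)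
    (h1.isMIntegralCurveAt hn)
  rw [hγ] at h2
  exact h2.symm

/-- The derivative of a retraction `ρ` of `s` at a point `s x`, as a map to the tangent space
at `x = ρ (s x)`. -/
noncomputable def retractTangent (s : N → M) (ρ : M → N) (x : N) :
    TangentSpace 𝓘(ℝ, W) (s x) →ₗ[ℝ] TangentSpace 𝓘(ℝ, V) x :=
  (tangentAt ρ (s x) : W →ₗ[ℝ] V)

variable {s : N → M} {ρ : M → N}

theorem retractTangent_tangentAt (hs : MDifferentiable 𝓘(ℝ, V) 𝓘(ℝ, W) s)
    (hρ : MDifferentiable 𝓘(ℝ, W) 𝓘(ℝ, V) ρ) (hsec : ∀ x, ρ (s x) = x) (x : N)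
    (w : TangentSpace 𝓘(ℝ, V) x) :
    retractTangent (V := V) (W := W) s ρ x (tangentAt (V := V) (W := W) s x w) = w := by
  have h := (hρ (s x)).hasMFDerivAt.comp x (hs x).hasMFDerivAt
  have hid : ρ ∘ s = id := funext hsec
  rw [hid] at h
  have h1 := hasMFDerivAt_unique h (hasMFDerivAt_id x)
  exact congrArg (fun T => T w) h1

variable {Y : (z : M) → TangentSpace 𝓘(ℝ, W) z} {X Z : (x : N) → TangentSpace 𝓘(ℝ, V) x}

theorem eq_of_areRelated (hs : MDifferentiable 𝓘(ℝ, V) 𝓘(ℝ, W) s)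
    (hρ : MDifferentiable 𝓘(ℝ, W) 𝓘(ℝ, V) ρ) (hsec : ∀ x, ρ (s x) = x)
    (hZ : ∀ x, Z x = retractTangent s ρ x (Y (s x))) (h : AreRelated s X Y) : X = Z := by
  funext x
  rw [hZ, h x, retractTangent_tangentAt hs hρ hsec]

theorem isTangentToImage_iff_areRelated (hs : MDifferentiable 𝓘(ℝ, V) 𝓘(ℝ, W) s)
    (hρ : MDifferentiable 𝓘(ℝ, W) 𝓘(ℝ, V) ρ) (hsec : ∀ x, ρ (s x) = x)
    (hZ : ∀ x, Z x = retractTangent s ρ x (Y (s x))) :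
    IsTangentToImage (V := V) s Y ↔ AreRelated s Z Y := by
  refine ⟨fun h x => ?_, fun h x => ⟨Z x, (h x).symm⟩⟩
  obtain ⟨w, hw⟩ := h x
  rw [hZ, ← hw, retractTangent_tangentAt hs hρ hsec]

/-- An integral curve `σ` starting in the image stays there, so `s ∘ ρ ∘ σ = σ` near time zero;
differentiating exhibits `Y` as a value of `Ts`. -/
theorem isTangentToImage_of_isFlowInvariant [CompleteSpace W] [IsManifold 𝓘(ℝ, W) ∞ M]
    (hs : MDifferentiable 𝓘(ℝ, V) 𝓘(ℝ, W) s)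
    (hρ : MDifferentiable 𝓘(ℝ, W) 𝓘(ℝ, V) ρ) (hsec : ∀ x, ρ (s x) = x) (hY : IsSmoothVF Y)
    (h : IsFlowInvariant (range s) Y) : IsTangentToImage (V := V) s Y := by
  -- The point `z` is kept separate from `s x` so that it can be replaced by `σ 0` without rewriting
  -- inside dependent tangent spaces.
  have key : ∀ (z : M) (x : N), s x = z → Y z ∈ range (mfderiv 𝓘(ℝ, V) 𝓘(ℝ, W) s x : V → W) := by
    intro z x hx
    obtain ⟨σ, rfl, ε, hε, hσY⟩ := exists_isMIntegralCurveOn_ball hY z 0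
    obtain ⟨ho, hc⟩ := isOpen_and_ordConnected_ball 0 ε
    have hn := Metric.ball_mem_nhds (0 : ℝ) hε
    have h0 := Metric.mem_ball_self (x := (0 : ℝ)) hε
    have hev : (s ∘ ρ) ∘ σ =ᶠ[𝓝 0] σ := by
      filter_upwards [hn] with t ht
      obtain ⟨y, hy⟩ := h σ _ ho hc hσY 0 h0 ⟨x, hx⟩ t ht
      simp [← hy, hsec]
    have hY0 := hσY.isMIntegralCurveAt hn
    have hsρ : HasMFDerivAt 𝓘(ℝ, W) 𝓘(ℝ, W) (s ∘ ρ) (σ 0) _ :=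
      (hs _).hasMFDerivAt.comp (σ 0) (hρ _).hasMFDerivAt
    have h1 := (hsρ.comp (0 : ℝ) hY0.hasMFDerivAt).congr_of_eventuallyEq hev.symm
    have h2 := hasMFDerivAt_unique hY0.hasMFDerivAt h1
    have h3 := congrArg (fun T => T (1 : ℝ)) h2
    obtain rfl : ρ (σ 0) = x := by rw [← hx, hsec]
    change (1 : ℝ) • Y (σ 0) = (mfderiv 𝓘(ℝ, V) 𝓘(ℝ, W) s (ρ (σ 0)))
      ((mfderiv 𝓘(ℝ, W) 𝓘(ℝ, V) ρ (σ 0)) ((1 : ℝ) • Y (σ 0))) at h3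
    rw [one_smul] at h3
    exact ⟨_, h3.symm⟩
  intro x
  exact key (s x) x rfl

/-- The times spent in the image form a nonempty subset that is open and closed in the connected
interval `J`. -/
theorem isFlowInvariant_of_areRelated [CompleteSpace V] [IsManifold 𝓘(ℝ, V) ∞ N]
    [IsManifold 𝓘(ℝ, W) ∞ M] [T2Space M] (hs : MDifferentiable 𝓘(ℝ, V) 𝓘(ℝ, W) s)
    (hρ : Continuous ρ) (hsec : ∀ x, ρ (s x) = x) (hY : IsSmoothVF Y) (hX : IsSmoothVF X)
    (h : AreRelated s X Y) : IsFlowInvariant (range s) Y := by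
  have hrange : ∀ z, z ∈ range s ↔ s (ρ z) = z := fun z =>
    ⟨by rintro ⟨x, rfl⟩; rw [hsec], fun hz => ⟨_, hz⟩⟩
  intro σ J hJ hJc hσ t₀ ht₀ hσt₀
  have hσc : ∀ t ∈ J, ContinuousAt σ t := fun t ht =>
    (hσ.continuousWithinAt ht).continuousAt (hJ.mem_nhds ht)
  set T : Set ℝ := {t | σ t ∈ range s} ∩ J with hT
  suffices hsub : J ⊆ T from fun t ht => (hsub ht).1
  refine hJc.isPreconnected.subset_of_closure_inter_subset (u := T) ?_ ⟨t₀, ht₀, hσt₀, ht₀⟩ ?_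
  -- Openness: `s` carries an integral curve of `X` to one of `Y`, and local uniqueness identifies
  -- it with `σ`.
  · rw [isOpen_iff_mem_nhds]
    rintro t ⟨⟨x, hx⟩, ht⟩
    obtain ⟨γ, rfl, ε, hε, hγ⟩ := exists_isMIntegralCurveOn_ball hX x t
    have h1 := isMIntegralCurveOn_comp hs hγ fun t _ => (h (γ t)).symm
    have h2 := eventuallyEq_of_isMIntegralCurveAt hY
      (h1.isMIntegralCurveAt (Metric.ball_mem_nhds t hε)) (hσ.isMIntegralCurveAt (hJ.mem_nhds ht))
      hx
    filter_upwards [h2, hJ.mem_nhds ht] with τ hτ hτJ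
    exact ⟨⟨γ τ, hτ⟩, hτJ⟩
  -- Closedness: the image is the fixed set of the continuous map `s ∘ ρ`, and limits in `M` are
  -- unique.
  · rintro t ⟨htT, htJ⟩
    refine ⟨(hrange _).2 ?_, htJ⟩
    have h1 : ContinuousAt (fun t => s (ρ (σ t))) t :=
      (hs _).continuousAt.comp (hρ.continuousAt.comp (hσc t htJ))
    have : (𝓝[T] t).NeBot := mem_closure_iff_nhdsWithin_neBot.1 htT
    refine tendsto_nhds_unique (l := 𝓝[T] t) (h1.tendsto.mono_left nhdsWithin_le_nhds)
      (Tendsto.congr' ?_ ((hσc t htJ).tendsto.mono_left nhdsWithin_le_nhds))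
    filter_upwards [self_mem_nhdsWithin] with τ hτ
    exact ((hrange _).1 hτ.1).symm

theorem projectsIntegralCurves_of_areRelated (hs : MDifferentiable 𝓘(ℝ, V) 𝓘(ℝ, W) s)
    (hρ : MDifferentiable 𝓘(ℝ, W) 𝓘(ℝ, V) ρ) (hsec : ∀ x, ρ (s x) = x)
    (hinv : IsFlowInvariant (range s) Y) (h : AreRelated s X Y) :
    ProjectsIntegralCurves ρ (range s) Y X := by
  intro σ J hJ hJc hσ t₀ ht₀ hσt₀
  refine isMIntegralCurveOn_comp hρ hσ fun t ht => ?_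
  obtain ⟨x, hx⟩ := hinv σ J hJ hJc hσ t₀ ht₀ hσt₀ t ht
  rw [← hx]
  have h1 := retractTangent_tangentAt hs hρ hsec x (X x)
  rw [← h x] at h1
  have h2 : ∀ y, y = x → @Eq V (X x) (X y) := by
    rintro y rfl
    rfl
  exact Eq.trans h1 (h2 _ (hsec x))

/-- If integral curves of `Y` are determined by their projections, a field that projects them
is related to `Y`. -/
theorem areRelated_of_projectsIntegralCurves [CompleteSpace W] [CompleteSpace V]
    [IsManifold 𝓘(ℝ, V) ∞ N] [IsManifold 𝓘(ℝ, W) ∞ M]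
    (hs : MDifferentiable 𝓘(ℝ, V) 𝓘(ℝ, W) s)
    (hρ : MDifferentiable 𝓘(ℝ, W) 𝓘(ℝ, V) ρ) (hsec : ∀ x, ρ (s x) = x) (hY : IsSmoothVF Y)
    (hX : IsSmoothVF X)
    (hdet : ∀ (σ σ' : ℝ → M) (t : ℝ), IsMIntegralCurveAt σ Y t → IsMIntegralCurveAt σ' Y t →
      ρ ∘ σ =ᶠ[𝓝 t] ρ ∘ σ' → σ t = σ' t)
    (h : ProjectsIntegralCurves ρ (range s) Y X) :
    AreRelated s X Y := by
  have hinv : IsFlowInvariant (range s) Y := by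
    intro σ J hJ hJc hσ t₀ ht₀ hσt₀ t ht
    have h1 := (h σ J hJ hJc hσ t₀ ht₀ hσt₀).isMIntegralCurveAt (hJ.mem_nhds ht)
    -- The comparison curve starts at the point of the image below which `σ t` projects. Both
    -- projections are integral curves of `X` through one point, so they agree locally; `hdet` then
    -- places `σ t` in the image.
    obtain ⟨σ', hσ', ε, hε, hσY⟩ := exists_isMIntegralCurveOn_ball hY (s (ρ (σ t))) t
    obtain ⟨ho, hc⟩ := isOpen_and_ordConnected_ball t ε
    have hn := Metric.ball_mem_nhds t hε
    have h2 := (h σ' _ ho hc hσY t (Metric.mem_ball_self hε)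
      ⟨_, hσ'.symm⟩).isMIntegralCurveAt hn
    have h3 := eventuallyEq_of_isMIntegralCurveAt hX h1 h2 (by
      rw [Function.comp_apply, Function.comp_apply, hσ', hsec])
    rw [hdet σ σ' t (hσ.isMIntegralCurveAt (hJ.mem_nhds ht)) (hσY.isMIntegralCurveAt hn) h3, hσ']
    exact ⟨_, rfl⟩
  have htan := isTangentToImage_of_isFlowInvariant hs hρ hsec hY hinv
  have hrel := (isTangentToImage_iff_areRelated hs hρ hsec (fun _ => rfl)).1 htan
  -- Initial velocities of projected curves identify `X`; this had to be proved, as the hypothesis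
  -- does not fix `X` in advance.
  have hXZ : X = fun x => retractTangent s ρ x (Y (s x)) := by
    have key : ∀ (z : M) (x : N), s x = z →
        @Eq V (X x) ((tangentAt ρ z : W →ₗ[ℝ] V) (Y z)) := by
      intro z x hx
      obtain ⟨σ, rfl, ε, hε, hσY⟩ := exists_isMIntegralCurveOn_ball hY z 0
      obtain ⟨ho, hc⟩ := isOpen_and_ordConnected_ball 0 ε
      have hn := Metric.ball_mem_nhds (0 : ℝ) hε
      have h1 := h σ _ ho hc hσY 0 (Metric.mem_ball_self hε) ⟨x, hx⟩
      have h2 := IsMIntegralCurveAt.eq_tangentAt (hρ (σ 0)) (hσY.isMIntegralCurveAt hn)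
        (h1.isMIntegralCurveAt hn)
      obtain rfl : ρ (σ 0) = x := by rw [← hx, hsec]
      exact h2.symm
    funext x
    exact key (s x) x rfl
  rw [hXZ]
  exact hrel

end RelatedVectorFields

/-! ### Sections of a projection with isotropic fibres -/

section SymplecticSections

variable {V : Type*} [NormedAddCommGroup V] [NormedSpace ℝ V]
  {N : Type*} [TopologicalSpace N] [ChartedSpace V N]
  {W : Type*} [NormedAddCommGroup W] [NormedSpace ℝ W]
  {M : Type*} [TopologicalSpace M] [ChartedSpace W M]
  {s : N → M} {ρ : M → N} {Y : (z : M) → TangentSpace 𝓘(ℝ, W) z}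
  {X Z : (x : N) → TangentSpace 𝓘(ℝ, V) x}
  {Ω : (z : M) → TangentSpace 𝓘(ℝ, W) z →ₗ[ℝ] TangentSpace 𝓘(ℝ, W) z →ₗ[ℝ] ℝ} {E : M → ℝ}

theorem differential_comp (hE : MDifferentiable 𝓘(ℝ, W) 𝓘(ℝ, ℝ) E)
    (hs : MDifferentiable 𝓘(ℝ, V) 𝓘(ℝ, W) s) (x : N) (w : TangentSpace 𝓘(ℝ, V) x) :
    differential (V := V) (E ∘ s) x w
      = differential (V := W) E (s x) (tangentAt (V := V) (W := W) s x w) := by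
  rw [differential, mfderiv_comp x (hE (s x)) (hs x)]
  rfl

/-- A vertical vector that is orthogonal to the image of a section vanishes, if the fibres are
isotropic and the form is nondegenerate. -/
theorem eq_zero_of_vertical (hs : MDifferentiable 𝓘(ℝ, V) 𝓘(ℝ, W) s)
    (hρ : MDifferentiable 𝓘(ℝ, W) 𝓘(ℝ, V) ρ) (hsec : ∀ x, ρ (s x) = x)
    (hnd : ∀ z v, (∀ w, Ω z v w = 0) → v = 0)
    (hvert : ∀ z v w, tangentAt (W := V) ρ z v = 0 → tangentAt (W := V) ρ z w = 0 → Ω z v w = 0)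
    {x : N} {u : TangentSpace 𝓘(ℝ, W) (s x)} (hu : retractTangent (V := V) s ρ x u = 0)
    (h : ∀ w, Ω (s x) u (tangentAt (V := V) s x w) = 0) : u = 0 := by
  refine hnd _ _ fun v => ?_
  -- Any `v` splits into a vertical part and a part tangent to the image; `u` is orthogonal to the
  -- first by isotropy and to the second by hypothesis.
  have h1 : Ω (s x) u (v - tangentAt s x (retractTangent (V := V) s ρ x v)) = 0 := by
    refine hvert _ _ _ hu ?_
    change retractTangent (V := V) s ρ x _ = 0
    rw [map_sub, retractTangent_tangentAt hs hρ hsec, sub_self]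
  rwa [map_sub, h, sub_zero] at h1

/-- The defect `Ts Z - Y` is vertical by the choice of `Z`, and the pulled-back equation says that
it is orthogonal to the image; `eq_zero_of_vertical` concludes. -/
theorem areRelated_iff_pullbackTwo (hs : MDifferentiable 𝓘(ℝ, V) 𝓘(ℝ, W) s)
    (hρ : MDifferentiable 𝓘(ℝ, W) 𝓘(ℝ, V) ρ) (hsec : ∀ x, ρ (s x) = x)
    (hnd : ∀ z v, (∀ w, Ω z v w = 0) → v = 0)
    (hvert : ∀ z v w, tangentAt (W := V) ρ z v = 0 → tangentAt (W := V) ρ z w = 0 → Ω z v w = 0)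
    (hE : MDifferentiable 𝓘(ℝ, W) 𝓘(ℝ, ℝ) E) (hYE : ∀ z, Ω z (Y z) = differential E z)
    (hZ : ∀ x, Z x = retractTangent s ρ x (Y (s x))) :
    AreRelated s Z Y ↔
      ∀ x, pullbackTwo (V := V) s Ω x (Z x) = differential (V := V) (E ∘ s) x := by
  have key : ∀ x w, pullbackTwo (V := V) s Ω x (Z x) w - differential (V := V) (E ∘ s) x w
      = Ω (s x) (tangentAt s x (Z x) - Y (s x)) (tangentAt s x w) := by
    intro x w
    rw [differential_comp hE hs, ← hYE, map_sub]
    rfl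
  refine ⟨fun h x => ?_, fun h x => ?_⟩
  · ext w
    rw [← sub_eq_zero, key, ← h x, sub_self, map_zero, LinearMap.zero_apply]
  · refine (sub_eq_zero.1 (eq_zero_of_vertical hs hρ hsec hnd hvert (x := x) ?_ fun w => ?_)).symm
    · rw [map_sub, retractTangent_tangentAt hs hρ hsec, hZ, sub_self]
    · rw [← key, h x, sub_self]

/-- If the image is isotropic and `v` is orthogonal to it, then `v - Ts (Tρ v)` is vertical and
orthogonal to the image, hence zero. Maximality is thus automatic. -/
theorem isLagrangianImage_iff (hs : MDifferentiable 𝓘(ℝ, V) 𝓘(ℝ, W) s)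
    (hρ : MDifferentiable 𝓘(ℝ, W) 𝓘(ℝ, V) ρ) (hsec : ∀ x, ρ (s x) = x)
    (hnd : ∀ z v, (∀ w, Ω z v w = 0) → v = 0)
    (hvert : ∀ z v w, tangentAt (W := V) ρ z v = 0 → tangentAt (W := V) ρ z w = 0 → Ω z v w = 0) :
    IsLagrangianImage (V := V) s Ω ↔ ∀ x, pullbackTwo (V := V) s Ω x = 0 := by
  refine ⟨fun h x => ?_, fun h x v => ⟨?_, fun hv => ?_⟩⟩
  · ext v w
    exact (h x _).1 ⟨v, rfl⟩ _ ⟨w, rfl⟩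
  · rintro ⟨v, rfl⟩ _ ⟨w, rfl⟩
    exact congrArg (fun T => T v w) (h x)
  · refine ⟨retractTangent (V := V) s ρ x v, (sub_eq_zero.1
      (eq_zero_of_vertical hs hρ hsec hnd hvert (x := x) ?_ fun w => ?_)).symm⟩
    · rw [map_sub, retractTangent_tangentAt hs hρ hsec, sub_self]
    · have h1 : Ω (s x) (tangentAt s x (retractTangent (V := V) s ρ x v))
          (tangentAt (V := V) s x w) = 0 :=
        congrArg (fun T => T (retractTangent (V := V) s ρ x v) w) (h x)
      rw [map_sub, LinearMap.sub_apply, hv _ ⟨w, rfl⟩, h1, sub_self]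

end SymplecticSections

/-! ### Locally constant functions and the Poincaré lemma on a manifold -/

section LocalPotentials

variable {V : Type*} [NormedAddCommGroup V] [NormedSpace ℝ V]
  {N : Type*} [TopologicalSpace N] [ChartedSpace V N] [IsManifold 𝓘(ℝ, V) ∞ N]

theorem differential_eq_fderiv_comp {f : N → ℝ} {x y : N} (hy : y ∈ (chartAt V x).source)
    (hf : MDifferentiableAt 𝓘(ℝ, V) 𝓘(ℝ, ℝ) f y) :
    DifferentiableAt ℝ (f ∘ (chartAt V x).symm) (chartAt V x y) ∧
    ∀ v, differential f y v = fderiv ℝ (f ∘ (chartAt V x).symm) (chartAt V x y)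
      (mfderiv 𝓘(ℝ, V) 𝓘(ℝ, V) (chartAt V x) y v) := by
  have hy' := (chartAt V x).map_source hy
  have hsymm : MDifferentiableAt 𝓘(ℝ, V) 𝓘(ℝ, V) (chartAt V x).symm (chartAt V x y) :=
    mdifferentiableAt_atlas_symm (chart_mem_atlas V x) hy'
  have hf' : MDifferentiableAt 𝓘(ℝ, V) 𝓘(ℝ, ℝ) f ((chartAt V x).symm (chartAt V x y)) := by
    rwa [(chartAt V x).left_inv hy]
  have hd : MDifferentiableAt 𝓘(ℝ, V) 𝓘(ℝ, ℝ) (f ∘ (chartAt V x).symm) (chartAt V x y) :=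
    hf'.comp _ hsymm
  have hd' := mdifferentiableAt_iff_differentiableAt.1 hd
  refine ⟨hd', fun v => ?_⟩
  have h1 : HasMFDerivAt 𝓘(ℝ, V) 𝓘(ℝ, ℝ) ((f ∘ (chartAt V x).symm) ∘ chartAt V x) y
      ((fderiv ℝ (f ∘ (chartAt V x).symm) (chartAt V x y)).comp
        (mfderiv 𝓘(ℝ, V) 𝓘(ℝ, V) (chartAt V x) y)) :=
    HasMFDerivAt.comp y hd'.hasFDerivAt.hasMFDerivAt
      (mdifferentiableAt_atlas (chart_mem_atlas V x) hy).hasMFDerivAt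
  have hev : f =ᶠ[𝓝 y] (f ∘ (chartAt V x).symm) ∘ chartAt V x := by
    filter_upwards [(chartAt V x).open_source.mem_nhds hy] with y' hy'
    simp [(chartAt V x).left_inv hy']
  rw [differential, (h1.congr_of_eventuallyEq hev).mfderiv]
  rfl

theorem bijective_mfderiv_chartAt {x y : N} (hy : y ∈ (chartAt V x).source) :
    Function.Bijective (mfderiv 𝓘(ℝ, V) 𝓘(ℝ, V) (chartAt V x) y) :=
  (mdifferentiable_of_mem_atlas (I := 𝓘(ℝ, V)) (chart_mem_atlas V x)).mfderiv_bijective hy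

theorem isLocallyConstant_iff_differential_eq_zero {f : N → ℝ}
    (hf : MDifferentiable 𝓘(ℝ, V) 𝓘(ℝ, ℝ) f) :
    (∀ x, differential (V := V) f x = 0) ↔ IsLocallyConstant f := by
  rw [IsLocallyConstant.iff_eventually_eq]
  refine ⟨fun h x => ?_, fun h x => ?_⟩
  · set e := chartAt V x
    have hx := mem_chart_source V x
    obtain ⟨ε, hε, hB⟩ := Metric.isOpen_iff.1 e.open_target _ (e.map_source hx)
    have hg : ∀ u ∈ Metric.ball (e x) ε, DifferentiableAt ℝ (f ∘ e.symm) u ∧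
        fderiv ℝ (f ∘ e.symm) u = 0 := by
      intro u hu
      have hy := e.map_target (hB hu)
      have h1 := differential_eq_fderiv_comp hy (hf _)
      rw [e.right_inv (hB hu)] at h1
      refine ⟨h1.1, ContinuousLinearMap.ext fun v => ?_⟩
      obtain ⟨v', rfl⟩ := (bijective_mfderiv_chartAt hy).2 v
      refine (h1.2 v').symm.trans ?_
      rw [h]
      rfl
    filter_upwards [e.open_source.mem_nhds hx, (e.continuousAt hx).preimage_mem_nhds
      (Metric.ball_mem_nhds _ hε)] with y hy hyB
    have h2 : (f ∘ e.symm) (e y) = (f ∘ e.symm) (e x) :=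
      (convex_ball (e x) ε).is_const_of_fderivWithin_eq_zero (𝕜 := ℝ)
        (fun u hu => (hg u hu).1.differentiableWithinAt)
        (fun u hu => by rw [fderivWithin_of_isOpen Metric.isOpen_ball hu, (hg u hu).2])
        hyB (Metric.mem_ball_self hε)
    simpa [e.left_inv hy, e.left_inv hx] using h2
  · have h1 : f =ᶠ[𝓝 x] fun _ => f x := h x
    ext v
    rw [differential, h1.mfderiv_eq, mfderiv_const]
    rfl

/-- The Poincaré lemma for a 1-form that is locally of the form `∑ P_i dQ_i`. -/
theorem hasLocalPotentials_of_closed [CompleteSpace V]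
    {θ : (x : N) → TangentSpace 𝓘(ℝ, V) x →ₗ[ℝ] ℝ} {ι : Type*}
    [Fintype ι] {U : N → Set N} (hU : ∀ x, IsOpen (U x)) (hxU : ∀ x, x ∈ U x)
    {P R : N → ι → N → ℝ} (hP : ∀ x i, ContMDiffOn 𝓘(ℝ, V) 𝓘(ℝ, ℝ) ∞ (P x i) (U x))
    (hR : ∀ x i, ContMDiffOn 𝓘(ℝ, V) 𝓘(ℝ, ℝ) ∞ (R x i) (U x))
    (hθ : ∀ x, ∀ y ∈ U x, ∀ v, θ y v = ∑ i, P x i y * differential (V := V) (R x i) y v)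
    (hclosed : ∀ x, ∀ y ∈ U x, ∀ v w,
      ∑ i, (differential (V := V) (P x i) y v * differential (V := V) (R x i) y w
        - differential (V := V) (P x i) y w * differential (V := V) (R x i) y v) = 0) :
    HasLocalPotentials θ := by
  intro x
  set e := chartAt V x
  have hx := mem_chart_source V x
  have hopen : IsOpen (e.target ∩ e.symm ⁻¹' U x) := e.isOpen_inter_preimage_symm (hU x)
  obtain ⟨ε, hε, hB⟩ := Metric.isOpen_iff.1 hopen (e x) ⟨e.map_source hx, by
    rw [mem_preimage, e.left_inv hx]
    exact hxU x⟩
  set B := Metric.ball (e x) ε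
  have hsymm : ContMDiffOn 𝓘(ℝ, V) 𝓘(ℝ, V) ∞ e.symm B :=
    (contMDiffOn_chart_symm (I := 𝓘(ℝ, V)) (x := x)).mono fun u hu => (hB hu).1
  have hsm : ∀ {f : N → ℝ}, ContMDiffOn 𝓘(ℝ, V) 𝓘(ℝ, ℝ) ∞ f (U x) →
      ContDiffOn ℝ ∞ (f ∘ e.symm) B := fun hf =>
    contMDiffOn_iff_contDiffOn.1 (hf.comp hsymm fun u hu => (hB hu).2)
  have hmd : ∀ {f : N → ℝ}, ContMDiffOn 𝓘(ℝ, V) 𝓘(ℝ, ℝ) ∞ f (U x) → ∀ y ∈ U x,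
      MDifferentiableAt 𝓘(ℝ, V) 𝓘(ℝ, ℝ) f y := fun hf y hy =>
    (hf.contMDiffAt ((hU x).mem_nhds hy)).mdifferentiableAt (by simp)
  set η : V → V →L[ℝ] ℝ := fun u =>
    ∑ i, (P x i ∘ e.symm) u • fderiv ℝ (R x i ∘ e.symm) u with hη
  have hηv : ∀ u v, η u v = ∑ i, (P x i ∘ e.symm) u * fderiv ℝ (R x i ∘ e.symm) u v := by
    intro u v
    simp [hη]
  have hηs : ContDiffOn ℝ ∞ η B := ContDiffOn.sum fun i _ =>
    (hsm (hP x i)).smul ((hsm (hR x i)).fderiv_of_isOpen (m := ∞) Metric.isOpen_ball (by simp))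
  -- In a chart, `∑ dP_i ∧ dR_i = 0` becomes symmetry of the derivative of `η`, the hypothesis of
  -- the Poincaré lemma on a convex ball.
  have hηc : ∀ u ∈ B, ∀ v w, fderiv ℝ η u v w = fderiv ℝ η u w v := by
    intro u hu v w
    have hn := Metric.isOpen_ball.mem_nhds hu
    have h1 := fderiv_sum_smul_fderiv_sub (P := fun i => P x i ∘ e.symm)
      (Q := fun i => R x i ∘ e.symm)
      (fun i => ((hsm (hP x i)).contDiffAt hn).differentiableAt (by simp))
      (fun i => (hsm (hR x i)).contDiffAt hn) v w
    have hy := e.map_target (hB hu).1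
    obtain ⟨v', hv⟩ := (bijective_mfderiv_chartAt hy).2 v
    obtain ⟨w', hw⟩ := (bijective_mfderiv_chartAt hy).2 w
    have hdf : ∀ {f : N → ℝ}, ContMDiffOn 𝓘(ℝ, V) 𝓘(ℝ, ℝ) ∞ f (U x) → ∀ v,
        differential f (e.symm u) v
          = fderiv ℝ (f ∘ e.symm) u (mfderiv 𝓘(ℝ, V) 𝓘(ℝ, V) e (e.symm u) v) := by
      intro f hf v
      have h2 := (differential_eq_fderiv_comp hy (hmd hf _ (hB hu).2)).2 v
      rwa [e.right_inv (hB hu).1] at h2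
    have h2 := hclosed x _ (hB hu).2 v' w'
    simp only [hdf (hP x _), hdf (hR x _)] at h2
    refine sub_eq_zero.1 (h1.trans ?_)
    rw [← hv, ← hw]
    exact h2
  obtain ⟨g, hg⟩ := (convex_ball (e x) ε).exists_forall_hasFDerivAt_of_fderiv_symmetric
    Metric.isOpen_ball (hηs.differentiableOn (by simp)) hηc
  have hgs : ContDiffOn ℝ ∞ g B := by
    refine (contDiffOn_infty_iff_fderiv_of_isOpen Metric.isOpen_ball).2
      ⟨fun u hu => (hg u hu).differentiableAt.differentiableWithinAt, ?_⟩
    exact hηs.congr fun u hu => (hg u hu).fderiv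
  have hS : IsOpen (e.source ∩ e ⁻¹' B) := e.isOpen_inter_preimage Metric.isOpen_ball
  refine ⟨e.source ∩ e ⁻¹' B, g ∘ e, hS, ⟨hx, Metric.mem_ball_self hε⟩, ?_, ?_⟩
  · exact (contMDiffOn_iff_contDiffOn.2 hgs).comp
      ((contMDiffOn_chart (I := 𝓘(ℝ, V)) (x := x)).mono inter_subset_left) fun y hy => hy.2
  · rintro y ⟨hy, hyB⟩
    have hyU : y ∈ U x := by
      have := (hB hyB).2
      rwa [mem_preimage, e.left_inv hy] at this
    ext v
    have h1 : HasMFDerivAt 𝓘(ℝ, V) 𝓘(ℝ, ℝ) (g ∘ e) y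
        ((η (e y)).comp (mfderiv 𝓘(ℝ, V) 𝓘(ℝ, V) e y)) :=
      HasMFDerivAt.comp y (hg _ hyB).hasMFDerivAt
        (mdifferentiableAt_atlas (chart_mem_atlas V x) hy).hasMFDerivAt
    rw [hθ x y hyU, differential, h1.mfderiv]
    refine Eq.trans ?_ (hηv (e y) (mfderiv 𝓘(ℝ, V) 𝓘(ℝ, V) e y v)).symm
    simp only [Function.comp_apply, e.left_inv hy]
    refine Finset.sum_congr rfl fun i _ => ?_
    rw [(differential_eq_fderiv_comp hy (hmd (hR x i) y hyU)).2]

end LocalPotentials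

/-! ### The projection `ρ`, the associated field and the generating functions -/

section HamiltonJacobi

variable {n m k : ℕ} {Q : Type*} [TopologicalSpace Q] [ChartedSpace (EuclideanSpace ℝ (Fin n)) Q]

local notation "𝔼" => EuclideanSpace ℝ (Fin n)

theorem rho_mem_natSource {a : Q} {z : HigherTangent n (2 * k - 1) Q} :
    rho z ∈ natSource (k - 1) a ↔ z ∈ natSource (2 * k - 1) a := by
  change HigherTangent.base _ ∈ (chartAt 𝔼 a).source ↔ _
  rw [rho, base_proj]
  rfl

variable [IsManifold (𝓡 n) ∞ Q]

theorem contMDiff_rho : ContMDiff 𝓘(ℝ, JetCoord n (2 * k - 1)) 𝓘(ℝ, JetCoord n (k - 1)) ∞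
    (rho : HigherTangent n (2 * k - 1) Q → HigherTangent n (k - 1) Q) :=
  contMDiff_proj (by omega : k - 1 ≤ 2 * k - 1)

theorem natTangent_rho {a : Q} {z : HigherTangent n (2 * k - 1) Q}
    (hz : z ∈ natSource (2 * k - 1) a) (v : TangentSpace 𝓘(ℝ, JetCoord n (2 * k - 1)) z) :
    natTangent a (rho z) (tangentAt (W := JetCoord n (k - 1)) rho z v)
      = truncCoord (by omega) (natTangent a z v) := by
  let T : JetCoord n (2 * k - 1) →L[ℝ] JetCoord n (k - 1) := ContinuousLinearMap.pi fun i =>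
    ContinuousLinearMap.proj (R := ℝ) (φ := fun _ : Fin (2 * k - 1 + 1) => 𝔼)
      (Fin.castLE (by omega) i)
  have h1 : HasMFDerivAt 𝓘(ℝ, JetCoord n (2 * k - 1)) 𝓘(ℝ, JetCoord n (k - 1))
      (T ∘ natCoord a) z (T.comp (natTangent a z)) :=
    HasMFDerivAt.comp z T.hasFDerivAt.hasMFDerivAt (hasMFDerivAt_natCoord hz)
  have h2 : HasMFDerivAt 𝓘(ℝ, JetCoord n (2 * k - 1)) 𝓘(ℝ, JetCoord n (k - 1))
      (natCoord a ∘ rho) z _ := (hasMFDerivAt_natCoord (rho_mem_natSource.2 hz)).comp z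
    ((contMDiff_rho z).mdifferentiableAt (by simp)).hasMFDerivAt
  have hev : natCoord a ∘ rho =ᶠ[𝓝 z] T ∘ natCoord a := by
    filter_upwards [natSource_mem_nhds hz] with y hy
    exact natCoord_proj _ hy
  have h3 := hasMFDerivAt_unique h2 (h1.congr_of_eventuallyEq hev)
  exact congrArg (fun T => T v) h3

variable {L : HigherTangent n k Q → ℝ}

/-- The fibres of `ρ` are isotropic. -/
theorem omegaL_vertical (hL : ContMDiff 𝓘(ℝ, JetCoord n k) 𝓘(ℝ, ℝ) ∞ L)
    (z : HigherTangent n (2 * k - 1) Q) (v w : TangentSpace 𝓘(ℝ, JetCoord n (2 * k - 1)) z)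
    (hv : tangentAt (W := JetCoord n (k - 1)) rho z v = 0)
    (hw : tangentAt (W := JetCoord n (k - 1)) rho z w = 0) : omegaL L z v w = 0 := by
  have hz := mem_natSource_base z
  have key : ∀ u, tangentAt (W := JetCoord n (k - 1)) rho z u = 0 → ∀ r : Fin k,
      natTangent z.base z u ⟨r, by omega⟩ = 0 := by
    intro u hu r
    have h := natTangent_rho hz u
    rw [hu, map_zero] at h
    exact (congrFun h ⟨r, by omega⟩).symm
  rw [omegaL_apply hL hz, localOmega_apply]
  refine Finset.sum_eq_zero fun r _ => Finset.sum_eq_zero fun A _ => ?_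
  rw [key v hv, key w hw]
  simp

theorem hasDerivAt_natCoord_comp {X : (z : HigherTangent n m Q) → TangentSpace 𝓘(ℝ, JetCoord n m) z}
    {σ : ℝ → HigherTangent n m Q} {a : Q} {t : ℝ} (hσ : HasMFDerivAt 𝓘(ℝ, ℝ) 𝓘(ℝ, JetCoord n m) σ t
      ((1 : ℝ →L[ℝ] ℝ).smulRight (X (σ t)))) (ha : σ t ∈ natSource m a) :
    HasDerivAt (fun t => natCoord a (σ t)) (natTangent a (σ t) (X (σ t))) t := by
  have h1 := (hasMFDerivAt_natCoord ha).comp t hσ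
  have h2 : HasFDerivAt (natCoord a ∘ σ)
      ((natTangent a (σ t) : JetCoord n m →L[ℝ] JetCoord n m).comp
      ((1 : ℝ →L[ℝ] ℝ).smulRight (X (σ t) : JetCoord n m))) t := h1.hasFDerivAt
  have h3 := h2.hasDerivAt
  refine h3.congr_deriv ?_
  change natTangent a (σ t) ((1 : ℝ) • X (σ t)) = _
  rw [one_smul]

/-- Integral curves of the Lagrangian vector field are determined by their projections. -/
theorem eq_of_rho_comp_eventuallyEq (hk : 1 ≤ k) (hL : ContMDiff 𝓘(ℝ, JetCoord n k) 𝓘(ℝ, ℝ) ∞ L)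
    (hreg : IsRegularLagrangian L) (σ σ' : ℝ → HigherTangent n (2 * k - 1) Q) (t : ℝ)
    (hσ : IsMIntegralCurveAt σ (lagrangianVF hk L) t)
    (hσ' : IsMIntegralCurveAt σ' (lagrangianVF hk L) t) (h : rho ∘ σ =ᶠ[𝓝 t] rho ∘ σ') :
    σ t = σ' t := by
  have hbase : ∀ᶠ τ in 𝓝 t, (σ τ).base = (σ' τ).base := by
    filter_upwards [h] with τ hτ
    have h1 := congrArg HigherTangent.base hτ
    simpa only [Function.comp_apply, rho, base_proj] using h1
  set a := (σ t).base
  have ha : ∀ᶠ τ in 𝓝 t, σ τ ∈ natSource (2 * k - 1) a :=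
    hσ.continuousAt.preimage_mem_nhds (natSource_mem_nhds (mem_natSource_base _))
  have ha' : ∀ᶠ τ in 𝓝 t, σ' τ ∈ natSource (2 * k - 1) a := by
    filter_upwards [ha, hbase] with τ h1 h2
    change (σ' τ).base ∈ (chartAt 𝔼 a).source
    rw [← h2]
    exact h1
  have hd : ∀ (δ : ℝ → HigherTangent n (2 * k - 1) Q), IsMIntegralCurveAt δ (lagrangianVF hk L) t →
      (∀ᶠ τ in 𝓝 t, δ τ ∈ natSource (2 * k - 1) a) → ∀ (i : ℕ) (hi : i < 2 * k - 1), ∀ᶠ τ in 𝓝 t,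
      deriv (fun τ => natCoord a (δ τ) ⟨i, by omega⟩) τ = natCoord a (δ τ) ⟨i + 1, by omega⟩ := by
    intro δ hδ hδa i hi
    filter_upwards [hδ, hδa] with τ h1 h2
    rw [← natTangent_lagrangianVF_apply hk hL hreg h2 i hi]
    exact (hasDerivAt_pi.1 (hasDerivAt_natCoord_comp h1 h2) ⟨i, by omega⟩).deriv
  -- Induction along the semispray equations: each coordinate is the time derivative of the previous
  -- one. Equality of germs, not just of values, is what allows differentiation.
  have key : ∀ (i : ℕ) (hi : i < 2 * k - 1 + 1),
      (fun τ => natCoord a (σ τ) ⟨i, hi⟩) =ᶠ[𝓝 t] fun τ => natCoord a (σ' τ) ⟨i, hi⟩ := by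
    intro i
    induction i with
    | zero =>
      intro _
      filter_upwards [hbase] with τ hτ
      have h1 := natCoord_zero a (σ τ)
      have h2 := natCoord_zero a (σ' τ)
      rw [hτ, ← h2] at h1
      exact h1
    | succ i ih =>
      intro hi
      filter_upwards [(ih (by omega)).deriv, hd σ hσ ha i (by omega), hd σ' hσ' ha' i (by omega)]
        with τ h1 h2 h3
      rw [← h2, ← h3, h1]
  refine natCoord_injOn a ha.self_of_nhds ha'.self_of_nhds (funext fun i => ?_)
  exact (key i i.2).self_of_nhds

variable {s : HigherTangent n (k - 1) Q → HigherTangent n (2 * k - 1) Q}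

/-- All tangent spaces are the same model space, so the transport along `ρ (s x) = x` acts as the
identity. -/
theorem associatedVF_eq_retractTangent (hk : 1 ≤ k) (hsec : ∀ x, rho (s x) = x)
    (x : HigherTangent n (k - 1) Q) : associatedVF hk L s hsec x
      = retractTangent s rho x (lagrangianVF hk L (s x)) := by
  have key : ∀ (y : HigherTangent n (k - 1) Q) (h : y = x)
      (v : TangentSpace 𝓘(ℝ, JetCoord n (k - 1)) y),
      @Eq (JetCoord n (k - 1)) (h ▸ v : TangentSpace 𝓘(ℝ, JetCoord n (k - 1)) x) v := by
    rintro y rfl v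
    rfl
  exact key _ (hsec x) _

theorem isSmoothVF_associatedVF (hk : 1 ≤ k) (hL : ContMDiff 𝓘(ℝ, JetCoord n k) 𝓘(ℝ, ℝ) ∞ L)
    (hreg : IsRegularLagrangian L)
    (hs : ContMDiff 𝓘(ℝ, JetCoord n (k - 1)) 𝓘(ℝ, JetCoord n (2 * k - 1)) ∞ s)
    (hsec : ∀ x, rho (s x) = x) : IsSmoothVF (associatedVF hk L s hsec) := by
  have h1 := (contMDiff_rho (n := n) (k := k) (Q := Q)).contMDiff_tangentMap (m := ∞) (by simp)
  have h2 := h1.comp ((isSmoothVF_lagrangianVF hk hL hreg).comp hs)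
  have h3 : (fun x => (⟨x, associatedVF hk L s hsec x⟩ :
      TangentBundle 𝓘(ℝ, JetCoord n (k - 1)) (HigherTangent n (k - 1) Q)))
      = tangentMap 𝓘(ℝ, JetCoord n (2 * k - 1)) 𝓘(ℝ, JetCoord n (k - 1)) rho ∘
        (fun z => (⟨z, lagrangianVF hk L z⟩ :
          TangentBundle 𝓘(ℝ, JetCoord n (2 * k - 1)) (HigherTangent n (2 * k - 1) Q))) ∘ s := by
    have key : ∀ (x y : HigherTangent n (k - 1) Q) (h : y = x)
        (v : TangentSpace 𝓘(ℝ, JetCoord n (k - 1)) y),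
        (⟨x, h ▸ v⟩ : TangentBundle 𝓘(ℝ, JetCoord n (k - 1)) (HigherTangent n (k - 1) Q))
          = ⟨y, v⟩ := by
      rintro x y rfl v
      rfl
    funext x
    exact key x _ (hsec x) _
  unfold IsSmoothVF
  rw [h3]
  exact h2

/-- The pull-back of the Poincaré-Cartan 1-form by an isotropic section is locally exact. -/
theorem hasLocalPotentials_pullbackOne (hL : ContMDiff 𝓘(ℝ, JetCoord n k) 𝓘(ℝ, ℝ) ∞ L)
    (hs : ContMDiff 𝓘(ℝ, JetCoord n (k - 1)) 𝓘(ℝ, JetCoord n (2 * k - 1)) ∞ s)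
    (h : ∀ x, pullbackTwo (V := JetCoord n (k - 1)) s (omegaL L) x = 0) :
    HasLocalPotentials (pullbackOne (V := JetCoord n (k - 1)) s (thetaL L)) := by
  have hsd : MDifferentiable 𝓘(ℝ, JetCoord n (k - 1)) 𝓘(ℝ, JetCoord n (2 * k - 1)) s :=
    hs.mdifferentiable (by simp)
  have hPa : ∀ (a : Q) (i : Fin k × Fin n),
      ContMDiffOn 𝓘(ℝ, JetCoord n (2 * k - 1)) 𝓘(ℝ, ℝ) ∞ (momentum L a i.1 i.2)
        (natSource (2 * k - 1) a) := by
    intro a i z hz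
    have h1 : ContMDiffAt 𝓘(ℝ, JetCoord n (2 * k - 1)) 𝓘(ℝ, ℝ) ∞
        (localMomentum (localLagrangian L a) i.1 i.2 ∘ natCoord a) z :=
      ContMDiffAt.comp z ((contDiffOn_localMomentum (chartAt 𝔼 a).open_target
        (contDiffOn_localLagrangian hL a) i.1 i.2).contDiffAt
        ((isOpen_jetDomain (chartAt 𝔼 a).open_target).mem_nhds
          (natCoord_mem_jetDomain hz))).contMDiffAt (contMDiffAt_natCoord hz)
    exact h1.contMDiffWithinAt
  have hRa : ∀ (a : Q) (i : Fin k × Fin n),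
      ContMDiffOn 𝓘(ℝ, JetCoord n (2 * k - 1)) 𝓘(ℝ, ℝ) ∞
        (coordFun a (⟨i.1, by omega⟩ : Fin (2 * k - 1 + 1)) i.2) (natSource (2 * k - 1) a) := by
    intro a i z hz
    have h1 : ContMDiffAt 𝓘(ℝ, JetCoord n (2 * k - 1)) 𝓘(ℝ, ℝ) ∞
        (coordCLM n (2 * k - 1) ⟨i.1, by omega⟩ i.2 ∘ natCoord a) z :=
      ContMDiffAt.comp z (coordCLM n (2 * k - 1) ⟨i.1, by omega⟩ i.2).contDiff.contMDiff.contMDiffAt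
        (contMDiffAt_natCoord hz)
    exact h1.contMDiffWithinAt
  have hdiff : ∀ {a : Q} {f : HigherTangent n (2 * k - 1) Q → ℝ},
      ContMDiffOn 𝓘(ℝ, JetCoord n (2 * k - 1)) 𝓘(ℝ, ℝ) ∞ f (natSource (2 * k - 1) a) →
      ∀ y, s y ∈ natSource (2 * k - 1) a → ∀ v,
      differential (V := JetCoord n (k - 1)) (f ∘ s) y v
        = differential (V := JetCoord n (2 * k - 1)) f (s y)
          (tangentAt (V := JetCoord n (k - 1)) (W := JetCoord n (2 * k - 1)) s y v) := by
    intro a f hf y hy v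
    rw [differential, mfderiv_comp y
      ((hf.contMDiffAt (natSource_mem_nhds hy)).mdifferentiableAt (by simp)) (hsd y)]
    rfl
  refine hasLocalPotentials_of_closed (ι := Fin k × Fin n)
    (U := fun x => s ⁻¹' natSource (2 * k - 1) (s x).base)
    (P := fun x i => momentum L (s x).base i.1 i.2 ∘ s)
    (R := fun x i => coordFun (s x).base ⟨i.1, by omega⟩ i.2 ∘ s)
    (fun x => (isOpen_natSource _).preimage hs.continuous) (fun x => mem_natSource_base (s x))
    (fun x i => (hPa _ i).comp hs.contMDiffOn fun y hy => hy)
    (fun x i => (hRa _ i).comp hs.contMDiffOn fun y hy => hy) ?_ ?_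
  · intro x y hy v
    have h1 := thetaL_apply hL hy (tangentAt (V := JetCoord n (k - 1)) s y v)
    refine h1.trans ?_
    rw [Fintype.sum_prod_type]
    refine Finset.sum_congr rfl fun r _ => Finset.sum_congr rfl fun A _ => ?_
    rw [hdiff (hRa _ (r, A)) y hy, differential_coordFun hy]
    rfl
  · intro x y hy v w
    -- Isotropy of the section, evaluated on `(w, v)` because of the sign in `ω_L = -dθ_L`, is
    -- exactly closedness of the pulled-back 1-form.
    have h1 : omegaL L (s y) (tangentAt (V := JetCoord n (k - 1)) s y w)
        (tangentAt (V := JetCoord n (k - 1)) s y v) = 0 :=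
      congrArg (fun T => T w v) (h y)
    rw [omegaL_apply hL hy, localOmega_apply] at h1
    rw [Fintype.sum_prod_type]
    refine Eq.trans ?_ h1
    refine Finset.sum_congr rfl fun r _ => Finset.sum_congr rfl fun A _ => ?_
    simp only [hdiff (hPa _ (r, A)) y hy, hdiff (hRa _ (r, A)) y hy, differential_coordFun hy,
      differential_momentum hL hy]
    ring

end HamiltonJacobi

end HJ

theorem mainTheorem9 (n k : ℕ) (hk : 1 ≤ k) (Q : Type*) [TopologicalSpace Q]
    [ChartedSpace (EuclideanSpace ℝ (Fin n)) Q] [IsManifold (𝓡 n) ∞ Q] [T2Space Q]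
    [SecondCountableTopology Q]
    (L : HigherTangent n k Q → ℝ) (hL : ContMDiff 𝓘(ℝ, JetCoord n k) 𝓘(ℝ, ℝ) ∞ L)
    (hreg : IsRegularLagrangian L)
    (s : HigherTangent n (k - 1) Q → HigherTangent n (2 * k - 1) Q)
    (hs : ContMDiff 𝓘(ℝ, JetCoord n (k - 1)) 𝓘(ℝ, JetCoord n (2 * k - 1)) ∞ s)
    (hsec : ∀ x, rho (s x) = x) :
    -- the generalized problem, for a pair `(s, X)`
    (∀ X : (x : HigherTangent n (k - 1) Q) → TangentSpace 𝓘(ℝ, JetCoord n (k - 1)) x,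
      IsSmoothVF X →
      List.TFAE [
        MapsIntegralCurves s X (lagrangianVF hk L),
        AreRelated s X (lagrangianVF hk L),
        X = associatedVF hk L s hsec ∧
          IsTangentToImage (V := JetCoord n (k - 1)) s (lagrangianVF hk L),
        X = associatedVF hk L s hsec ∧ IsFlowInvariant (Set.range s) (lagrangianVF hk L),
        ProjectsIntegralCurves rho (Set.range s) (lagrangianVF hk L) X,
        X = associatedVF hk L s hsec ∧
          ∀ x, pullbackTwo (V := JetCoord n (k - 1)) s (omegaL L) x (X x) =
            differential (V := JetCoord n (k - 1)) (energyL hk L ∘ s) x]) ∧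
    -- the generalized problem, for the section alone
    List.TFAE [
      ∃ X : (x : HigherTangent n (k - 1) Q) → TangentSpace 𝓘(ℝ, JetCoord n (k - 1)) x,
        IsSmoothVF X ∧ MapsIntegralCurves s X (lagrangianVF hk L),
      IsTangentToImage (V := JetCoord n (k - 1)) s (lagrangianVF hk L),
      IsFlowInvariant (Set.range s) (lagrangianVF hk L),
      ∀ x, pullbackTwo (V := JetCoord n (k - 1)) s (omegaL L) x (associatedVF hk L s hsec x) =
        differential (V := JetCoord n (k - 1)) (energyL hk L ∘ s) x] ∧
    -- the Hamilton-Jacobi problem, with `s^* ω_L = 0`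
    List.TFAE [
      (∃ X : (x : HigherTangent n (k - 1) Q) → TangentSpace 𝓘(ℝ, JetCoord n (k - 1)) x,
        IsSmoothVF X ∧ MapsIntegralCurves s X (lagrangianVF hk L)) ∧
        ∀ x, pullbackTwo (V := JetCoord n (k - 1)) s (omegaL L) x = 0,
      IsLagrangianImage (V := JetCoord n (k - 1)) s (omegaL L) ∧
        IsTangentToImage (V := JetCoord n (k - 1)) s (lagrangianVF hk L) ∧
        HasLocalPotentials (pullbackOne (V := JetCoord n (k - 1)) s (thetaL L)),
      IsLagrangianImage (V := JetCoord n (k - 1)) s (omegaL L) ∧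
        IsFlowInvariant (Set.range s) (lagrangianVF hk L),
      (∀ x, pullbackTwo (V := JetCoord n (k - 1)) s (omegaL L) x = 0) ∧
        ∀ x, differential (V := JetCoord n (k - 1)) (energyL hk L ∘ s) x = 0,
      (∀ x, pullbackTwo (V := JetCoord n (k - 1)) s (omegaL L) x = 0) ∧
        IsLocallyConstant (energyL hk L ∘ s)] := by
  have hsd : MDifferentiable 𝓘(ℝ, JetCoord n (k - 1)) 𝓘(ℝ, JetCoord n (2 * k - 1)) s :=
    hs.mdifferentiable (by simp)
  have hρ := contMDiff_rho (n := n) (k := k) (Q := Q)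
  have hρd := hρ.mdifferentiable (by simp)
  have hY := isSmoothVF_lagrangianVF hk hL hreg
  have hZs := isSmoothVF_associatedVF hk hL hreg hs hsec
  have hZ := associatedVF_eq_retractTangent (L := L) hk hsec
  have hvert := omegaL_vertical hL
  have hEd : MDifferentiable 𝓘(ℝ, JetCoord n (2 * k - 1)) 𝓘(ℝ, ℝ) (energyL hk L) :=
    (contMDiff_energyL hk hL).mdifferentiable (by simp)
  have hEs : MDifferentiable 𝓘(ℝ, JetCoord n (k - 1)) 𝓘(ℝ, ℝ) (energyL hk L ∘ s) := hEd.comp hsd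
  have hYE := omegaL_lagrangianVF hk hL hreg
  have hmaps : ∀ X : (x : HigherTangent n (k - 1) Q) → TangentSpace 𝓘(ℝ, JetCoord n (k - 1)) x,
      IsSmoothVF X → (MapsIntegralCurves s X (lagrangianVF hk L) ↔
        AreRelated s X (lagrangianVF hk L)) := fun X hX =>
    mapsIntegralCurves_iff_areRelated hsd hX _
  have huniq : ∀ X, AreRelated s X (lagrangianVF hk L) → X = associatedVF hk L s hsec := fun X h =>
    eq_of_areRelated hsd hρd hsec hZ h
  have htan := isTangentToImage_iff_areRelated hsd hρd hsec hZ
  have hinv : IsFlowInvariant (Set.range s) (lagrangianVF hk L) ↔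
      AreRelated s (associatedVF hk L s hsec) (lagrangianVF hk L) :=
    ⟨fun h => htan.1 (isTangentToImage_of_isFlowInvariant hsd hρd hsec hY h),
      isFlowInvariant_of_areRelated hsd hρ.continuous hsec hY hZs⟩
  have hpull := areRelated_iff_pullbackTwo hsd hρd hsec hreg hvert hEd hYE hZ
  have hlag := isLagrangianImage_iff hsd hρd hsec hreg hvert
  -- Only `X_s` can solve the problem and it is smooth, so the existential reduces to one relation.
  have hex : (∃ X : (x : HigherTangent n (k - 1) Q) → TangentSpace 𝓘(ℝ, JetCoord n (k - 1)) x,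
      IsSmoothVF X ∧ MapsIntegralCurves s X (lagrangianVF hk L)) ↔
      AreRelated s (associatedVF hk L s hsec) (lagrangianVF hk L) := by
    refine ⟨?_, fun h => ⟨_, hZs, (hmaps _ hZs).2 h⟩⟩
    rintro ⟨X, hX, h⟩
    have h1 := (hmaps X hX).1 h
    rwa [huniq X h1] at h1
  have hpull0 : (∀ x, pullbackTwo (V := JetCoord n (k - 1)) s (omegaL L) x = 0) →
      (AreRelated s (associatedVF hk L s hsec) (lagrangianVF hk L) ↔
        ∀ x, differential (V := JetCoord n (k - 1)) (energyL hk L ∘ s) x = 0) := by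
    intro h0
    rw [hpull]
    refine forall_congr' fun x => ?_
    rw [h0 x, LinearMap.zero_apply, eq_comm]
  have hconst := isLocallyConstant_iff_differential_eq_zero hEs
  refine ⟨fun X hX => ?_, ?_, ?_⟩
  -- Relatedness already forces `X = X_s`, so each equivalence proved for `X_s` yields one with that
  -- equality as an explicit conjunct.
  · have hXrel : ∀ {p : Prop},
        (AreRelated s (associatedVF hk L s hsec) (lagrangianVF hk L) ↔ p) →
        (AreRelated s X (lagrangianVF hk L) ↔ X = associatedVF hk L s hsec ∧ p) := by
      intro p hp
      refine ⟨fun h => ?_, ?_⟩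
      · obtain rfl := huniq X h
        exact ⟨rfl, hp.1 h⟩
      · rintro ⟨rfl, h⟩
        exact hp.2 h
    tfae_have 1 ↔ 2 := hmaps X hX
    tfae_have 2 ↔ 3 := hXrel htan.symm
    tfae_have 2 ↔ 4 := hXrel hinv.symm
    tfae_have 2 → 5 := fun h => projectsIntegralCurves_of_areRelated hsd hρd hsec
      (isFlowInvariant_of_areRelated hsd hρ.continuous hsec hY hX h) h
    tfae_have 5 → 2 := areRelated_of_projectsIntegralCurves hsd hρd hsec hY hX
      (eq_of_rho_comp_eventuallyEq hk hL hreg)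
    tfae_have 2 ↔ 6 := by
      refine (hXrel hpull).trans (and_congr_right ?_)
      rintro rfl
      rfl
    tfae_finish
  · tfae_have 1 ↔ 4 := hex.trans hpull
    tfae_have 2 ↔ 4 := htan.trans hpull
    tfae_have 3 ↔ 4 := hinv.trans hpull
    tfae_finish
  · tfae_have 1 → 2 := fun h => ⟨hlag.2 h.2, htan.2 (hex.1 h.1),
      hasLocalPotentials_pullbackOne hL hs h.2⟩
    tfae_have 2 → 3 := fun h => ⟨h.1, hinv.2 (htan.1 h.2.1)⟩
    tfae_have 3 → 4 := fun h => ⟨hlag.1 h.1, (hpull0 (hlag.1 h.1)).1 (hinv.1 h.2)⟩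
    tfae_have 4 → 1 := fun h => ⟨hex.2 ((hpull0 h.1).2 h.2), h.1⟩
    tfae_have 4 ↔ 5 := and_congr_right fun _ => hconst
    tfae_finish
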